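/- Let $n\ge 2$ and $k\ge 1$ be integers. Let $M_{n,k}=\mathbb P(H^{-k}\oplus 1)\to\mathbb{CP}^{n-1}$ be the Hirzebruch manifold, where $H$ is the hyperplane bundle; let $g_0$ be the Fubini–Study metric on $\mathbb{CP}^{n-1}$ with $\mathrm{Ric}(g_0)=g_0$, and let $|\cdot|$ be the norm on $H^{-k}$ induced by the standard Hermitian metric of $\mathbb C^n$. A function $\phi$ on $[-c,c]$ is said to generate a metric $g$ on $M_{n,k}$ if, on the complement $H^{-k}\setminus 0$ of the zero and infinity sections, $$ g=\pi^*\Big(\big(1+\tfrac kn U\big)g_0\Big)+dt^2+(dt\circ J)^2, $$ where $J$ is the complex structure and $t$, $U$ are functions of $s=\log|v|$, $v\in H^{-k}\setminus 0$, such that $\frac{dt}{ds}=\sqrt{\phi(U)}$, $\frac{dU}{ds}=\phi(U)$, $U=0$ exactly where $t=0$, and the range of $U$ is $(-c,c)$. The holomorphic sectional curvature of a Kähler metric $g$ is $H(X)=R(X,JX,JX,X)/|X|^4$ for tangent vectors $X\neq 0$, with $R$ the Riemannian curvature tensor. Set $\varepsilon_p=\frac{2n}{2p+2k-1}$ for $p\in\mathbb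 N$. Then $\varepsilon_p\to 0$ as $p\to\infty$, and there is $p_0=p_0(n,k)\in\mathbb N$ such that $\varepsilon_p>0$ for all $p\ge p_0$ and the following holds. For every real $c>0$ such that $c\le \frac nk-2\varepsilon_q$ for some integer $q\ge p_0$, there is an integer $p_1=p_1(n,k,c)>p_0$ such that for every integer $p\ge p_1$ there exist $\delta_1>0$ and $\delta_2>0$ such that, for every $\alpha_2\in(0,\delta_1)$ and with $\mu=\frac cp+\delta_2$, the even polynomial $$ \phi(x)=\mu-\alpha_2x^2-\alpha_{2p-2}x^{2p-2}-\alpha_{2p}x^{2p},\qquad x\in[-c,c], $$ $$ \alpha_{2p-2}=\frac{p\mu-c-(p-1)\alpha_2c^2}{c^{2p-2}},\qquad \alpha_{2p}=\frac{c-(p-1)\mu+(p-2)\alpha_2c^2}{c^{2p}}, $$ generates a smooth $U(n)$-invariant Kähler metric on $M_{n,k}$ whose holomorphic sectional curvature is positive at every point and in every direction. -/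

import Mathlib

open scoped Manifold ContDiff Topology

noncomputable section

namespace Hirzebruch

/-! ### The Hirzebruch manifold as a complex manifold -/

/-- Homogeneous coordinates `(Z, a, b)` of a point of `ℙ(H^{-k} ⊕ 1)` over `ℂℙ^{n-1}`: the point
`[a Z^{⊗k} : b]` of the fibre over the line spanned by `Z`. -/
structure Coord (n : ℕ) where
  Z : Fin n → ℂ
  a : ℂ
  b : ℂ
  Z_ne : Z ≠ 0
  ab_ne : a ≠ 0 ∨ b ≠ 0

/-- `(Z, a, b)` and `(λ Z, μ λ^{-k} a, μ b)` are the same point, for all nonzero `λ` and `μ`. -/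
def coordSetoid (n k : ℕ) : Setoid (Coord n) where
  r p q := ∃ l m : ℂˣ, q.Z = (l : ℂ) • p.Z ∧ (l : ℂ) ^ k * q.a = m * p.a ∧ q.b = m * p.b
  iseqv :=
    { refl := fun p => ⟨1, 1, by simp⟩
      symm := by
        rintro p q ⟨l, m, h1, h2, h3⟩
        refine ⟨l⁻¹, m⁻¹, ?_, ?_, ?_⟩
        · rw [h1, smul_smul]; simp
        · have hl := l.ne_zero
          have hm := m.ne_zero
          have hl' := pow_ne_zero k hl
          simp only [Units.val_inv_eq_inv_val, inv_pow]
          field_simp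
          linear_combination -h2
        · rw [h3]; simp
      trans := by
        rintro p q r ⟨l, m, h1, h2, h3⟩ ⟨l', m', h1', h2', h3'⟩
        refine ⟨l' * l, m' * m, ?_, ?_, ?_⟩
        · rw [h1', h1, smul_smul]; simp
        · simp only [Units.val_mul]
          linear_combination (l : ℂ) ^ k * h2' + (m' : ℂ) * h2
        · rw [h3', h3]; simp only [Units.val_mul]; ring }

/-- The Hirzebruch manifold `M_{n,k} = ℙ(H^{-k} ⊕ 1)` over `ℂℙ^{n-1}`. -/
def Manifold (n k : ℕ) : Type := Quotient (coordSetoid n k)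

/-- The point with given homogeneous coordinates. -/
def mk {n : ℕ} (k : ℕ) (p : Coord n) : Manifold n k := Quotient.mk (coordSetoid n k) p

/-- Inhomogeneous fibre coordinate over `{Z i ≠ 0}`: `a (Z i)^k / b` or its inverse. -/
def fibreCoord {n : ℕ} (k : ℕ) (i : Fin n) (inf : Bool) (p : Coord n) : ℂ :=
  bif inf then p.b / (p.a * p.Z i ^ k) else p.a * p.Z i ^ k / p.b

/-- The map of the chart `(i, inf)`: the coordinates with index `j ≠ i` are `Z j / Z i`, and the
coordinate with index `i` is the fibre coordinate. -/
def chartFun (n k : ℕ) (i : Fin n) (inf : Bool) : Manifold n k → (Fin n → ℂ) :=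
  Quotient.lift
    (fun p : Coord n => Function.update (fun j => p.Z j / p.Z i) i (fibreCoord k i inf p)) (by
      rintro p q ⟨l, m, h1, h2, h3⟩
      have hl := l.ne_zero
      have hm := m.ne_zero
      have e1 : (fun j => p.Z j / p.Z i) = fun j => q.Z j / q.Z i := by
        funext j
        simp only [h1, Pi.smul_apply, smul_eq_mul, mul_div_mul_left _ _ hl]
      have e2 : q.a * q.Z i ^ k = m * (p.a * p.Z i ^ k) := by
        simp only [h1, Pi.smul_apply, smul_eq_mul, mul_pow]
        linear_combination p.Z i ^ k * h2
      have e3 : fibreCoord k i inf p = fibreCoord k i inf q := by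
        unfold fibreCoord
        cases inf <;> simp only [cond_true, cond_false, e2, h3, mul_div_mul_left _ _ hm]
      simp only [e1, e3])

/-- The domain of the chart `(i, inf)`: `{Z i ≠ 0, b ≠ 0}` or `{Z i ≠ 0, a ≠ 0}`. -/
def chartSource (n k : ℕ) (i : Fin n) (inf : Bool) : Set (Manifold n k) :=
  {x | Quotient.liftOn x
    (fun p : Coord n => p.Z i ≠ 0 ∧ (bif inf then p.a else p.b) ≠ 0) (by
      rintro p q ⟨l, m, h1, h2, h3⟩
      have hl := l.ne_zero
      have hm := m.ne_zero
      have ha : q.a ≠ 0 ↔ p.a ≠ 0 := by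
        have : q.a = 0 ↔ p.a = 0 := by
          constructor
          · intro h
            rw [h, mul_zero] at h2
            exact (mul_eq_zero.1 h2.symm).resolve_left hm
          · intro h
            rw [h, mul_zero] at h2
            exact (mul_eq_zero.1 h2).resolve_left (pow_ne_zero _ hl)
        exact not_congr this
      cases inf <;> simp [h1, h3, ha])}

/-- Coordinates of the point with coordinate vector `y` in the chart `(i, inf)`:
`Z` is `y` with its `i`-th entry replaced by `1`. -/
def paramCoord (n : ℕ) (i : Fin n) (inf : Bool) (y : Fin n → ℂ) : Coord n where
  Z := Function.update y i 1
  a := bif inf then 1 else y i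
  b := bif inf then y i else 1
  Z_ne := fun h => by simpa using congrFun h i
  ab_ne := by cases inf <;> simp

/-- The inverse of the chart `(i, inf)`. -/
def param (n k : ℕ) (i : Fin n) (inf : Bool) (y : Fin n → ℂ) : Manifold n k :=
  mk k (paramCoord n i inf y)

theorem chartFun_param (n k : ℕ) (i : Fin n) (inf : Bool) (y : Fin n → ℂ) :
    chartFun n k i inf (param n k i inf y) = y := by
  change Function.update (fun j => Function.update y i 1 j / Function.update y i 1 i) i
    (fibreCoord k i inf (paramCoord n i inf y)) = y
  funext j
  by_cases h : j = i
  · subst h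
    cases inf <;> simp [fibreCoord, paramCoord]
  · simp [h]

theorem param_mem (n k : ℕ) (i : Fin n) (inf : Bool) (y : Fin n → ℂ) :
    param n k i inf y ∈ chartSource n k i inf := by
  change Function.update y i 1 i ≠ 0 ∧
    (bif inf then (paramCoord n i inf y).a else (paramCoord n i inf y).b) ≠ 0
  cases inf <;> simp [paramCoord]

theorem param_chartFun (n k : ℕ) (i : Fin n) (inf : Bool) (x : Manifold n k)
    (hx : x ∈ chartSource n k i inf) : param n k i inf (chartFun n k i inf x) = x := by
  induction x using Quotient.inductionOn with
  | h p =>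
  obtain ⟨h1, h2⟩ : p.Z i ≠ 0 ∧ (bif inf then p.a else p.b) ≠ 0 := hx
  have hZ : (p.Z i) • (Function.update (Function.update (fun j => p.Z j / p.Z i) i
      (fibreCoord k i inf p)) i 1) = p.Z := by
    funext j
    by_cases h : j = i
    · subst h; simp
    · simp only [Pi.smul_apply, smul_eq_mul, Function.update_idem, ne_eq, h, not_false_eq_true,
        Function.update_of_ne]
      field_simp
  apply Quotient.sound
  cases inf
  · have h2' : p.b ≠ 0 := by simpa using h2
    refine ⟨Units.mk0 _ h1, Units.mk0 _ h2', hZ.symm, ?_, ?_⟩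
    · have e : chartFun n k i false ⟦p⟧ i = p.a * p.Z i ^ k / p.b := by
        change Function.update (fun j => p.Z j / p.Z i) i (fibreCoord k i false p) i = _
        rw [Function.update_self]; rfl
      simp only [paramCoord, cond_false, e, Units.val_mk0]
      field_simp
    · simp [paramCoord]
  · have h2' : p.a ≠ 0 := by simpa using h2
    refine ⟨Units.mk0 _ h1, Units.mk0 _ (mul_ne_zero (pow_ne_zero k h1) h2'), hZ.symm, ?_, ?_⟩
    · simp [paramCoord]
    · have e : chartFun n k i true ⟦p⟧ i = p.b / (p.a * p.Z i ^ k) := by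
        change Function.update (fun j => p.Z j / p.Z i) i (fibreCoord k i true p) i = _
        rw [Function.update_self]; rfl
      simp only [paramCoord, cond_true, e, Units.val_mk0]
      field_simp

/-- The chart `(i, inf)` as a bijection onto `ℂ^n`. -/
def chartEquiv (n k : ℕ) (i : Fin n) (inf : Bool) : PartialEquiv (Manifold n k) (Fin n → ℂ) where
  toFun := chartFun n k i inf
  invFun := param n k i inf
  source := chartSource n k i inf
  target := Set.univ
  map_source' := fun _ _ => Set.mem_univ _
  map_target' := fun y _ => param_mem n k i inf y
  left_inv' := fun x hx => param_chartFun n k i inf x hx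
  right_inv' := fun y _ => chartFun_param n k i inf y

theorem transition_source (n k : ℕ) (i j : Fin n) (inf inf' : Bool) :
    ((chartEquiv n k i inf).symm.trans (chartEquiv n k j inf')).source =
      {y | Function.update y i 1 j ≠ 0 ∧
        (bif inf' then (bif inf then 1 else y i) else (bif inf then y i else 1)) ≠ 0} := by
  ext y
  rw [PartialEquiv.trans_source]
  change (True ∧ param n k i inf y ∈ chartSource n k j inf') ↔ _
  rw [true_and]
  rfl

theorem transition_apply (n k : ℕ) (i j : Fin n) (inf inf' : Bool) (y : Fin n → ℂ) :
    (chartEquiv n k i inf).symm.trans (chartEquiv n k j inf') y =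
      Function.update (fun l => Function.update y i 1 l / Function.update y i 1 j) j
        (fibreCoord k j inf' (paramCoord n i inf y)) := rfl

theorem contDiff_update_one (n : ℕ) (i j : Fin n) :
    ContDiff ℂ ω (fun y : Fin n → ℂ => Function.update y i (1 : ℂ) j) := by
  by_cases h : j = i
  · subst h; simpa using contDiff_const
  · simpa [h] using contDiff_apply ℂ ℂ j

theorem isOpen_transition_source (n k : ℕ) (i j : Fin n) (inf inf' : Bool) :
    IsOpen ((chartEquiv n k i inf).symm.trans (chartEquiv n k j inf')).source := by
  rw [transition_source]
  refine (isOpen_ne_fun (contDiff_update_one n i j).continuous continuous_const).inter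
    (isOpen_ne_fun ?_ continuous_const)
  cases inf <;> cases inf' <;> simp <;> fun_prop

theorem contDiffOn_transition (n k : ℕ) (i j : Fin n) (inf inf' : Bool) :
    ContDiffOn ℂ ω ((chartEquiv n k i inf).symm.trans (chartEquiv n k j inf'))
      ((chartEquiv n k i inf).symm.trans (chartEquiv n k j inf')).source := by
  rw [transition_source]
  have hu : ∀ l, ContDiff ℂ ω (fun y : Fin n → ℂ => Function.update y i (1 : ℂ) l) :=
    contDiff_update_one n i
  have hy : ContDiff ℂ ω (fun y : Fin n → ℂ => y i) := contDiff_apply ℂ ℂ i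
  have hk := (hu j).pow k
  refine contDiffOn_pi.2 fun l => ?_
  by_cases h : l = j
  · subst h
    simp only [transition_apply, Function.update_self, fibreCoord, paramCoord]
    cases inf <;> cases inf' <;> simp only [cond_true, cond_false]
    · simpa using (hy.mul hk).contDiffOn
    · refine contDiffOn_const.div (hy.mul hk).contDiffOn fun y hy' => ?_
      exact mul_ne_zero hy'.2 (pow_ne_zero _ hy'.1)
    · refine (contDiff_const.mul hk).contDiffOn.div hy.contDiffOn fun y hy' => hy'.2
    · refine hy.contDiffOn.div (contDiff_const.mul hk).contDiffOn fun y hy' => ?_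
      exact mul_ne_zero one_ne_zero (pow_ne_zero _ hy'.1)
  · simp only [transition_apply, ne_eq, h, not_false_eq_true, Function.update_of_ne]
    exact (hu l).contDiffOn.div (hu j).contDiffOn fun y hy' => hy'.1

theorem exists_mem_chartSource (n k : ℕ) (x : Manifold n k) :
    ∃ c : Fin n × Bool, x ∈ chartSource n k c.1 c.2 := by
  induction x using Quotient.inductionOn with
  | h p =>
  obtain ⟨i, hi⟩ := Function.ne_iff.1 p.Z_ne
  rcases p.ab_ne with h | h
  · exact ⟨(i, true), hi, h⟩
  · exact ⟨(i, false), hi, h⟩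

/-- The `2n` charts `(i, inf)` on the set `M_{n,k}`. -/
def chartedCore (n k : ℕ) : ChartedSpaceCore (Fin n → ℂ) (Manifold n k) where
  atlas := Set.range fun c : Fin n × Bool => chartEquiv n k c.1 c.2
  chartAt x := chartEquiv n k (exists_mem_chartSource n k x).choose.1
    (exists_mem_chartSource n k x).choose.2
  mem_chart_source x := (exists_mem_chartSource n k x).choose_spec
  chart_mem_atlas _ := ⟨_, rfl⟩
  open_source := by
    rintro _ _ ⟨c, rfl⟩ ⟨c', rfl⟩
    exact isOpen_transition_source n k c.1 c'.1 c.2 c'.2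
  continuousOn_toFun := by
    rintro _ _ ⟨c, rfl⟩ ⟨c', rfl⟩
    exact (contDiffOn_transition n k c.1 c'.1 c.2 c'.2).continuousOn

instance (n k : ℕ) : TopologicalSpace (Manifold n k) := (chartedCore n k).toTopologicalSpace

/-- The chart `(i, inf)` of `M_{n,k}`; its image is all of `ℂ^n`. -/
def chart (n k : ℕ) (i : Fin n) (inf : Bool) :
    OpenPartialHomeomorph (Manifold n k) (Fin n → ℂ) :=
  (chartedCore n k).openPartialHomeomorph (chartEquiv n k i inf) ⟨(i, inf), rfl⟩

instance (n k : ℕ) : ChartedSpace (Fin n → ℂ) (Manifold n k) where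
  atlas := Set.range fun c : Fin n × Bool => chart n k c.1 c.2
  chartAt x := chart n k (exists_mem_chartSource n k x).choose.1
    (exists_mem_chartSource n k x).choose.2
  mem_chart_source x := (exists_mem_chartSource n k x).choose_spec
  chart_mem_atlas _ := ⟨_, rfl⟩

/-- `M_{n,k}` is a complex manifold. -/
instance (n k : ℕ) : IsManifold 𝓘(ℂ, Fin n → ℂ) ω (Manifold n k) := by
  refine isManifold_of_contDiffOn _ _ _ ?_
  rintro _ _ ⟨c, rfl⟩ ⟨c', rfl⟩
  rw [modelWithCornersSelf_coe, modelWithCornersSelf_coe_symm, Set.range_id, Set.preimage_id,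
    Set.inter_univ]
  exact contDiffOn_transition n k c.1 c'.1 c.2 c'.2

/-- The underlying smooth real manifold. -/
instance (n k : ℕ) : IsManifold 𝓘(ℝ, Fin n → ℂ) ∞ (Manifold n k) := by
  refine isManifold_of_contDiffOn _ _ _ ?_
  rintro _ _ ⟨c, rfl⟩ ⟨c', rfl⟩
  rw [modelWithCornersSelf_coe, modelWithCornersSelf_coe_symm, Set.range_id, Set.preimage_id,
    Set.inter_univ]
  exact ((contDiffOn_transition n k c.1 c'.1 c.2 c'.2).restrict_scalars ℝ).of_le le_top

instance (n k : ℕ) : IsManifold 𝓘(ℝ, Fin n → ℂ) 1 (Manifold n k) :=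
  IsManifold.of_le (n := ∞) (by simp)

/-! ### Riemannian metrics, the Kähler condition, holomorphic sectional curvature -/

/-- Smooth Riemannian metrics on `M_{n,k}`. -/
abbrev Metric (n k : ℕ) :=
  Bundle.ContMDiffRiemannianMetric 𝓘(ℝ, Fin n → ℂ) ∞ (Fin n → ℂ)
    (fun x : Manifold n k => TangentSpace 𝓘(ℝ, Fin n → ℂ) x)

/-- The expression of a metric in the chart `(i, inf)`, i.e. its pullback under the inverse of
the chart. -/
def Metric.inChart {n k : ℕ} (g : Metric n k) (i : Fin n) (inf : Bool) (y : Fin n → ℂ) :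
    (Fin n → ℂ) →L[ℝ] (Fin n → ℂ) →L[ℝ] ℝ :=
  let D : (Fin n → ℂ) →L[ℝ] (Fin n → ℂ) :=
    mfderiv 𝓘(ℝ, Fin n → ℂ) 𝓘(ℝ, Fin n → ℂ) (chart n k i inf).symm y
  let G : (Fin n → ℂ) →L[ℝ] (Fin n → ℂ) →L[ℝ] ℝ := g.inner ((chart n k i inf).symm y)
  G.bilinearComp D D

section Local

variable {n : ℕ} (G : (Fin n → ℂ) → (Fin n → ℂ) →L[ℝ] (Fin n → ℂ) →L[ℝ] ℝ)

/-- `G` is Hermitian for the standard complex structure of `ℂ^n`, and its fundamental form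
`ω(X, Y) = G(iX, Y)` is closed. -/
def IsKahlerOn : Prop :=
  (∀ y X Y, G y (Complex.I • X) (Complex.I • Y) = G y X Y) ∧
  ∀ y X Y Z, fderiv ℝ G y X (Complex.I • Y) Z + fderiv ℝ G y Y (Complex.I • Z) X +
    fderiv ℝ G y Z (Complex.I • X) Y = 0

/-- The Christoffel symbol `Γ(X, Y)` of the Levi-Civita connection, determined by
`2 G(Γ(X, Y), Z) = (D_X G)(Y, Z) + (D_Y G)(X, Z) - (D_Z G)(X, Y)` for all `Z`. -/
def christoffel (y X Y : Fin n → ℂ) : Fin n → ℂ :=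
  (G y).inverse ((1 / 2 : ℝ) •
    (fderiv ℝ G y X Y + fderiv ℝ G y Y X - ((fderiv ℝ G y).flip X).flip Y))

/-- The Riemannian curvature operator `R(X, Y) Z` for
`R(X, Y) = ∇_X ∇_Y - ∇_Y ∇_X - ∇_{[X, Y]}`. -/
def curvature (y X Y Z : Fin n → ℂ) : Fin n → ℂ :=
  fderiv ℝ (fun y' => christoffel G y' Y Z) y X - fderiv ℝ (fun y' => christoffel G y' X Z) y Y
    + christoffel G y X (christoffel G y Y Z) - christoffel G y Y (christoffel G y X Z)

/-- The holomorphic sectional curvature `H(X) = R(X, JX, JX, X) / |X|^4`. -/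
def holSec (y X : Fin n → ℂ) : ℝ :=
  G y (curvature G y X (Complex.I • X) (Complex.I • X)) X / (G y X X) ^ 2

end Local

/-- `g` is a Kähler metric. -/
def Metric.IsKahler {n k : ℕ} (g : Metric n k) : Prop :=
  ∀ (i : Fin n) (inf : Bool), IsKahlerOn (g.inChart i inf)

/-- `g` has positive holomorphic sectional curvature, at every point and in every direction. -/
def Metric.HolSecPos {n k : ℕ} (g : Metric n k) : Prop :=
  ∀ (i : Fin n) (inf : Bool) (y X : Fin n → ℂ), X ≠ 0 → 0 < holSec (g.inChart i inf) y X

/-! ### The action of the unitary group -/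

/-- The action of `A ∈ U(n)` on homogeneous coordinates. -/
def unitaryCoord {n : ℕ} (A : Matrix.unitaryGroup (Fin n) ℂ) (p : Coord n) : Coord n where
  Z := A.1.mulVec p.Z
  a := p.a
  b := p.b
  Z_ne := fun h => p.Z_ne <| by
    have h' := congrArg (star A.1).mulVec h
    rwa [Matrix.mulVec_mulVec, Matrix.mem_unitaryGroup_iff'.1 A.2, Matrix.one_mulVec,
      Matrix.mulVec_zero] at h'
  ab_ne := p.ab_ne

/-- The action of `U(n)` on `M_{n,k}`. -/
def unitaryAct {n k : ℕ} (A : Matrix.unitaryGroup (Fin n) ℂ) : Manifold n k → Manifold n k :=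
  Quotient.lift (fun p => mk k (unitaryCoord A p)) (by
    rintro p q ⟨l, m, h1, h2, h3⟩
    refine Quotient.sound ⟨l, m, ?_, h2, h3⟩
    change A.1.mulVec q.Z = (l : ℂ) • A.1.mulVec p.Z
    rw [h1, Matrix.mulVec_smul])

/-- `U(n)` acts on `(M_{n,k}, g)` by isometries. -/
def Metric.IsUnitaryInvariant {n k : ℕ} (g : Metric n k) : Prop :=
  ∀ (A : Matrix.unitaryGroup (Fin n) ℂ) (x : Manifold n k)
    (X Y : TangentSpace 𝓘(ℝ, Fin n → ℂ) x),
    g.inner (unitaryAct A x)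
      (mfderiv 𝓘(ℝ, Fin n → ℂ) 𝓘(ℝ, Fin n → ℂ) (unitaryAct A) x X)
      (mfderiv 𝓘(ℝ, Fin n → ℂ) 𝓘(ℝ, Fin n → ℂ) (unitaryAct A) x Y) = g.inner x X Y

/-! ### Metrics generated by a function of one variable -/

/-- The squared standard norm of `ℂ^n`. -/
def sqNorm {n : ℕ} (Z : Fin n → ℂ) : ℝ := ∑ j, ‖Z j‖ ^ 2

theorem sqNorm_smul {n : ℕ} (l : ℂ) (Z : Fin n → ℂ) : sqNorm (l • Z) = ‖l‖ ^ 2 * sqNorm Z := by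
  simp [sqNorm, mul_pow, Finset.mul_sum]

/-- The norm `|a / b| |Z|^k` of the vector `(a / b) Z^{⊗k}` of `H^{-k}` for the Hermitian metric
induced by the standard one on `ℂ^n`, at points with `b ≠ 0`. -/
def fibreNorm {n k : ℕ} : Manifold n k → ℝ :=
  Quotient.lift (fun p : Coord n => ‖p.a‖ / ‖p.b‖ * √(sqNorm p.Z) ^ k) (by
    rintro p q ⟨l, m, h1, h2, h3⟩
    have hm : ‖(m : ℂ)‖ ≠ 0 := norm_ne_zero_iff.2 m.ne_zero
    have h2' : ‖(l : ℂ)‖ ^ k * ‖q.a‖ = ‖(m : ℂ)‖ * ‖p.a‖ := by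
      simpa using congrArg norm h2
    simp only [h1, h3, sqNorm_smul, norm_mul, Real.sqrt_mul (sq_nonneg ‖(l : ℂ)‖),
      Real.sqrt_sq (norm_nonneg _), mul_pow]
    rw [← mul_div_mul_left ‖p.a‖ ‖p.b‖ hm, ← h2']
    ring)

/-- The pullback to `ℂ^n ∖ {0}` of the Fubini-Study metric `g₀` of `ℂℙ^{n-1}` normalized by
`Ric(g₀) = g₀`, whose Kähler form is `n i ∂∂̄ log |Z|²`. -/
def fubiniStudy {n : ℕ} (Z V W : Fin n → ℂ) : ℝ :=
  2 * n * (V ⬝ᵥ star W / sqNorm Z - (V ⬝ᵥ star Z) * (Z ⬝ᵥ star W) / sqNorm Z ^ 2 : ℂ).re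

/-- `g` is the metric on `M_{n,k}` generated by the function `φ` on `[Umin, Umax]`: on the
`ℂ^*`-bundle `H^{-k} ∖ 0`, the complement of the zero and the infinity section,
`g = π^* g_t + dt² + (dt ∘ J)²` with `g_t = (1 + (k / n) U) g₀`. Here `t` and `U` are functions of
the logarithm `s` of the fibre norm, with `u = dt/ds` (so that `u² = g(∂_s, ∂_s)` for the
generator `∂_s` of the action of `ℝ⁺`), `dU = u dt`, `u² = φ(U)`, and `U = 0` where `t = 0`;
`U` runs through `(Umin, Umax)`. In the chart `(i, inf)` the bundle projection
is `y ↦ [Z]`, where `Z` is `y` with its `i`-th entry replaced by `1`; the two sections removed are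
where the `i`-th coordinate vanishes. -/
def Metric.IsGeneratedBy {n k : ℕ} (g : Metric n k) (Umin Umax : ℝ) (φ : ℝ → ℝ) : Prop :=
  ∃ t U : ℝ → ℝ,
    (∀ s, HasDerivAt t (√(φ (U s))) s) ∧
    (∀ s, HasDerivAt U (φ (U s)) s) ∧
    Set.range U = Set.Ioo Umin Umax ∧
    (∀ s, t s = 0 ↔ U s = 0) ∧
    ∀ (i : Fin n) (inf : Bool) (y : Fin n → ℂ), y i ≠ 0 → ∀ X Y : Fin n → ℂ,
      let s : (Fin n → ℂ) → ℝ := fun y' => Real.log (fibreNorm (param n k i inf y'))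
      let dt : (Fin n → ℂ) →L[ℝ] ℝ := fderiv ℝ (fun y' => t (s y')) y
      g.inChart i inf y X Y =
        (1 + (k : ℝ) / n * U (s y)) * fubiniStudy (Function.update y i 1)
          (Function.update X i 0) (Function.update Y i 0)
        + dt X * dt Y + dt (Complex.I • X) * dt (Complex.I • Y)

/-! ### The polynomials -/

/-- `ε_p = 2n / (2p + 2k - 1)`. -/
def eps (n k p : ℕ) : ℝ := 2 * n / (2 * p + 2 * k - 1)

/-- The even polynomial
`φ(x) = μ - α₂ x² - α_{2p-2} x^{2p-2} - α_{2p} x^{2p}` with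
`α_{2p-2} = (p μ - c - (p-1) α₂ c²) / c^{2p-2}` and
`α_{2p} = (c - (p-1) μ + (p-2) α₂ c²) / c^{2p}`; used for `p ≥ 1`. -/
def phi (p : ℕ) (c μ α₂ : ℝ) (x : ℝ) : ℝ :=
  μ - α₂ * x ^ 2
    - (p * μ - c - (p - 1) * α₂ * c ^ 2) / c ^ (2 * p - 2) * x ^ (2 * p - 2)
    - (c - (p - 1) * μ + (p - 2) * α₂ * c ^ 2) / c ^ (2 * p) * x ^ (2 * p)

end Hirzebruch

end

noncomputable section

set_option maxSynthPendingDepth 3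

namespace Hirzebruch

/-! ### Two-jets of real functions at the origin -/

/-! Everything reduces to functions of one variable. Off the two sections the metric is the Levi
form of `F(s)`, where `s` is the logarithm of the fibre norm and `F' = n/k + U`
(`localForm_eq_levi`). Writing `U = W(r)` with `r = e^{2s}`, the condition `dU/ds = φ(U)` becomes `2
r W' = φ(W)`. In a chart the metric involves only `W(r)` and `W'(r)`, so it extends smoothly over
the zero section once `W` is smooth at `r = 0` with `W(0) = -c` and `W'(0) > 0`. Since `φ` is even,
`W(1/r) = -W(r)`, and the infinity section is covered by the same formula with `k` replaced by `-k`.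
These requirements form the structure `Profile`. Closedness of the fundamental form, compatibility
of the charts and `U(n)`-invariance all follow from the potential on a dense open set, and then
everywhere by continuity (`isKahlerMetric_localMetric`, `localMetric_actInCharts`).

A profile exists if `φ` vanishes at `±c`, is positive between, and has slope `2` at `-c`. Separating
variables gives `log r = ∫ 2 dx / φ(x)`. Splitting off the poles yields `r = (c + x)/(c - x)` times
the exponential of a smooth function, and this can be inverted smoothly, even across `x = -c`
(`profile_momentum`).

For the curvature no component of the curvature tensor is computed. If `γ` is a holomorphic disc
with `γ'(0) = X`, the Laplacian of `|γ'|²` at the origin equals `-2 R(X, JX, JX, X) + 4 |∇_X γ'|²`.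
A tangent disc with strictly superharmonic squared speed therefore proves positivity
(`IsKahlerMetric.holSec_pos_of_disc`). The discs used move along a projective line in the base and
have two free second-order parameters. With the best parameters the Laplacian is a quadratic form in
the vertical part `P` and the horizontal part `ν` of `|X|²`. It is negative under the pointwise
`CurvatureCondition` on `φ`, by completing the square (`curvature_form_neg`).

It remains to check this condition. With `y = x/c` and `m = p - 2` the polynomial is `A (1 - y²) + B
(1 - y^{2p-2}) + D (1 - y^{2p})`, and the slope condition is `A + (p-1) B + p D = c`. Cauchy-Schwarz
compares `φ'²` with `φ''` and leaves one scalar inequality (`curvatureCondition_trinomial`). As `δ₂`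
and `α₂` tend to `0`, so do `A` and `B`, while `D` tends to `c/p`, and the inequality becomes `c <
n/k - ε_p`. This holds for large `p` as soon as `c < n/k`, and the strict inequality leaves room for
small `δ₂` and `α₂` (`exists_metric_phi`). A positive `α₂` keeps `φ''` negative at `x = 0`. -/

/-- `f` is differentiable near `0`, its derivative is differentiable at `0`, and
`f 0 = a`, `f' 0 = b`, `f'' 0 = d`. -/
def HasJet (f : ℝ → ℝ) (a b d : ℝ) : Prop :=
  ∃ f' : ℝ → ℝ, (∀ᶠ x in 𝓝 (0 : ℝ), HasDerivAt f (f' x) x) ∧ f 0 = a ∧ f' 0 = b ∧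
    HasDerivAt f' d 0

namespace HasJet

variable {f g : ℝ → ℝ} {a b d a' b' d' : ℝ}

theorem congr (hf : HasJet f a b d) (h : f =ᶠ[𝓝 0] g) : HasJet g a b d := by
  obtain ⟨f', h1, h2, h3, h4⟩ := hf
  refine ⟨f', ?_, h.eq_of_nhds ▸ h2, h3, h4⟩
  filter_upwards [h1, h.eventually_nhds] with x hx hx'
  exact hx.congr_of_eventuallyEq (Filter.EventuallyEq.symm hx')

/-- Lets one compute the second derivative of the squared speed twice, abstractly from the metric
and explicitly from a formula, and equate the results. -/
theorem snd_unique (hf : HasJet f a b d) (hg : HasJet f a' b' d') : d = d' := by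
  obtain ⟨f₁, h1, -, -, h4⟩ := hf
  obtain ⟨f₂, k1, -, -, k4⟩ := hg
  refine h4.unique (k4.congr_of_eventuallyEq ?_)
  filter_upwards [h1, k1] with x hx hx' using hx.unique hx'

theorem const (a : ℝ) : HasJet (fun _ => a) a 0 0 :=
  ⟨fun _ => 0, .of_forall fun x => hasDerivAt_const x a, rfl, rfl, hasDerivAt_const _ _⟩

theorem id : HasJet (fun x => x) 0 1 0 :=
  ⟨fun _ => 1, .of_forall fun x => hasDerivAt_id x, rfl, rfl, hasDerivAt_const _ _⟩

theorem add (hf : HasJet f a b d) (hg : HasJet g a' b' d') :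
    HasJet (fun x => f x + g x) (a + a') (b + b') (d + d') := by
  obtain ⟨f₁, h1, h2, h3, h4⟩ := hf
  obtain ⟨g₁, k1, k2, k3, k4⟩ := hg
  refine ⟨fun x => f₁ x + g₁ x, ?_, by simp [h2, k2], by simp [h3, k3], h4.add k4⟩
  filter_upwards [h1, k1] with x hx hx' using hx.add hx'

theorem mul (hf : HasJet f a b d) (hg : HasJet g a' b' d') :
    HasJet (fun x => f x * g x) (a * a') (b * a' + a * b') (d * a' + 2 * b * b' + a * d') := by
  obtain ⟨f₁, h1, h2, h3, h4⟩ := hf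
  obtain ⟨g₁, k1, k2, k3, k4⟩ := hg
  refine ⟨fun x => f₁ x * g x + f x * g₁ x, ?_, by simp [h2, k2], by simp [h2, h3, k2, k3], ?_⟩
  · filter_upwards [h1, k1] with x hx hx' using hx.mul hx'
  · refine ((h4.mul k1.self_of_nhds).add (h1.self_of_nhds.mul k4)).congr_deriv ?_
    rw [h2, h3, k2, k3]; ring

theorem const_mul (s : ℝ) (hf : HasJet f a b d) :
    HasJet (fun x => s * f x) (s * a) (s * b) (s * d) := by
  simpa using (HasJet.const s).mul hf

/-- The chain rule for two-jets. -/
theorem comp {h h' : ℝ → ℝ} {h'' : ℝ} (hf : HasJet f a b d)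
    (hh : ∀ᶠ x in 𝓝 a, HasDerivAt h (h' x) x) (hh' : HasDerivAt h' h'' a) :
    HasJet (fun x => h (f x)) (h a) (h' a * b) (h'' * b ^ 2 + h' a * d) := by
  obtain ⟨f₁, h1, h2, h3, h4⟩ := hf
  have hc : ContinuousAt f 0 := h1.self_of_nhds.continuousAt
  refine ⟨fun x => h' (f x) * f₁ x, ?_, by simp [h2], by simp [h2, h3], ?_⟩
  · rw [← h2] at hh
    filter_upwards [h1, hc.eventually hh] with x hx hx' using hx'.comp x hx
  · rw [← h2] at hh'
    refine ((hh'.comp 0 h1.self_of_nhds).mul h4).congr_deriv ?_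
    simp only [Function.comp, h2, h3]; ring

theorem inv (hf : HasJet f a b d) (ha : a ≠ 0) :
    HasJet (fun x => (f x)⁻¹) a⁻¹ (-(a ^ 2)⁻¹ * b) (2 * (a ^ 3)⁻¹ * b ^ 2 + -(a ^ 2)⁻¹ * d) := by
  refine hf.comp (h := fun x => x⁻¹) (h' := fun x => -(x ^ 2)⁻¹) ?_ ?_
  · filter_upwards [isOpen_ne.mem_nhds ha] with x hx using hasDerivAt_inv hx
  · refine (((hasDerivAt_pow 2 a).inv (pow_ne_zero 2 ha)).neg).congr_deriv ?_
    field_simp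
    ring

end HasJet

/-! ### Curvature of Kähler metrics in holomorphic coordinates -/

section Curvature

variable {n : ℕ} {G : (Fin n → ℂ) → (Fin n → ℂ) →L[ℝ] (Fin n → ℂ) →L[ℝ] ℝ}

/-- A smooth Kähler metric on `ℂ^n`. -/
structure IsKahlerMetric (G : (Fin n → ℂ) → (Fin n → ℂ) →L[ℝ] (Fin n → ℂ) →L[ℝ] ℝ) : Prop where
  smooth : ContDiff ℝ ∞ G
  symm : ∀ y X Y, G y X Y = G y Y X
  pos : ∀ y X, X ≠ 0 → 0 < G y X X
  kahler : IsKahlerOn G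

theorem exists_equiv_of_pos (B : (Fin n → ℂ) →L[ℝ] (Fin n → ℂ) →L[ℝ] ℝ)
    (hB : ∀ X, X ≠ 0 → 0 < B X X) :
    ∃ e : (Fin n → ℂ) ≃L[ℝ] ((Fin n → ℂ) →L[ℝ] ℝ), (e : (Fin n → ℂ) →L[ℝ] _) = B := by
  have hinj : Function.Injective (B : (Fin n → ℂ) →ₗ[ℝ] ((Fin n → ℂ) →L[ℝ] ℝ)) := by
    rw [← LinearMap.ker_eq_bot, LinearMap.ker_eq_bot']
    intro X hX
    by_contra h
    have h1 := hB X h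
    have h2 : B X = 0 := hX
    simp [h2] at h1
  have hdim : Module.finrank ℝ (Fin n → ℂ) = Module.finrank ℝ ((Fin n → ℂ) →L[ℝ] ℝ) := by
    rw [← Subspace.dual_finrank_eq]
    exact LinearEquiv.finrank_eq
      (LinearMap.toContinuousLinearMap : ((Fin n → ℂ) →ₗ[ℝ] ℝ) ≃ₗ[ℝ] ((Fin n → ℂ) →L[ℝ] ℝ))
  refine ⟨(LinearMap.linearEquivOfInjective _ hinj hdim).toContinuousLinearEquiv, ?_⟩
  ext X Y
  rfl

theorem apply_inverse_of_pos (B : (Fin n → ℂ) →L[ℝ] (Fin n → ℂ) →L[ℝ] ℝ)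
    (hB : ∀ X, X ≠ 0 → 0 < B X X) (l : (Fin n → ℂ) →L[ℝ] ℝ) : B (B.inverse l) = l := by
  obtain ⟨e, rfl⟩ := exists_equiv_of_pos B hB
  rw [ContinuousLinearMap.inverse_equiv]
  exact e.apply_symm_apply l

theorem eq_of_forall_apply_eq {B : (Fin n → ℂ) →L[ℝ] (Fin n → ℂ) →L[ℝ] ℝ}
    (hB : ∀ X, X ≠ 0 → 0 < B X X) {X Y : Fin n → ℂ} (h : ∀ Z, B X Z = B Y Z) : X = Y := by
  by_contra hne
  have h1 := hB (X - Y) (sub_ne_zero.2 hne)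
  rw [B.map_sub X Y, sub_apply, h, sub_self] at h1
  exact lt_irrefl _ h1

namespace IsKahlerMetric

theorem differentiableAt (hG : IsKahlerMetric G) (y : Fin n → ℂ) : DifferentiableAt ℝ G y :=
  (hG.smooth.differentiable (by simp)) y

theorem differentiableAt_fderiv (hG : IsKahlerMetric G) (y : Fin n → ℂ) :
    DifferentiableAt ℝ (fderiv ℝ G) y :=
  ((hG.smooth.fderiv_right (m := 1) (by norm_cast)).differentiable (by simp)) y

theorem fderiv_apply_apply (hG : IsKahlerMetric G) (y V X Y : Fin n → ℂ) :
    fderiv ℝ (fun y' => G y' X Y) y V = fderiv ℝ G y V X Y := by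
  have h := (((hG.differentiableAt y).hasFDerivAt.clm_apply
    (hasFDerivAt_const X y)).clm_apply (hasFDerivAt_const Y y)).fderiv
  rw [h]; simp

theorem fderiv_symm (hG : IsKahlerMetric G) (y V X Y : Fin n → ℂ) :
    fderiv ℝ G y V X Y = fderiv ℝ G y V Y X := by
  rw [← hG.fderiv_apply_apply, ← hG.fderiv_apply_apply]
  simp only [hG.symm _ X Y]

theorem apply_I (hG : IsKahlerMetric G) (y X Y : Fin n → ℂ) :
    G y (Complex.I • X) (Complex.I • Y) = G y X Y :=
  hG.kahler.1 y X Y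

theorem fderiv_I (hG : IsKahlerMetric G) (y V X Y : Fin n → ℂ) :
    fderiv ℝ G y V (Complex.I • X) (Complex.I • Y) = fderiv ℝ G y V X Y := by
  rw [← hG.fderiv_apply_apply, ← hG.fderiv_apply_apply]
  simp only [hG.apply_I _ X Y]

theorem I_smul_I_smul (X : Fin n → ℂ) : Complex.I • Complex.I • X = -X := by
  rw [smul_smul, Complex.I_mul_I, neg_one_smul]

theorem apply_I_left (hG : IsKahlerMetric G) (y X Y : Fin n → ℂ) :
    G y (Complex.I • X) Y = - G y X (Complex.I • Y) := by
  have h := hG.apply_I y X (Complex.I • Y)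
  rw [I_smul_I_smul, map_neg] at h
  linarith

theorem fderiv_I_left (hG : IsKahlerMetric G) (y V X Y : Fin n → ℂ) :
    fderiv ℝ G y V (Complex.I • X) Y = - fderiv ℝ G y V X (Complex.I • Y) := by
  have h := hG.fderiv_I y V X (Complex.I • Y)
  rw [I_smul_I_smul, map_neg] at h
  linarith

theorem fderiv_self_I (hG : IsKahlerMetric G) (y V X : Fin n → ℂ) :
    fderiv ℝ G y V X (Complex.I • X) = 0 := by
  have h := hG.fderiv_I_left y V X X
  rw [hG.fderiv_symm] at h
  linarith

theorem apply_christoffel (hG : IsKahlerMetric G) (y X Y Z : Fin n → ℂ) :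
    G y (christoffel G y X Y) Z =
      1 / 2 * (fderiv ℝ G y X Y Z + fderiv ℝ G y Y X Z - fderiv ℝ G y Z X Y) := by
  rw [christoffel, apply_inverse_of_pos _ (hG.pos y)]
  simp

theorem christoffel_comm (hG : IsKahlerMetric G) (y X Y : Fin n → ℂ) :
    christoffel G y X Y = christoffel G y Y X := by
  refine eq_of_forall_apply_eq (hG.pos y) fun Z => ?_
  rw [hG.apply_christoffel, hG.apply_christoffel, hG.fderiv_symm y Z X Y]
  ring

/-- This is `∇J = 0`. In the Koszul formula it follows from two instances of closedness, at `(Z, Y,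
X)` and `(X, iY, iZ)`, together with the invariance of the derivatives of `G` under `I`. -/
theorem christoffel_I_right (hG : IsKahlerMetric G) (y X Y : Fin n → ℂ) :
    christoffel G y X (Complex.I • Y) = Complex.I • christoffel G y X Y := by
  refine eq_of_forall_apply_eq (hG.pos y) fun Z => ?_
  rw [hG.apply_I_left, hG.apply_christoffel, hG.apply_christoffel]
  have h1 := hG.kahler.2 y Z Y X
  have h2 := hG.kahler.2 y X (Complex.I • Y) (Complex.I • Z)
  simp only [I_smul_I_smul, map_neg, neg_apply] at h2
  have h3 := hG.fderiv_I y (Complex.I • Z) X Y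
  have h4 := hG.fderiv_symm y Z X (Complex.I • Y)
  have h5 := hG.fderiv_symm y (Complex.I • Y) Z X
  have h6 := hG.fderiv_I_left y X Y Z
  have h7 := hG.fderiv_symm y X (Complex.I • Z) Y
  have h8 := hG.fderiv_I_left y Y X Z
  linarith

theorem christoffel_I_left (hG : IsKahlerMetric G) (y X Y : Fin n → ℂ) :
    christoffel G y (Complex.I • X) Y = Complex.I • christoffel G y X Y := by
  rw [hG.christoffel_comm, hG.christoffel_I_right, hG.christoffel_comm]

theorem fderiv_eq_christoffel (hG : IsKahlerMetric G) (y X Y Z : Fin n → ℂ) :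
    fderiv ℝ G y X Y Z = G y (christoffel G y X Y) Z + G y Y (christoffel G y X Z) := by
  rw [hG.symm y Y, hG.apply_christoffel, hG.apply_christoffel, hG.fderiv_symm y X Z Y,
    hG.fderiv_symm y Z X Y, hG.fderiv_symm y Y X Z, hG.fderiv_symm y Z Y X]
  ring

theorem differentiableAt_christoffel (hG : IsKahlerMetric G) (y X Y : Fin n → ℂ) :
    DifferentiableAt ℝ (fun y' => christoffel G y' X Y) y := by
  have h1 : DifferentiableAt ℝ (fun y' => (G y').inverse) y := by
    obtain ⟨e, he⟩ := exists_equiv_of_pos (G y) (hG.pos y)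
    have h := contDiffAt_map_inverse (𝕜 := ℝ) (n := 1) e
    rw [he] at h
    exact (h.differentiableAt (by simp)).comp y (hG.differentiableAt y)
  have h2 : DifferentiableAt ℝ (fun y' => (1 / 2 : ℝ) •
      (fderiv ℝ G y' X Y + fderiv ℝ G y' Y X - ((fderiv ℝ G y').flip X).flip Y)) y := by
    have h3 := hG.differentiableAt_fderiv y
    have h4 : DifferentiableAt ℝ (fun y' => (fderiv ℝ G y').flip) y :=
      (ContinuousLinearMap.flipₗᵢ ℝ (Fin n → ℂ) (Fin n → ℂ)
        ((Fin n → ℂ) →L[ℝ] ℝ)).toContinuousLinearEquiv.differentiableAt.comp y h3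
    have h5 : DifferentiableAt ℝ (fun y' => ((fderiv ℝ G y').flip X).flip) y :=
      (ContinuousLinearMap.flipₗᵢ ℝ (Fin n → ℂ) (Fin n → ℂ)
        ℝ).toContinuousLinearEquiv.differentiableAt.comp y
        (h4.clm_apply (differentiableAt_const X))
    exact ((((h3.clm_apply (differentiableAt_const X)).clm_apply (differentiableAt_const Y)).add
      ((h3.clm_apply (differentiableAt_const Y)).clm_apply (differentiableAt_const X))).sub
      (h5.clm_apply (differentiableAt_const Y))).const_smul (1 / 2 : ℝ)
  exact h1.clm_apply h2

/-- The Christoffel symbol is complex bilinear, so `Γ(iX, iX) = -Γ(X, X)` and `Γ(X, iX) = iΓ(X, X)`.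
The two terms of the curvature quadratic in `Γ` then cancel, and only derivatives of `Γ(X, X)`
remain. -/
theorem curvature_self_I (hG : IsKahlerMetric G) (y X : Fin n → ℂ) :
    curvature G y X (Complex.I • X) (Complex.I • X) =
      -(fderiv ℝ (fun y' => christoffel G y' X X) y X)
      - Complex.I • fderiv ℝ (fun y' => christoffel G y' X X) y (Complex.I • X) := by
  have e1 : (fun y' => christoffel G y' (Complex.I • X) (Complex.I • X)) =
      fun y' => - christoffel G y' X X := by
    funext y'
    rw [hG.christoffel_I_left, hG.christoffel_I_right, I_smul_I_smul]
  have e2 : (fun y' => christoffel G y' X (Complex.I • X)) =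
      fun y' => Complex.I • christoffel G y' X X := by
    funext y'
    rw [hG.christoffel_I_right]
  have hd := hG.differentiableAt_christoffel y X X
  have d1 : fderiv ℝ (fun y' => - christoffel G y' X X) y =
      -fderiv ℝ (fun y' => christoffel G y' X X) y := fderiv_fun_neg
  have d2 : fderiv ℝ (fun y' => Complex.I • christoffel G y' X X) y =
      Complex.I • fderiv ℝ (fun y' => christoffel G y' X X) y :=
    fderiv_fun_const_smul hd _
  have e1' := congrFun e1 y
  have e2' := congrFun e2 y
  rw [curvature, e1, e2, e1', e2', d1, d2, hG.christoffel_I_left, hG.christoffel_I_right,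
    I_smul_I_smul]
  have e3 : christoffel G y X (-christoffel G y X X) = -christoffel G y X (christoffel G y X X) := by
    have := hG.christoffel_I_right y X (Complex.I • christoffel G y X X)
    rwa [I_smul_I_smul, hG.christoffel_I_right, I_smul_I_smul] at this
  rw [e3]
  simp only [neg_apply, smul_apply]
  abel

theorem apply_fderiv_christoffel (hG : IsKahlerMetric G) (y V X Z : Fin n → ℂ) :
    G y (fderiv ℝ (fun y' => christoffel G y' X X) y V) Z =
      1 / 2 * (2 * fderiv ℝ (fderiv ℝ G) y V X X Z - fderiv ℝ (fderiv ℝ G) y V Z X X)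
      - fderiv ℝ G y V (christoffel G y X X) Z := by
  have hd := hG.differentiableAt_christoffel y X X
  have h2 := (hG.differentiableAt_fderiv y).hasFDerivAt
  have hc : ∀ A : Fin n → ℂ, HasFDerivAt (𝕜 := ℝ) (fun _ : Fin n → ℂ => A) 0 y :=
    fun A => hasFDerivAt_const A y
  have e1 := ((hG.differentiableAt y).hasFDerivAt.clm_apply hd.hasFDerivAt).clm_apply (hc Z)
  have e2 := ((((h2.clm_apply (hc X)).clm_apply (hc X)).clm_apply (hc Z)).const_mul 2).sub
    (((h2.clm_apply (hc Z)).clm_apply (hc X)).clm_apply (hc X)) |>.const_mul (1 / 2)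
  have e : (fun y' => G y' (christoffel G y' X X) Z) = fun y' =>
      1 / 2 * (2 * fderiv ℝ G y' X X Z - fderiv ℝ G y' Z X X) := by
    funext y'
    rw [hG.apply_christoffel]; ring
  rw [e] at e1
  have := congrArg (fun l => l V) (e1.unique e2)
  simp at this
  linarith

theorem fderiv_fderiv_I (hG : IsKahlerMetric G) (y V V' X Y : Fin n → ℂ) :
    fderiv ℝ (fderiv ℝ G) y V V' (Complex.I • X) (Complex.I • Y) =
      fderiv ℝ (fderiv ℝ G) y V V' X Y := by
  have h2 := (hG.differentiableAt_fderiv y).hasFDerivAt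
  have hc : ∀ A : Fin n → ℂ, HasFDerivAt (𝕜 := ℝ) (fun _ : Fin n → ℂ => A) 0 y :=
    fun A => hasFDerivAt_const A y
  have e1 := ((h2.clm_apply (hc V')).clm_apply (hc (Complex.I • X))).clm_apply
    (hc (Complex.I • Y))
  have e2 := ((h2.clm_apply (hc V')).clm_apply (hc X)).clm_apply (hc Y)
  simp only [hG.fderiv_I] at e1
  simpa using congrArg (fun l => l V) (e1.unique e2)

/-- The holomorphic sectional curvature in terms of second derivatives of the metric. -/
theorem apply_curvature (hG : IsKahlerMetric G) (y X : Fin n → ℂ) :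
    G y (curvature G y X (Complex.I • X) (Complex.I • X)) X =
      -(1 / 2) * (fderiv ℝ (fderiv ℝ G) y X X X X +
        fderiv ℝ (fderiv ℝ G) y (Complex.I • X) (Complex.I • X) X X)
      + 2 * G y (christoffel G y X X) (christoffel G y X X) := by
  have h2 := (hG.differentiableAt_fderiv y).hasFDerivAt
  have hc : ∀ A : Fin n → ℂ, HasFDerivAt (𝕜 := ℝ) (fun _ : Fin n → ℂ => A) 0 y :=
    fun A => hasFDerivAt_const A y
  have h0 : fderiv ℝ (fderiv ℝ G) y (Complex.I • X) X X (Complex.I • X) = 0 := by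
    have e1 := ((h2.clm_apply (hc X)).clm_apply (hc X)).clm_apply (hc (Complex.I • X))
    have e : (fun y' => fderiv ℝ G y' X X (Complex.I • X)) = fun _ => 0 := by
      funext y'
      exact hG.fderiv_self_I y' X X
    rw [e] at e1
    have := congrArg (fun l => l (Complex.I • X)) (e1.unique (hasFDerivAt_const (0 : ℝ) y))
    simpa using this
  rw [hG.curvature_self_I]
  simp only [map_sub, map_neg, sub_apply, neg_apply]
  rw [hG.apply_I_left, hG.apply_fderiv_christoffel, hG.apply_fderiv_christoffel, h0,
    hG.fderiv_eq_christoffel y X, hG.fderiv_eq_christoffel y (Complex.I • X),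
    hG.christoffel_I_left, hG.christoffel_I_left, hG.christoffel_I_right, I_smul_I_smul,
    hG.apply_I, map_neg]
  ring

/-- Second derivative of the squared speed along a real curve. -/
theorem hasJet_speed (hs : ContDiff ℝ ∞ G) {c v w : ℝ → Fin n → ℂ} {u : Fin n → ℂ}
    (hc : ∀ᶠ x in 𝓝 (0 : ℝ), HasDerivAt c (v x) x) (hv : ∀ᶠ x in 𝓝 (0 : ℝ), HasDerivAt v (w x) x)
    (hw : HasDerivAt w u 0) :
    ∃ a b, HasJet (fun x => G (c x) (v x) (v x)) a b
      (fderiv ℝ (fderiv ℝ G) (c 0) (v 0) (v 0) (v 0) (v 0) + fderiv ℝ G (c 0) (w 0) (v 0) (v 0)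
        + 2 * fderiv ℝ G (c 0) (v 0) (w 0) (v 0) + 2 * fderiv ℝ G (c 0) (v 0) (v 0) (w 0)
        + 2 * G (c 0) (w 0) (w 0) + G (c 0) u (v 0) + G (c 0) (v 0) u) := by
  have hd : ∀ y, DifferentiableAt ℝ G y := hs.differentiable (by simp)
  have hd2 : ∀ y, DifferentiableAt ℝ (fderiv ℝ G) y :=
    (hs.fderiv_right (m := 1) (by norm_cast)).differentiable (by simp)
  have hGc : ∀ x, HasDerivAt c (v x) x → HasDerivAt (fun x => G (c x)) (fderiv ℝ G (c x) (v x)) x :=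
    fun x hx => (hd (c x)).hasFDerivAt.comp_hasDerivAt x hx
  have hDGc : ∀ x, HasDerivAt c (v x) x → HasDerivAt (fun x => fderiv ℝ G (c x))
      (fderiv ℝ (fderiv ℝ G) (c x) (v x)) x :=
    fun x hx => (hd2 (c x)).hasFDerivAt.comp_hasDerivAt x hx
  refine ⟨_, _, fun x => fderiv ℝ G (c x) (v x) (v x) (v x) + G (c x) (w x) (v x)
    + G (c x) (v x) (w x), ?_, rfl, rfl, ?_⟩
  · filter_upwards [hc, hv] with x hx hx'
    refine (((hGc x hx).clm_apply hx').clm_apply hx').congr_deriv ?_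
    simp
  · have c0 := hc.self_of_nhds
    have v0 := hv.self_of_nhds
    refine ((((((hDGc 0 c0).clm_apply v0).clm_apply v0).clm_apply v0).add
      (((hGc 0 c0).clm_apply hw).clm_apply v0)).add
      (((hGc 0 c0).clm_apply v0).clm_apply hw)).congr_deriv ?_
    simp only [add_apply]
    ring

/-- The holomorphic sectional curvature is positive in the direction of a holomorphic disc whose
squared speed is strictly superharmonic at the origin. -/
theorem holSec_pos_of_disc (hG : IsKahlerMetric G) {γ : ℂ → Fin n → ℂ} (hγ : AnalyticAt ℂ γ 0)
    {e : ℂ → ℝ}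
    (he : ∀ᶠ z in 𝓝 (0 : ℂ), e z = G (γ z) (deriv γ z) (deriv γ z)) (hX : deriv γ 0 ≠ 0)
    {a b d a' b' d' : ℝ} (h1 : HasJet (fun x => e x) a b d)
    (h2 : HasJet (fun x => e (x * Complex.I)) a' b' d') (hneg : d + d' < 0) :
    0 < holSec G (γ 0) (deriv γ 0) := by
  set y := γ 0 with hy
  set X := deriv γ 0 with hXdef
  set W := deriv (deriv γ) 0 with hW
  set u := deriv (deriv (deriv γ)) 0 with hu
  have a0 := hγ.eventually_analyticAt
  have a1 : ∀ᶠ z in 𝓝 (0 : ℂ), HasDerivAt γ (deriv γ z) z := by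
    filter_upwards [a0] with z hz using hz.differentiableAt.hasDerivAt
  have a2 : ∀ᶠ z in 𝓝 (0 : ℂ), HasDerivAt (deriv γ) (deriv (deriv γ) z) z := by
    filter_upwards [a0] with z hz using hz.deriv.differentiableAt.hasDerivAt
  have a3 : HasDerivAt (deriv (deriv γ)) u 0 := hγ.deriv.deriv.differentiableAt.hasDerivAt
  have t1 : Filter.Tendsto (fun x : ℝ => (x : ℂ)) (𝓝 0) (𝓝 0) := by
    have : Continuous fun x : ℝ => (x : ℂ) := Complex.continuous_ofReal
    simpa using this.tendsto 0
  have t2 : Filter.Tendsto (fun x : ℝ => (x : ℂ) * Complex.I) (𝓝 0) (𝓝 0) := by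
    have : Continuous fun x : ℝ => (x : ℂ) * Complex.I := by fun_prop
    simpa using this.tendsto 0
  have l1 : ∀ x : ℝ, HasDerivAt (fun x : ℝ => (x : ℂ)) 1 x :=
    fun x => Complex.ofRealCLM.hasDerivAt
  have l2 : ∀ x : ℝ, HasDerivAt (fun x : ℝ => (x : ℂ) * Complex.I) Complex.I x := fun x => by
    simpa using (l1 x).mul_const Complex.I
  have c1 : ∀ (f : ℂ → Fin n → ℂ) (f' : Fin n → ℂ) (x : ℝ), HasDerivAt f f' (x : ℂ) →
      HasDerivAt (fun x : ℝ => f x) f' x := fun f f' x h => by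
    have := HasDerivAt.scomp (h := fun x : ℝ => (x : ℂ)) x h (l1 x)
    rw [one_smul] at this
    exact this
  have c2 : ∀ (f : ℂ → Fin n → ℂ) (f' : Fin n → ℂ) (x : ℝ), HasDerivAt f f' (x * Complex.I : ℂ) →
      HasDerivAt (fun x : ℝ => f (x * Complex.I)) (Complex.I • f') x := fun f f' x h => by
    exact HasDerivAt.scomp (h := fun x : ℝ => (x : ℂ) * Complex.I) x h (l2 x)
  -- The squared speed is differentiated along the real and along the imaginary axis; the sum of the
  -- two second derivatives is the Laplacian.
  obtain ⟨p1, q1, j1⟩ := hasJet_speed (G := G) hG.smooth (c := fun x : ℝ => γ x)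
    (v := fun x : ℝ => deriv γ x) (w := fun x : ℝ => deriv (deriv γ) x) (u := u)
    (by filter_upwards [t1.eventually a1] with x hx using c1 _ _ _ hx)
    (by filter_upwards [t1.eventually a2] with x hx using c1 _ _ _ hx)
    (c1 _ _ 0 (by simpa using a3))
  obtain ⟨p2, q2, j2⟩ := hasJet_speed (G := G) hG.smooth (c := fun x : ℝ => γ (x * Complex.I))
    (v := fun x : ℝ => Complex.I • deriv γ (x * Complex.I))
    (w := fun x : ℝ => Complex.I • Complex.I • deriv (deriv γ) (x * Complex.I))
    (u := Complex.I • Complex.I • Complex.I • u)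
    (by filter_upwards [t2.eventually a1] with x hx using c2 _ _ _ hx)
    (by filter_upwards [t2.eventually a2] with x hx using (c2 _ _ _ hx).const_smul Complex.I)
    (((c2 _ _ 0 (by simpa using a3)).const_smul Complex.I).const_smul Complex.I)
  have k1 := h1.snd_unique (j1.congr (by
    filter_upwards [t1.eventually he] with x hx using hx.symm))
  have k2 := h2.snd_unique (j2.congr (by
    filter_upwards [t2.eventually he] with x hx
    rw [hx, hG.apply_I]))
  simp only [Complex.ofReal_zero, zero_mul, I_smul_I_smul, ← hy, ← hXdef, ← hW] at k1 k2
  simp only [map_neg, neg_apply, neg_neg, hG.apply_I, hG.fderiv_I] at k2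
  rw [hG.fderiv_fderiv_I] at k2
  set C := christoffel G y X X
  have m1 : fderiv ℝ G y X X W = G y C W + G y X (christoffel G y X W) :=
    hG.fderiv_eq_christoffel y X X W
  have m2 : fderiv ℝ G y (Complex.I • X) (Complex.I • X) W =
      - G y C W + G y X (christoffel G y X W) := by
    rw [hG.fderiv_eq_christoffel, hG.christoffel_I_left, hG.christoffel_I_left,
      hG.christoffel_I_right, I_smul_I_smul, hG.apply_I]
    simp [C]
  have m1' := hG.fderiv_symm y X W X
  have m2' := hG.fderiv_symm y (Complex.I • X) W (Complex.I • X)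
  -- Adding the two jets, the terms in the third derivative `u` and in `Γ(X, W)` cancel, and `d +
  -- d'` is `-2 G(R(X, iX) iX, X) + 4 G(C + W, C + W)`. Here `C + W` is the covariant acceleration
  -- of the disc.
  have key : 0 < G y (curvature G y X (Complex.I • X) (Complex.I • X)) X := by
    have hcw : 0 ≤ G y (C + W) (C + W) := by
      by_cases h : C + W = 0
      · simp [h]
      · exact (hG.pos y _ h).le
    simp only [map_add, add_apply] at hcw
    have s1 := hG.symm y C W
    have s2 := hG.symm y u X
    rw [hG.apply_curvature]
    linarith
  exact div_pos key (pow_pos (hG.pos y X hX) 2)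

end IsKahlerMetric

end Curvature

/-! ### The Levi form -/

section Levi

variable {n : ℕ}

/-- The Levi form `D²f(X, Y) + D²f(iX, iY)` of a real function on `ℂ^n`. -/
def levi (f : (Fin n → ℂ) → ℝ) (y X Y : Fin n → ℂ) : ℝ :=
  fderiv ℝ (fderiv ℝ f) y X Y + fderiv ℝ (fderiv ℝ f) y (Complex.I • X) (Complex.I • Y)

theorem levi_congr {f g : (Fin n → ℂ) → ℝ} {y : Fin n → ℂ} (h : f =ᶠ[𝓝 y] g)
    (X Y : Fin n → ℂ) : levi f y X Y = levi g y X Y := by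
  rw [levi, levi, h.fderiv.fderiv_eq]

theorem differentiableAt_fderiv_of_contDiffAt {f : (Fin n → ℂ) → ℝ} {y : Fin n → ℂ}
    (hf : ContDiffAt ℝ 2 f y) : DifferentiableAt ℝ (fderiv ℝ f) y :=
  (hf.fderiv_right (m := 1) (by norm_num)).differentiableAt (by simp)

theorem eventually_differentiableAt {f : (Fin n → ℂ) → ℝ} {y : Fin n → ℂ}
    (hf : ContDiffAt ℝ 2 f y) : ∀ᶠ y' in 𝓝 y, DifferentiableAt ℝ f y' := by
  filter_upwards [hf.eventually (by simp)] with y' h using h.differentiableAt (by simp)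

theorem fderiv_fderiv_apply {f : (Fin n → ℂ) → ℝ} {y Y : Fin n → ℂ}
    (hf : ContDiffAt ℝ 2 f y) {D : (Fin n → ℂ) →L[ℝ] ℝ}
    (h : HasFDerivAt (fun y' => fderiv ℝ f y' Y) D y) (X : Fin n → ℂ) :
    fderiv ℝ (fderiv ℝ f) y X Y = D X := by
  have h1 := (differentiableAt_fderiv_of_contDiffAt hf).hasFDerivAt.clm_apply
    (hasFDerivAt_const Y y)
  rw [h.unique h1]; simp

theorem levi_comp {f : (Fin n → ℂ) → ℝ} {y : Fin n → ℂ} (hf : ContDiffAt ℝ 2 f y)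
    {F F' : ℝ → ℝ} {F'' : ℝ} (hF : ContDiff ℝ 2 F) (hF1 : ∀ x, HasDerivAt F (F' x) x)
    (hF2 : HasDerivAt F' F'' (f y)) (X Y : Fin n → ℂ) :
    levi (fun y => F (f y)) y X Y = F'' * (fderiv ℝ f y X * fderiv ℝ f y Y +
      fderiv ℝ f y (Complex.I • X) * fderiv ℝ f y (Complex.I • Y)) + F' (f y) * levi f y X Y := by
  have key : ∀ X Y, fderiv ℝ (fderiv ℝ (fun y => F (f y))) y X Y =
      F'' * (fderiv ℝ f y X * fderiv ℝ f y Y) + F' (f y) * fderiv ℝ (fderiv ℝ f) y X Y := by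
    intro X Y
    have hc : ContDiffAt ℝ 2 (fun y => F (f y)) y := hF.contDiffAt.comp y hf
    have h0 : (fun y' => fderiv ℝ (fun y => F (f y)) y' Y) =ᶠ[𝓝 y]
        fun y' => F' (f y') * fderiv ℝ f y' Y := by
      filter_upwards [eventually_differentiableAt hf] with y' h
      have := ((hF1 (f y')).comp_hasFDerivAt y' h.hasFDerivAt).fderiv
      rw [show (fun y => F (f y)) = F ∘ f from rfl, this]; simp
    have h1 : HasFDerivAt (fun y' => F' (f y')) (F'' • fderiv ℝ f y) y :=
      hF2.comp_hasFDerivAt y (hf.differentiableAt (by simp)).hasFDerivAt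
    have h2 : HasFDerivAt (fun y' => fderiv ℝ f y' Y) _ y :=
      (differentiableAt_fderiv_of_contDiffAt hf).hasFDerivAt.clm_apply (hasFDerivAt_const Y y)
    rw [fderiv_fderiv_apply hc ((h1.mul h2).congr_of_eventuallyEq h0)]
    simp
    ring
  rw [levi, levi, key, key]
  ring

theorem fderiv_real_eq {T : (Fin n → ℂ) → (Fin n → ℂ)} {y : Fin n → ℂ}
    (hT : DifferentiableAt ℂ T y) : fderiv ℝ T y = (fderiv ℂ T y).restrictScalars ℝ :=
  (hT.hasFDerivAt.restrictScalars ℝ).fderiv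

/-- The second derivative of a holomorphic `T` is complex bilinear, so its contributions at `(X, Y)`
and `(iX, iY)` cancel. The Levi form is thus a tensor under holomorphic changes of coordinates. -/
theorem levi_comp_holomorphic {f : (Fin n → ℂ) → ℝ} {T : (Fin n → ℂ) → (Fin n → ℂ)}
    {y : Fin n → ℂ} (hT : ContDiffAt ℂ 2 T y) (hf : ContDiffAt ℝ 2 f (T y)) (X Y : Fin n → ℂ) :
    levi (fun y => f (T y)) y X Y = levi f (T y) (fderiv ℝ T y X) (fderiv ℝ T y Y) := by
  have hTd : ∀ᶠ y' in 𝓝 y, DifferentiableAt ℂ T y' := by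
    filter_upwards [hT.eventually (by simp)] with y' h using h.differentiableAt (by simp)
  have hT2 : DifferentiableAt ℂ (fderiv ℂ T) y :=
    (hT.fderiv_right (m := 1) (by norm_num)).differentiableAt (by simp)
  have hT1 := hTd.self_of_nhds
  have key : ∀ X Y, fderiv ℝ (fderiv ℝ (fun y => f (T y))) y X Y =
      fderiv ℝ (fderiv ℝ f) (T y) (fderiv ℝ T y X) (fderiv ℝ T y Y) +
        fderiv ℝ f (T y) (fderiv ℂ (fderiv ℂ T) y X Y) := by
    intro X Y
    have hc : ContDiffAt ℝ 2 (fun y => f (T y)) y := hf.comp y (hT.restrict_scalars ℝ)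
    have h0 : (fun y' => fderiv ℝ (fun y => f (T y)) y' Y) =ᶠ[𝓝 y]
        fun y' => fderiv ℝ f (T y') (fderiv ℂ T y' Y) := by
      filter_upwards [hT.continuousAt.eventually (eventually_differentiableAt hf), hTd]
        with y' h h'
      have := (h.hasFDerivAt.comp y' (h'.hasFDerivAt.restrictScalars ℝ)).fderiv
      rw [show (fun y => f (T y)) = f ∘ T from rfl, this]; simp
    have h1 : HasFDerivAt (fun y' => fderiv ℝ f (T y'))
        ((fderiv ℝ (fderiv ℝ f) (T y)).comp (fderiv ℝ T y)) y := by
      refine (differentiableAt_fderiv_of_contDiffAt hf).hasFDerivAt.comp y ?_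
      rw [fderiv_real_eq hT1]
      exact hT1.hasFDerivAt.restrictScalars ℝ
    have h2 := (hT2.hasFDerivAt.clm_apply (hasFDerivAt_const Y y)).restrictScalars ℝ
    rw [fderiv_fderiv_apply hc ((h1.clm_apply h2).congr_of_eventuallyEq h0)]
    simp [fderiv_real_eq hT1]
    ring
  have hI : ∀ X, fderiv ℝ T y (Complex.I • X) = Complex.I • fderiv ℝ T y X := by
    intro X
    simp [fderiv_real_eq hT1]
  have hII : fderiv ℂ (fderiv ℂ T) y (Complex.I • X) (Complex.I • Y) =
      - fderiv ℂ (fderiv ℂ T) y X Y := by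
    simp [smul_smul]
  rw [levi, levi, key, key, hI, hI, hII, map_neg]
  ring

/-- The fundamental form of the Levi form is closed. -/
theorem fderiv_cyclic_of_eq_levi {f : (Fin n → ℂ) → ℝ} {y : Fin n → ℂ}
    (hf : ContDiffAt ℝ ∞ f y) {G : (Fin n → ℂ) → (Fin n → ℂ) →L[ℝ] (Fin n → ℂ) →L[ℝ] ℝ}
    (hd : DifferentiableAt ℝ G y) (hG : ∀ᶠ y' in 𝓝 y, ∀ X Y, G y' X Y = levi f y' X Y)
    (X Y Z : Fin n → ℂ) :
    fderiv ℝ G y X (Complex.I • Y) Z + fderiv ℝ G y Y (Complex.I • Z) X +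
      fderiv ℝ G y Z (Complex.I • X) Y = 0 := by
  have hf1 : ContDiffAt ℝ 2 (fderiv ℝ f) y :=
    hf.fderiv_right (m := 2) (by norm_cast)
  have hf2 : DifferentiableAt ℝ (fderiv ℝ (fderiv ℝ f)) y :=
    (hf1.fderiv_right (m := 1) (by norm_num)).differentiableAt (by simp)
  have hev : ∀ᶠ y' in 𝓝 y, ContDiffAt ℝ 2 f y' :=
    (hf.of_le (m := 2) ENat.LEInfty.out).eventually (by simp)
  set D := fderiv ℝ (fderiv ℝ (fderiv ℝ f)) y with hD
  have hc : ∀ A : Fin n → ℂ, HasFDerivAt (𝕜 := ℝ) (fun _ : Fin n → ℂ => A) 0 y :=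
    fun A => hasFDerivAt_const A y
  have hDD : ∀ A B, HasFDerivAt (fun y' => fderiv ℝ (fderiv ℝ f) y' A B)
      ((D.flip A).flip B) y := fun A B => by
    refine ((hf2.hasFDerivAt.clm_apply (hc A)).clm_apply (hc B)).congr_fderiv ?_
    ext V
    simp [D]
  have e : ∀ V A B, fderiv ℝ G y V A B = D V A B + D V (Complex.I • A) (Complex.I • B) := by
    intro V A B
    have h1 := (hd.hasFDerivAt.clm_apply (hc A)).clm_apply (hc B)
    have h2 := (hDD A B).add (hDD (Complex.I • A) (Complex.I • B))
    have h3 := h1.congr_of_eventuallyEq (f₁ := fun y' => fderiv ℝ (fderiv ℝ f) y' A B +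
      fderiv ℝ (fderiv ℝ f) y' (Complex.I • A) (Complex.I • B)) (by
        filter_upwards [hG] with y' h
        rw [h]; rfl)
    simpa using congrArg (fun l => l V) (h3.unique h2)
  -- Together, `s1` and `s2` say that the third derivative is totally symmetric; the six terms of
  -- the cyclic sum then cancel in pairs.
  have s1 : ∀ V A B, D V A B = D V B A := by
    intro V A B
    have h := (hDD A B).congr_of_eventuallyEq (f₁ := fun y' => fderiv ℝ (fderiv ℝ f) y' B A) (by
      filter_upwards [hev] with y' h
      exact (h.isSymmSndFDerivAt (by simp)) B A)
    simpa using congrArg (fun l => l V) (h.unique (hDD B A))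
  have s2 : ∀ V A B, D V A B = D A V B := by
    intro V A B
    have := (hf1.isSymmSndFDerivAt (by simp)) V A
    rw [hD, this]
  simp only [e, IsKahlerMetric.I_smul_I_smul, map_neg, neg_apply]
  rw [s2 X (Complex.I • Y) Z, s1 (Complex.I • Y) X Z, s1 X Y, s2 X (Complex.I • Z) Y,
    s1 (Complex.I • Z), s2 Y (Complex.I • Z), s2 Y Z, s1 Z Y (Complex.I • X), s2 (Complex.I • Y),
    s1 Z (Complex.I • Y)]
  ring

end Levi

/-! ### Hermitian algebra -/

section Hermitian

variable {n : ℕ}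

theorem ofReal_sqNorm (Z : Fin n → ℂ) : (sqNorm Z : ℂ) = Z ⬝ᵥ star Z := by
  simp [sqNorm, dotProduct, Complex.mul_conj, Complex.normSq_eq_norm_sq]

theorem conj_dotProduct_star (V W : Fin n → ℂ) :
    (starRingEnd ℂ) (V ⬝ᵥ star W) = W ⬝ᵥ star V := by
  simp [dotProduct, mul_comm]

theorem sqNorm_nonneg (Z : Fin n → ℂ) : 0 ≤ sqNorm Z :=
  Finset.sum_nonneg fun _ _ => by positivity

theorem sqNorm_eq_zero {Z : Fin n → ℂ} : sqNorm Z = 0 ↔ Z = 0 := by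
  rw [sqNorm, Finset.sum_eq_zero_iff_of_nonneg fun _ _ => by positivity]
  simp [funext_iff]

theorem sqNorm_pos {Z : Fin n → ℂ} (h : Z ≠ 0) : 0 < sqNorm Z :=
  (sqNorm_nonneg Z).lt_of_ne fun h' => h (sqNorm_eq_zero.1 h'.symm)

/-- The component of `V` orthogonal to `Z`. -/
def orthPart (Z V : Fin n → ℂ) : Fin n → ℂ := V - (V ⬝ᵥ star Z / sqNorm Z) • Z

theorem sqNorm_orthPart {Z : Fin n → ℂ} (hZ : Z ≠ 0) (V : Fin n → ℂ) :
    (sqNorm (orthPart Z V) : ℂ) =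
      V ⬝ᵥ star V - (V ⬝ᵥ star Z) * (Z ⬝ᵥ star V) / sqNorm Z := by
  have h : (sqNorm Z : ℂ) ≠ 0 := by exact_mod_cast (sqNorm_pos hZ).ne'
  have h1 : (starRingEnd ℂ) (sqNorm Z : ℂ) = sqNorm Z := Complex.conj_ofReal _
  rw [ofReal_sqNorm, orthPart]
  simp only [star_sub, star_smul, sub_dotProduct, dotProduct_sub, smul_dotProduct,
    dotProduct_smul, smul_eq_mul, RCLike.star_def, map_div₀, h1, conj_dotProduct_star,
    ← ofReal_sqNorm Z]
  field_simp
  ring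

theorem fubiniStudy_self {Z : Fin n → ℂ} (hZ : Z ≠ 0) (V : Fin n → ℂ) :
    fubiniStudy Z V V = 2 * n * (sqNorm (orthPart Z V) / sqNorm Z) := by
  have h : (sqNorm Z : ℂ) ≠ 0 := by exact_mod_cast (sqNorm_pos hZ).ne'
  have e : (V ⬝ᵥ star V / sqNorm Z - (V ⬝ᵥ star Z) * (Z ⬝ᵥ star V) / sqNorm Z ^ 2 : ℂ) =
      ((sqNorm (orthPart Z V) / sqNorm Z : ℝ) : ℂ) := by
    rw [Complex.ofReal_div, sqNorm_orthPart hZ]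
    field_simp
  rw [fubiniStudy, e, Complex.ofReal_re]

theorem fubiniStudy_comm (Z V W : Fin n → ℂ) : fubiniStudy Z V W = fubiniStudy Z W V := by
  have h1 : (starRingEnd ℂ) (sqNorm Z : ℂ) = sqNorm Z := Complex.conj_ofReal _
  rw [fubiniStudy, fubiniStudy, ← Complex.conj_re]
  simp only [map_sub, map_div₀, map_mul, map_pow, conj_dotProduct_star, h1]
  ring_nf

theorem fubiniStudy_I (Z V W : Fin n → ℂ) :
    fubiniStudy Z (Complex.I • V) (Complex.I • W) = fubiniStudy Z V W := by
  rw [fubiniStudy, fubiniStudy]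
  simp only [star_smul, smul_dotProduct, dotProduct_smul, smul_eq_mul, RCLike.star_def,
    Complex.conj_I]
  congr 2
  linear_combination (- (V ⬝ᵥ star W / sqNorm Z) + (V ⬝ᵥ star Z) * (Z ⬝ᵥ star W) / sqNorm Z ^ 2)
    * Complex.I_sq

theorem fubiniStudy_isBilinearMap (Z : Fin n → ℂ) : IsBilinearMap ℝ (fubiniStudy Z) := by
  have hadd : ∀ V V' W, fubiniStudy Z (V + V') W = fubiniStudy Z V W + fubiniStudy Z V' W := by
    intro V V' W
    rw [fubiniStudy, fubiniStudy, fubiniStudy, ← mul_add, ← Complex.add_re]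
    simp only [add_dotProduct]
    congr 2; ring
  have hsmul : ∀ (a : ℝ) V W, fubiniStudy Z (a • V) W = a • fubiniStudy Z V W := by
    intro a V W
    rw [fubiniStudy, fubiniStudy, smul_eq_mul, mul_left_comm a, ← Complex.re_ofReal_mul a]
    simp only [smul_dotProduct, Complex.real_smul]
    congr 2; ring
  exact ⟨hadd, hsmul, fun V W W' => by
    rw [fubiniStudy_comm, hadd, fubiniStudy_comm, fubiniStudy_comm Z V W'], fun a V W => by
    rw [fubiniStudy_comm, hsmul, fubiniStudy_comm]⟩

end Hermitian

/-! ### The Levi form of the logarithm of a Hermitian norm -/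

section LogNorm

variable {n m : ℕ} {T : (Fin n → ℂ) → (Fin m → ℂ)} {L : (Fin n → ℂ) →L[ℝ] (Fin m → ℂ)}

theorem contDiff_of_affine (hT : ∀ y, HasFDerivAt T L y) : ContDiff ℝ ∞ T := by
  refine contDiff_infty_iff_fderiv.2 ⟨fun y => (hT y).differentiableAt, ?_⟩
  rw [show fderiv ℝ T = fun _ => L from funext fun y => (hT y).fderiv]
  exact contDiff_const

theorem hasFDerivAt_dotProduct_star (hT : ∀ y, HasFDerivAt T L y) (V : Fin m → ℂ)
    (y : Fin n → ℂ) :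
    ∃ D : (Fin n → ℂ) →L[ℝ] ℂ, HasFDerivAt (fun y' => V ⬝ᵥ star (T y')) D y ∧
      ∀ X, D X = V ⬝ᵥ star (L X) := by
  refine ⟨∑ j, V j • (Complex.conjCLE : ℂ →L[ℝ] ℂ).comp
    ((ContinuousLinearMap.proj (R := ℝ) j).comp L), ?_, fun X => ?_⟩
  · simp only [dotProduct]
    refine HasFDerivAt.fun_sum fun j _ => ?_
    have h1 := (ContinuousLinearMap.proj (R := ℝ) (φ := fun _ : Fin m => ℂ) j).hasFDerivAt.comp y
      (hT y)
    exact ((Complex.conjCLE : ℂ →L[ℝ] ℂ).hasFDerivAt.comp y h1).const_smul (V j)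
  · simp [dotProduct]

theorem hasFDerivAt_sqNorm (hT : ∀ y, HasFDerivAt T L y) (y : Fin n → ℂ) :
    ∃ D : (Fin n → ℂ) →L[ℝ] ℝ, HasFDerivAt (fun y' => sqNorm (T y')) D y ∧
      ∀ X, D X = 2 * (L X ⬝ᵥ star (T y)).re := by
  have hj : ∀ j, HasFDerivAt (fun y' => T y' j)
      ((ContinuousLinearMap.proj (R := ℝ) j).comp L) y := fun j =>
    (ContinuousLinearMap.proj (R := ℝ) (φ := fun _ : Fin m => ℂ) j).hasFDerivAt.comp y (hT y)
  refine ⟨_, HasFDerivAt.fun_sum fun j _ => (hj j).norm_sq, fun X => ?_⟩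
  simp [dotProduct, Complex.inner, Finset.mul_sum, mul_add]

theorem contDiff_sqNorm (hT : ∀ y, HasFDerivAt T L y) :
    ContDiff ℝ ∞ (fun y => sqNorm (T y)) := by
  have h := contDiff_of_affine hT
  exact ContDiff.sum fun j _ => (contDiff_pi.1 h j).norm_sq ℝ

theorem contDiffAt_log_sqNorm (hT : ∀ y, HasFDerivAt T L y) {y : Fin n → ℂ} (hy : T y ≠ 0) :
    ContDiffAt ℝ ∞ (fun y => Real.log (sqNorm (T y))) y :=
  (contDiff_sqNorm hT).contDiffAt.log (sqNorm_pos hy).ne'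

theorem fderiv_log_sqNorm (hT : ∀ y, HasFDerivAt T L y) {y : Fin n → ℂ} (hy : T y ≠ 0)
    (X : Fin n → ℂ) : fderiv ℝ (fun y => Real.log (sqNorm (T y))) y X =
      2 * (L X ⬝ᵥ star (T y)).re / sqNorm (T y) := by
  obtain ⟨D, hD, hDX⟩ := hasFDerivAt_sqNorm hT y
  rw [(hD.log (sqNorm_pos hy).ne').fderiv]
  simp [hDX]
  ring

/-- This is `4 ∂∂̄ log |T|²`. Adding the real Hessian at `(iX, iY)` completes products of real parts
to real parts of Hermitian products; `T` is affine and contributes no second derivative. -/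
theorem levi_log_sqNorm (hT : ∀ y, HasFDerivAt T L y)
    (hL : ∀ X, L (Complex.I • X) = Complex.I • L X) {y : Fin n → ℂ} (hy : T y ≠ 0)
    (X Y : Fin n → ℂ) : levi (fun y => Real.log (sqNorm (T y))) y X Y =
      4 * (L X ⬝ᵥ star (L Y) / sqNorm (T y) -
        (L X ⬝ᵥ star (T y)) * (T y ⬝ᵥ star (L Y)) / sqNorm (T y) ^ 2 : ℂ).re := by
  have hN := (sqNorm_pos hy).ne'
  have hne : ∀ᶠ y' in 𝓝 y, T y' ≠ 0 :=
    (hT y).continuousAt.eventually (isOpen_ne.mem_nhds hy)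
  have key : ∀ X Y, fderiv ℝ (fderiv ℝ (fun y => Real.log (sqNorm (T y)))) y X Y =
      2 * (L Y ⬝ᵥ star (L X)).re / sqNorm (T y) -
        4 * (L Y ⬝ᵥ star (T y)).re * (L X ⬝ᵥ star (T y)).re / sqNorm (T y) ^ 2 := by
    intro X Y
    obtain ⟨D, hD, hDX⟩ := hasFDerivAt_sqNorm hT y
    obtain ⟨D', hD', hDX'⟩ := hasFDerivAt_dotProduct_star hT (L Y) y
    have h0 : (fun y' => fderiv ℝ (fun y => Real.log (sqNorm (T y))) y' Y) =ᶠ[𝓝 y]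
        fun y' => 2 * (L Y ⬝ᵥ star (T y')).re * (sqNorm (T y'))⁻¹ := by
      filter_upwards [hne] with y' h
      rw [fderiv_log_sqNorm hT h, div_eq_mul_inv]
    have h1 : HasFDerivAt (fun y' => (L Y ⬝ᵥ star (T y')).re) (Complex.reCLM.comp D') y :=
      Complex.reCLM.hasFDerivAt.comp y hD'
    have h2 := (hasDerivAt_inv hN).comp_hasFDerivAt y hD
    rw [fderiv_fderiv_apply ((contDiffAt_log_sqNorm hT hy).of_le ENat.LEInfty.out)
      (((h1.const_mul 2).mul h2).congr_of_eventuallyEq h0)]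
    simp [hDX, hDX']
    field_simp
    ring
  have e1 : ∀ (a b : ℂ) (r : ℝ), (a / r - b / r ^ 2 : ℂ).re = a.re / r - b.re / r ^ 2 := by
    intro a b r
    rw [← Complex.ofReal_pow, Complex.sub_re, Complex.div_ofReal_re, Complex.div_ofReal_re]
  rw [levi, key, key, e1, hL, hL, ← conj_dotProduct_star (L Y) (T y),
    ← conj_dotProduct_star (L Y) (L X)]
  simp only [star_smul, smul_dotProduct, dotProduct_smul, smul_eq_mul, RCLike.star_def,
    Complex.conj_I]
  simp only [Complex.mul_re, Complex.I_re, Complex.I_im, Complex.conj_re, Complex.conj_im,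
    Complex.mul_im, Complex.neg_re, Complex.neg_im]
  field_simp
  ring

end LogNorm

/-! ### The metric in a chart -/

/-- `W` is the momentum coordinate as a function of the squared fibre norm `r`, for the metric on
`M_{n,k}` generated by `φ` on `[-c, c]`. -/
structure Profile (n k : ℕ) (c : ℝ) (φ W : ℝ → ℝ) : Prop where
  phi_smooth : ContDiff ℝ ∞ φ
  phi_even : ∀ x, φ (-x) = φ x
  smooth : ∀ r, 0 ≤ r → ContDiffAt ℝ ∞ W r
  zero : W 0 = -c
  ode : ∀ r, 0 ≤ r → 2 * r * deriv W r = φ (W r)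
  ode_near_zero : ∀ᶠ r in 𝓝 (0 : ℝ), 2 * r * deriv W r = φ (W r)
  deriv_pos : ∀ r, 0 ≤ r → 0 < deriv W r
  image : W '' Set.Ioi 0 = Set.Ioo (-c) c
  odd : ∀ r, 0 < r → W r⁻¹ = -W r
  c_pos : 0 < c
  mul_lt : k * c < n
  k_pos : 0 < k

namespace Profile

variable {n k : ℕ} {c : ℝ} {φ W : ℝ → ℝ}

theorem mem_Ioo (h : Profile n k c φ W) {r : ℝ} (hr : 0 < r) : W r ∈ Set.Ioo (-c) c := by
  rw [← h.image]; exact ⟨r, hr, rfl⟩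

theorem mem_Icc (h : Profile n k c φ W) {r : ℝ} (hr : 0 ≤ r) : W r ∈ Set.Icc (-c) c := by
  rcases hr.eq_or_lt with rfl | hr
  · rw [h.zero]; exact ⟨le_rfl, by linarith [h.c_pos]⟩
  · exact Set.Ioo_subset_Icc_self (h.mem_Ioo hr)

theorem hasDerivAt (h : Profile n k c φ W) {r : ℝ} (hr : 0 ≤ r) : HasDerivAt W (deriv W r) r :=
  ((h.smooth r hr).differentiableAt (by simp)).hasDerivAt

theorem deriv_smooth (h : Profile n k c φ W) {r : ℝ} (hr : 0 ≤ r) : ContDiffAt ℝ ∞ (deriv W) r := by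
  have := ((h.smooth r hr).fderiv_right (m := ∞) (by simp)).clm_apply
    (contDiffAt_const (c := (1 : ℝ)))
  exact this

/-- `n + κ W > 0` if `|κ| = k`. -/
theorem sigma_pos (h : Profile n k c φ W) {κ : ℝ} (hκ : |κ| = k) {r : ℝ} (hr : 0 ≤ r) :
    0 < n + κ * W r := by
  have h1 : |W r| ≤ c := abs_le.2 (h.mem_Icc hr)
  have h2 : |κ * W r| ≤ k * c := by
    rw [abs_mul, hκ]; gcongr
  have := (abs_le.1 h2).1
  linarith [h.mul_lt]

theorem hasDerivAt_exp (h : Profile n k c φ W) (s : ℝ) :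
    HasDerivAt (fun s => W (Real.exp (2 * s))) (φ (W (Real.exp (2 * s)))) s := by
  have h1 : HasDerivAt (fun s => Real.exp (2 * s)) (Real.exp (2 * s) * 2) s := by
    simpa using ((hasDerivAt_id s).const_mul 2).exp
  have h2 := (h.hasDerivAt (Real.exp_pos (2 * s)).le).comp s h1
  refine h2.congr_deriv ?_
  rw [← h.ode _ (Real.exp_pos _).le]; ring

theorem contDiff_exp (h : Profile n k c φ W) : ContDiff ℝ ∞ (fun s => W (Real.exp (2 * s))) :=
  contDiff_iff_contDiffAt.2 fun s =>
    (h.smooth _ (Real.exp_pos _).le).comp s (f := fun s => Real.exp (2 * s))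
      ((contDiff_const.mul contDiff_id).exp.contDiffAt)

end Profile

/-! ### Coordinate expressions: smoothness, positivity and potential of the metric in a chart. -/

section Local

variable {n : ℕ}

/-- The linear part of the affine map replacing the `i`-th coordinate by `1`. -/
def horCLM (i : Fin n) : (Fin n → ℂ) →L[ℝ] (Fin n → ℂ) :=
  ContinuousLinearMap.pi fun j => if j = i then 0 else ContinuousLinearMap.proj j

theorem horCLM_apply (i : Fin n) (X : Fin n → ℂ) : horCLM i X = Function.update X i 0 := by
  funext j
  by_cases h : j = i
  · subst h; simp [horCLM]
  · simp [horCLM, h]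

theorem horCLM_I (i : Fin n) (X : Fin n → ℂ) :
    horCLM i (Complex.I • X) = Complex.I • horCLM i X := by
  funext j
  by_cases h : j = i
  · subst h; simp [horCLM]
  · simp [horCLM, h]

theorem hasFDerivAt_update_one (i : Fin n) (y : Fin n → ℂ) :
    HasFDerivAt (fun y : Fin n → ℂ => Function.update y i (1 : ℂ)) (horCLM i) y := by
  refine hasFDerivAt_pi.2 fun j => ?_
  by_cases h : j = i
  · subst h
    simpa using hasFDerivAt_const (1 : ℂ) y
  · have e : (fun y : Fin n → ℂ => Function.update y i (1 : ℂ) j) =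
        ContinuousLinearMap.proj (R := ℝ) (φ := fun _ : Fin n => ℂ) j := by
      funext y'; simp [h]
    rw [e]
    refine (ContinuousLinearMap.hasFDerivAt _).congr_fderiv ?_
    ext X; simp [h]

theorem update_one_ne_zero (i : Fin n) (y : Fin n → ℂ) : Function.update y i (1 : ℂ) ≠ 0 :=
  fun h => by simpa using congrFun h i

theorem sqNorm_update_pos (i : Fin n) (y : Fin n → ℂ) : 0 < sqNorm (Function.update y i (1 : ℂ)) :=
  sqNorm_pos (update_one_ne_zero i y)

/-- The fibre coordinate, as a map into `ℂ^1`. -/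
def fibCLM (i : Fin n) : (Fin n → ℂ) →L[ℝ] (Fin 1 → ℂ) :=
  ContinuousLinearMap.pi fun _ => ContinuousLinearMap.proj i

theorem fibCLM_apply (i : Fin n) (X : Fin n → ℂ) (j : Fin 1) : fibCLM i X j = X i := rfl

theorem fibCLM_ne_zero {i : Fin n} {y : Fin n → ℂ} (hy : y i ≠ 0) : fibCLM i y ≠ 0 :=
  fun h => hy (congrFun h 0)

theorem sqNorm_fibCLM (i : Fin n) (y : Fin n → ℂ) : sqNorm (fibCLM i y) = ‖y i‖ ^ 2 := by
  simp [sqNorm, fibCLM_apply]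

/-- The logarithm of the fibre norm (or of its inverse), for `κ = k` (or `κ = -k`). -/
def logRad (κ : ℝ) (i : Fin n) (y : Fin n → ℂ) : ℝ :=
  1 / 2 * Real.log (sqNorm (fibCLM i y)) + κ / 2 * Real.log (sqNorm (Function.update y i (1 : ℂ)))

/-- The square of the fibre norm (or of its inverse), for `κ = k` (or `κ = -k`). -/
def rad (κ : ℝ) (i : Fin n) (y : Fin n → ℂ) : ℝ :=
  ‖y i‖ ^ 2 * Real.exp (κ * Real.log (sqNorm (Function.update y i (1 : ℂ))))

theorem rad_nonneg (κ : ℝ) (i : Fin n) (y : Fin n → ℂ) : 0 ≤ rad κ i y := by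
  unfold rad; positivity

theorem exp_logRad (κ : ℝ) (i : Fin n) {y : Fin n → ℂ} (hy : y i ≠ 0) :
    Real.exp (2 * logRad κ i y) = rad κ i y := by
  have h : 0 < ‖y i‖ ^ 2 := by positivity
  rw [logRad, rad, sqNorm_fibCLM, mul_add, Real.exp_add, ← mul_assoc, ← mul_assoc]
  rw [show (2 : ℝ) * (1 / 2) = 1 by norm_num, one_mul, Real.exp_log h, mul_div_cancel₀ κ two_ne_zero]

/-- The `(1,0)`-form dual to the generator of the action of `ℂ^*`, multiplied by the fibre
coordinate. -/
def theta (κ : ℝ) (i : Fin n) (y X : Fin n → ℂ) : ℂ :=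
  X i + κ * y i * (Function.update X i 0 ⬝ᵥ star (Function.update y i (1 : ℂ))
    / sqNorm (Function.update y i (1 : ℂ)))

theorem theta_add (κ : ℝ) (i : Fin n) (y X Y : Fin n → ℂ) :
    theta κ i y (X + Y) = theta κ i y X + theta κ i y Y := by
  simp only [theta, ← horCLM_apply, map_add, add_dotProduct, Pi.add_apply]
  ring

theorem theta_smul (κ : ℝ) (i : Fin n) (y : Fin n → ℂ) (a : ℝ) (X : Fin n → ℂ) :
    theta κ i y (a • X) = a * theta κ i y X := by
  simp only [theta, ← horCLM_apply, map_smul, smul_dotProduct, Pi.smul_apply, Complex.real_smul]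
  ring

theorem theta_I (κ : ℝ) (i : Fin n) (y X : Fin n → ℂ) :
    theta κ i y (Complex.I • X) = Complex.I * theta κ i y X := by
  simp only [theta, ← horCLM_apply, horCLM_I, smul_dotProduct, Pi.smul_apply, smul_eq_mul]
  ring

/-- The metric in the chart `i`, as a function of two vectors. -/
def localForm (κ : ℝ) (W : ℝ → ℝ) (i : Fin n) (y X Y : Fin n → ℂ) : ℝ :=
  (1 + κ / n * W (rad κ i y)) * fubiniStudy (Function.update y i (1 : ℂ))
    (Function.update X i 0) (Function.update Y i 0)
  + 2 * deriv W (rad κ i y) * Real.exp (κ * Real.log (sqNorm (Function.update y i (1 : ℂ)))) *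
    (theta κ i y X * (starRingEnd ℂ) (theta κ i y Y)).re

theorem localForm_comm (κ : ℝ) (W : ℝ → ℝ) (i : Fin n) (y X Y : Fin n → ℂ) :
    localForm κ W i y X Y = localForm κ W i y Y X := by
  rw [localForm, localForm, fubiniStudy_comm]
  congr 2
  simp [Complex.mul_re]
  ring

theorem localForm_isBilinearMap (κ : ℝ) (W : ℝ → ℝ) (i : Fin n) (y : Fin n → ℂ) :
    IsBilinearMap ℝ (localForm κ W i y) := by
  have hF := fubiniStudy_isBilinearMap (Function.update y i (1 : ℂ))
  have hadd : ∀ X X' Y, localForm κ W i y (X + X') Y =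
      localForm κ W i y X Y + localForm κ W i y X' Y := by
    intro X X' Y
    simp only [localForm, theta_add, ← horCLM_apply, map_add, hF.add_left, add_mul,
      Complex.add_re]
    ring
  have hsmul : ∀ (a : ℝ) X Y, localForm κ W i y (a • X) Y = a • localForm κ W i y X Y := by
    intro a X Y
    simp only [localForm, theta_smul, ← horCLM_apply, map_smul, hF.smul_left, mul_assoc,
      Complex.re_ofReal_mul, smul_eq_mul]
    ring
  exact ⟨hadd, hsmul, fun X Y Y' => by
    rw [localForm_comm, hadd, localForm_comm, localForm_comm κ W i y X Y'], fun a X Y => by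
    rw [localForm_comm, hsmul, localForm_comm]⟩

theorem localForm_I (κ : ℝ) (W : ℝ → ℝ) (i : Fin n) (y X Y : Fin n → ℂ) :
    localForm κ W i y (Complex.I • X) (Complex.I • Y) = localForm κ W i y X Y := by
  simp only [localForm, theta_I, ← horCLM_apply, horCLM_I, fubiniStudy_I]
  congr 2
  simp [Complex.mul_re]

/-- The metric in the chart `i`. -/
def localMetric (κ : ℝ) (W : ℝ → ℝ) (i : Fin n) (y : Fin n → ℂ) :
    (Fin n → ℂ) →L[ℝ] (Fin n → ℂ) →L[ℝ] ℝ :=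
  (localForm_isBilinearMap κ W i y).toContinuousBilinearMap

theorem localMetric_apply (κ : ℝ) (W : ℝ → ℝ) (i : Fin n) (y X Y : Fin n → ℂ) :
    localMetric κ W i y X Y = localForm κ W i y X Y := rfl

theorem contDiff_log_sqNorm_update (i : Fin n) :
    ContDiff ℝ ∞ fun y => Real.log (sqNorm (Function.update y i (1 : ℂ))) :=
  contDiff_iff_contDiffAt.2 fun y =>
    contDiffAt_log_sqNorm (hasFDerivAt_update_one i) (update_one_ne_zero i y)

theorem contDiff_rad (κ : ℝ) (i : Fin n) : ContDiff ℝ ∞ (rad κ i) :=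
  ((contDiff_apply ℝ ℂ i).norm_sq ℝ).mul (contDiff_const.mul (contDiff_log_sqNorm_update i)).exp

theorem contDiff_dotProduct_star_update (i : Fin n) (V : Fin n → ℂ) :
    ContDiff ℝ ∞ fun y => V ⬝ᵥ star (Function.update y i (1 : ℂ)) := by
  have h := contDiff_pi.1 (contDiff_of_affine (hasFDerivAt_update_one i))
  simp only [dotProduct]
  exact ContDiff.sum fun j _ => contDiff_const.mul
    ((Complex.conjCLE : ℂ →L[ℝ] ℂ).contDiff.comp (h j))

theorem contDiff_sqNorm_update_inv (i : Fin n) :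
    ContDiff ℝ ∞ fun y => ((sqNorm (Function.update y i (1 : ℂ)) : ℂ))⁻¹ := by
  have h := (contDiff_sqNorm (hasFDerivAt_update_one i)).inv
    (fun y => (sqNorm_update_pos i y).ne')
  have h2 := Complex.ofRealCLM.contDiff.comp h (n := ∞)
  convert h2 using 1
  funext y
  simp

theorem contDiff_theta (κ : ℝ) (i : Fin n) (X : Fin n → ℂ) :
    ContDiff ℝ ∞ fun y => theta κ i y X := by
  have h1 := contDiff_dotProduct_star_update i (Function.update X i 0)
  have h2 := contDiff_sqNorm_update_inv i
  simp only [theta, div_eq_mul_inv]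
  exact contDiff_const.add ((contDiff_const.mul (contDiff_apply ℝ ℂ i)).mul (h1.mul h2))

theorem contDiff_fubiniStudy (i : Fin n) (V W : Fin n → ℂ) :
    ContDiff ℝ ∞ fun y => fubiniStudy (Function.update y i (1 : ℂ)) V W := by
  have h1 := contDiff_dotProduct_star_update i
  have h2 := contDiff_sqNorm_update_inv i
  have h3 : ContDiff ℝ ∞ fun y => Function.update y i (1 : ℂ) ⬝ᵥ star W := by
    convert (Complex.conjCLE : ℂ →L[ℝ] ℂ).contDiff.comp (h1 W) using 1
    funext y
    exact (conj_dotProduct_star _ _).symm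
  simp only [fubiniStudy, div_eq_mul_inv, ← inv_pow]
  exact contDiff_const.mul (Complex.reCLM.contDiff.comp
    ((contDiff_const.mul h2).sub (((h1 V).mul h3).mul (h2.pow 2))))

variable {k : ℕ} {c : ℝ} {φ W : ℝ → ℝ}

theorem contDiff_localMetric (h : Profile n k c φ W) (κ : ℝ) (i : Fin n) :
    ContDiff ℝ ∞ (localMetric κ W i) := by
  refine contDiff_clm_apply_iff.2 fun X => contDiff_clm_apply_iff.2 fun Y => ?_
  simp only [localMetric_apply, localForm]
  have hr := contDiff_rad κ i
  have hW : ContDiff ℝ ∞ fun y => W (rad κ i y) := contDiff_iff_contDiffAt.2 fun y =>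
    (h.smooth _ (rad_nonneg κ i y)).comp y hr.contDiffAt
  have hW' : ContDiff ℝ ∞ fun y => deriv W (rad κ i y) := contDiff_iff_contDiffAt.2 fun y =>
    (h.deriv_smooth (rad_nonneg κ i y)).comp y hr.contDiffAt
  exact ((contDiff_const.add (contDiff_const.mul hW)).mul (contDiff_fubiniStudy i _ _)).add
    (((contDiff_const.mul hW').mul (contDiff_const.mul (contDiff_log_sqNorm_update i)).exp).mul
    (Complex.reCLM.contDiff.comp ((contDiff_theta κ i X).mul
      ((Complex.conjCLE : ℂ →L[ℝ] ℂ).contDiff.comp (contDiff_theta κ i Y)))))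

theorem localMetric_pos (h : Profile n k c φ W) {κ : ℝ} (hκ : |κ| = k) (i : Fin n)
    (y X : Fin n → ℂ) (hX : X ≠ 0) : 0 < localMetric κ W i y X X := by
  have hn : (0 : ℝ) < n := by exact_mod_cast Fin.pos i
  have hr := rad_nonneg κ i y
  have h1 : 0 < 1 + κ / n * W (rad κ i y) := by
    have := h.sigma_pos hκ hr
    have e : 1 + κ / n * W (rad κ i y) = (n + κ * W (rad κ i y)) / n := by field_simp
    rw [e]; positivity
  have h2 := h.deriv_pos _ hr
  have hN := sqNorm_update_pos i y
  rw [localMetric_apply, localForm, fubiniStudy_self (update_one_ne_zero i y), Complex.mul_conj,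
    Complex.ofReal_re]
  have t1 : 0 ≤ sqNorm (orthPart (Function.update y i 1) (Function.update X i 0)) :=
    sqNorm_nonneg _
  have t2 : 0 ≤ Complex.normSq (theta κ i y X) := Complex.normSq_nonneg _
  -- The horizontal part of `X` may be degenerate. The `i`-th entry of `Z` is `1` and that of the
  -- horizontal vector is `0`, so a horizontal vector proportional to `Z` vanishes; `X` is then
  -- vertical and the second summand is positive.
  rcases t1.eq_or_lt with t1 | t1
  · have e1 := sqNorm_eq_zero.1 t1.symm
    have e2 := congrFun e1 i
    simp only [orthPart, Pi.sub_apply, Pi.smul_apply, Function.update_self, smul_eq_mul,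
      mul_one, zero_sub, Pi.zero_apply, neg_eq_zero] at e2
    rw [orthPart, e2, zero_smul, sub_zero] at e1
    have e3 : theta κ i y X = X i := by rw [theta, e2]; simp
    have e4 : X i ≠ 0 := fun h0 => hX <| by
      funext j
      by_cases hj : j = i
      · subst hj; exact h0
      · simpa [hj] using congrFun e1 j
    have t3 : 0 < Complex.normSq (theta κ i y X) := by rw [e3]; exact Complex.normSq_pos.2 e4
    rw [← t1]
    simp only [zero_div, mul_zero, zero_add]
    positivity
  · have : 0 < sqNorm (orthPart (Function.update y i 1) (Function.update X i 0)) /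
        sqNorm (Function.update y i 1) := div_pos t1 hN
    positivity

theorem contDiffAt_logRad (κ : ℝ) {i : Fin n} {y : Fin n → ℂ} (hy : y i ≠ 0) :
    ContDiffAt ℝ ∞ (logRad κ i) y :=
  (contDiffAt_const.mul (contDiffAt_log_sqNorm (fun _ => (fibCLM i).hasFDerivAt)
    (fibCLM_ne_zero hy))).add
    (contDiffAt_const.mul (contDiff_log_sqNorm_update i).contDiffAt)

/-- The `(1,0)`-form dual to the generator of the action of `ℂ^*`. -/
theorem theta_div {κ : ℝ} {i : Fin n} {y : Fin n → ℂ} (hy : y i ≠ 0) (X : Fin n → ℂ) :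
    theta κ i y X / y i = X i / y i + κ * (Function.update X i 0 ⬝ᵥ
      star (Function.update y i (1 : ℂ)) / sqNorm (Function.update y i (1 : ℂ))) := by
  rw [theta]; field_simp

theorem fderiv_logRad {κ : ℝ} {i : Fin n} {y : Fin n → ℂ} (hy : y i ≠ 0) (X : Fin n → ℂ) :
    fderiv ℝ (logRad κ i) y X = (theta κ i y X / y i).re := by
  have h1 := contDiffAt_log_sqNorm (fun _ => (fibCLM i).hasFDerivAt) (fibCLM_ne_zero hy)
  have h2 := (contDiff_log_sqNorm_update i).contDiffAt (x := y)
  have d1 := ((h1.differentiableAt (by simp)).hasFDerivAt.const_mul (1 / 2)).fun_add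
    ((h2.differentiableAt (by simp)).hasFDerivAt.const_mul (κ / 2))
  have e := d1.fderiv
  rw [show logRad κ i = fun y => 1 / 2 * Real.log (sqNorm (fibCLM i y)) +
    κ / 2 * Real.log (sqNorm (Function.update y i (1 : ℂ))) from rfl]
  rw [e]
  simp only [add_apply, smul_apply, smul_eq_mul]
  rw [fderiv_log_sqNorm (fun _ => (fibCLM i).hasFDerivAt) (fibCLM_ne_zero hy),
    fderiv_log_sqNorm (hasFDerivAt_update_one i) (update_one_ne_zero i y), theta_div hy,
    Complex.add_re, Complex.re_ofReal_mul, Complex.div_ofReal_re, horCLM_apply, sqNorm_fibCLM]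
  have e3 : (X i / y i).re = (X i * (starRingEnd ℂ) (y i)).re / ‖y i‖ ^ 2 := by
    rw [← Complex.div_ofReal_re, Complex.ofReal_pow, ← Complex.mul_conj']
    have : (starRingEnd ℂ) (y i) ≠ 0 := by simpa using hy
    field_simp
  rw [e3]
  simp only [dotProduct, Finset.univ_unique, Finset.sum_singleton, fibCLM_apply, Pi.star_apply,
    RCLike.star_def]
  ring

/-- The term `log |y_i|²` is pluriharmonic where `y_i ≠ 0`, so only `log |Z|²` contributes. -/
theorem levi_logRad {κ : ℝ} {i : Fin n} {y : Fin n → ℂ} (hy : y i ≠ 0) (X Y : Fin n → ℂ) :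
    levi (logRad κ i) y X Y = κ / n * fubiniStudy (Function.update y i (1 : ℂ))
      (Function.update X i 0) (Function.update Y i 0) := by
  have hn : (n : ℝ) ≠ 0 := by exact_mod_cast (Fin.pos i).ne'
  have h1 := contDiffAt_log_sqNorm (fun _ => (fibCLM i).hasFDerivAt) (fibCLM_ne_zero hy)
  have h2 := (contDiff_log_sqNorm_update i).contDiffAt (x := y)
  have key : ∀ X Y, fderiv ℝ (fderiv ℝ (logRad κ i)) y X Y =
      1 / 2 * fderiv ℝ (fderiv ℝ (fun y => Real.log (sqNorm (fibCLM i y)))) y X Y + κ / 2 *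
        fderiv ℝ (fderiv ℝ (fun y => Real.log (sqNorm (Function.update y i (1 : ℂ))))) y X Y := by
    intro X Y
    have le : (2 : ℕ∞ω) ≤ ∞ := ENat.LEInfty.out
    have h0 : (fun y' => fderiv ℝ (logRad κ i) y' Y) =ᶠ[𝓝 y] fun y' =>
        1 / 2 * fderiv ℝ (fun y => Real.log (sqNorm (fibCLM i y))) y' Y + κ / 2 *
        fderiv ℝ (fun y => Real.log (sqNorm (Function.update y i (1 : ℂ)))) y' Y := by
      filter_upwards [eventually_differentiableAt (h1.of_le le),
        eventually_differentiableAt (h2.of_le le)] with y' d1 d2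
      have := ((d1.hasFDerivAt.const_mul (1 / 2)).fun_add (d2.hasFDerivAt.const_mul (κ / 2))).fderiv
      rw [show logRad κ i = fun y => 1 / 2 * Real.log (sqNorm (fibCLM i y)) +
        κ / 2 * Real.log (sqNorm (Function.update y i (1 : ℂ))) from rfl, this]
      simp
    have d1 := (differentiableAt_fderiv_of_contDiffAt (h1.of_le le)).hasFDerivAt.clm_apply
      (hasFDerivAt_const Y y)
    have d2 := (differentiableAt_fderiv_of_contDiffAt (h2.of_le le)).hasFDerivAt.clm_apply
      (hasFDerivAt_const Y y)
    rw [fderiv_fderiv_apply ((contDiffAt_logRad κ hy).of_le le)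
      (((d1.const_mul (1 / 2)).add (d2.const_mul (κ / 2))).congr_of_eventuallyEq h0)]
    simp
  have e : levi (logRad κ i) y X Y =
      1 / 2 * levi (fun y => Real.log (sqNorm (fibCLM i y))) y X Y + κ / 2 *
      levi (fun y => Real.log (sqNorm (Function.update y i (1 : ℂ)))) y X Y := by
    simp only [levi, key]; ring
  have e0 : (fibCLM i X ⬝ᵥ star (fibCLM i Y) / (sqNorm (fibCLM i y) : ℂ) -
      (fibCLM i X ⬝ᵥ star (fibCLM i y)) * (fibCLM i y ⬝ᵥ star (fibCLM i Y)) /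
        (sqNorm (fibCLM i y) : ℂ) ^ 2) = 0 := by
    have h3 : (starRingEnd ℂ) (y i) ≠ 0 := by simpa using hy
    rw [ofReal_sqNorm]
    simp only [dotProduct, Finset.univ_unique, Finset.sum_singleton, fibCLM_apply, Pi.star_apply,
      RCLike.star_def]
    field_simp
    ring
  rw [e, levi_log_sqNorm (fun _ => (fibCLM i).hasFDerivAt) (fun X => by
    ext j; simp [fibCLM_apply]) (fibCLM_ne_zero hy),
    levi_log_sqNorm (hasFDerivAt_update_one i) (horCLM_I i) (update_one_ne_zero i y), e0,
    horCLM_apply, horCLM_apply, fubiniStudy]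
  simp only [Complex.zero_re]
  field_simp
  ring

/-- Away from the two sections the metric is the Levi form of a function of the fibre norm. -/
theorem localForm_eq_levi (h : Profile n k c φ W) {F : ℝ → ℝ} (hF : ContDiff ℝ ∞ F)
    (hF' : ∀ s, HasDerivAt F (n / k + W (Real.exp (2 * s))) s) {ε : ℝ} (hε : ε = 1 ∨ ε = -1)
    (i : Fin n) {y : Fin n → ℂ} (hy : y i ≠ 0) (X Y : Fin n → ℂ) :
    localForm (ε * k) W i y X Y = levi (fun y => F (ε * logRad (ε * k) i y)) y X Y := by
  have hn : (n : ℝ) ≠ 0 := by exact_mod_cast (Fin.pos i).ne'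
  have hk : (k : ℝ) ≠ 0 := by exact_mod_cast h.k_pos.ne'
  have le : (2 : ℕ∞ω) ≤ ∞ := ENat.LEInfty.out
  set κ := ε * k with hκ
  have hr : 0 < rad κ i y := by rw [← exp_logRad κ i hy]; exact Real.exp_pos _
  have hFε : ∀ s, HasDerivAt (fun s => F (ε * s))
      (ε * (n / k + W (Real.exp (2 * (ε * s))))) s := fun s => by
    have h1 : HasDerivAt (fun s => ε * s) ε s := by simpa using (hasDerivAt_id s).const_mul ε
    refine ((hF' (ε * s)).comp s h1).congr_deriv (by ring)
  -- For `ε = -1` the argument `e^{2s}` is the inverse of `rad`; oddness of `W` under inversion and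
  -- evenness of `φ` bring the formula to the form it has for `ε = 1`.
  have hFε2 : HasDerivAt (fun s => ε * (n / k + W (Real.exp (2 * (ε * s)))))
      (φ (W (rad κ i y))) (logRad κ i y) := by
    have h1 : HasDerivAt (fun s => ε * s) ε (logRad κ i y) := by
      simpa using (hasDerivAt_id _).const_mul ε
    refine ((((h.hasDerivAt_exp (ε * logRad κ i y)).comp _ h1).const_add
      ((n : ℝ) / k)).const_mul ε).congr_deriv ?_
    rcases hε with rfl | rfl
    · rw [one_mul, one_mul, exp_logRad κ i hy, mul_one]
    · rw [show 2 * (-1 * logRad κ i y) = -(2 * logRad κ i y) by ring, Real.exp_neg,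
        exp_logRad κ i hy, h.odd _ hr, h.phi_even]; ring
  rw [levi_comp (f := logRad κ i) ((contDiffAt_logRad κ hy).of_le le) (F := fun s => F (ε * s))
    ((hF.comp (contDiff_const.mul contDiff_id)).of_le le) hFε hFε2, levi_logRad hy]
  have e1 : ε * (n / k + W (Real.exp (2 * (ε * logRad κ i y)))) * (κ / n) =
      1 + κ / n * W (rad κ i y) := by
    rcases hε with rfl | rfl
    · rw [one_mul, one_mul, exp_logRad κ i hy, hκ]; field_simp
    · rw [show 2 * (-1 * logRad κ i y) = -(2 * logRad κ i y) by ring, Real.exp_neg,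
        exp_logRad κ i hy, h.odd _ hr, hκ]; field_simp
  rw [← mul_assoc, e1, localForm, add_comm]
  congr 1
  simp only [fderiv_logRad hy, theta_I]
  rw [← h.ode _ hr.le]
  have e2 : ∀ X, ∃ a, theta κ i y X = y i * a := fun X => ⟨theta κ i y X / y i, by field_simp⟩
  obtain ⟨a, ha⟩ := e2 X
  obtain ⟨b, hb⟩ := e2 Y
  rw [ha, hb, rad, ← Complex.normSq_eq_norm_sq, Complex.normSq_apply, mul_left_comm Complex.I,
    mul_left_comm Complex.I, mul_div_cancel_left₀ _ hy, mul_div_cancel_left₀ _ hy,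
    mul_div_cancel_left₀ _ hy, mul_div_cancel_left₀ _ hy]
  simp [Complex.mul_re, Complex.mul_im]
  ring

end Local

/-! ### The Kähler condition and the change of charts -/

section Compat

variable {n k : ℕ} {c : ℝ} {φ W : ℝ → ℝ}

/-- The constant `n/k` makes `F' · (k/n) = 1 + (k/n) U`, the required coefficient of the
Fubini-Study metric; then `F'' = φ(U)` gives the vertical part. -/
theorem Profile.exists_potential (h : Profile n k c φ W) :
    ∃ F : ℝ → ℝ, ContDiff ℝ ∞ F ∧ ∀ s, HasDerivAt F (n / k + W (Real.exp (2 * s))) s := by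
  have hc : ContDiff ℝ ∞ (fun s => (n : ℝ) / k + W (Real.exp (2 * s))) :=
    contDiff_const.add h.contDiff_exp
  have hd : ∀ s, HasDerivAt (fun s => ∫ x in (0 : ℝ)..s, ((n : ℝ) / k + W (Real.exp (2 * x))))
      (n / k + W (Real.exp (2 * s))) s := fun s =>
    intervalIntegral.integral_hasDerivAt_right (hc.continuous.intervalIntegrable _ _)
      (hc.continuous.stronglyMeasurableAtFilter _ _) hc.continuous.continuousAt
  refine ⟨_, contDiff_infty_iff_deriv.2 ⟨fun s => (hd s).differentiableAt, ?_⟩, hd⟩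
  rw [funext fun s => (hd s).deriv]
  exact hc

/-- The sign distinguishing the charts around the zero section from those around the infinity
section. -/
def sgn (inf : Bool) : ℝ := bif inf then -1 else 1

theorem sgn_eq (inf : Bool) : sgn inf = 1 ∨ sgn inf = -1 := by cases inf <;> simp [sgn]

theorem abs_sgn_mul (inf : Bool) (k : ℕ) : |sgn inf * k| = k := by cases inf <;> simp [sgn]

theorem dense_coord_ne_zero (i : Fin n) : Dense {y : Fin n → ℂ | y i ≠ 0} :=
  (dense_compl_singleton (0 : ℂ)).preimage (isOpenMap_eval i)

theorem isOpen_coord_ne_zero (i : Fin n) : IsOpen {y : Fin n → ℂ | y i ≠ 0} :=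
  isOpen_ne_fun (continuous_apply i) continuous_const

theorem isKahlerMetric_localMetric (h : Profile n k c φ W) (i : Fin n) (inf : Bool) :
    IsKahlerMetric (localMetric (sgn inf * k) W i) where
  smooth := contDiff_localMetric h _ i
  symm := localForm_comm _ W i
  pos := localMetric_pos h (abs_sgn_mul inf k) i
  kahler := by
    refine ⟨localForm_I _ W i, fun y X Y Z => ?_⟩
    obtain ⟨F, hF, hF'⟩ := h.exists_potential
    set G := localMetric (sgn inf * k) W i with hG
    have hs : ContDiff ℝ ∞ G := contDiff_localMetric h _ i
    have hc : Continuous (fderiv ℝ G) := hs.continuous_fderiv (by simp)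
    have hc' : Continuous fun y => fderiv ℝ G y X (Complex.I • Y) Z +
        fderiv ℝ G y Y (Complex.I • Z) X + fderiv ℝ G y Z (Complex.I • X) Y := by fun_prop
    -- The potential is singular along the section `y_i = 0`, so closedness is proved off it and
    -- extended by continuity of the derivatives of `G`.
    refine congrFun (hc'.ext_on (dense_coord_ne_zero i) (continuous_const (y := (0 : ℝ))) ?_) y
    intro y hy
    have hf : ContDiffAt ℝ ∞ (fun y => F (sgn inf * logRad (sgn inf * k) i y)) y :=
      hF.contDiffAt.comp y (contDiffAt_const.mul (contDiffAt_logRad _ hy))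
    refine fderiv_cyclic_of_eq_levi hf (hs.differentiable (by simp) y) ?_ X Y Z
    filter_upwards [(isOpen_coord_ne_zero i).mem_nhds hy] with y' hy' X Y
    exact localForm_eq_levi h hF hF' (sgn_eq inf) i hy' X Y

theorem log_fibreNorm_param (k : ℕ) (i : Fin n) (inf : Bool) {y : Fin n → ℂ} (hy : y i ≠ 0) :
    Real.log (fibreNorm (param n k i inf y)) = sgn inf * logRad (sgn inf * k) i y := by
  have hN := sqNorm_update_pos i y
  have h1 : ‖y i‖ ≠ 0 := norm_ne_zero_iff.2 hy
  have h2 : √(sqNorm (Function.update y i (1 : ℂ))) ^ k ≠ 0 := by positivity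
  have e : fibreNorm (param n k i inf y) = ‖(paramCoord n i inf y).a‖ / ‖(paramCoord n i inf y).b‖
    * √(sqNorm (Function.update y i (1 : ℂ))) ^ k := rfl
  rw [e, logRad, sqNorm_fibCLM]
  cases inf
  · simp only [paramCoord, cond_false, norm_one, div_one, sgn]
    rw [Real.log_mul h1 h2, Real.log_pow, Real.log_sqrt hN.le, Real.log_pow]
    push_cast; ring
  · simp only [paramCoord, cond_true, norm_one, sgn]
    rw [Real.log_mul (by positivity) h2, Real.log_pow, Real.log_sqrt hN.le, Real.log_pow, one_div,
      Real.log_inv]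
    push_cast; ring

/-! ### The unitary group in charts. -/

theorem sqNorm_unitary (A : Matrix.unitaryGroup (Fin n) ℂ) (Z : Fin n → ℂ) :
    sqNorm (A.1.mulVec Z) = sqNorm Z := by
  have h : ((sqNorm (A.1.mulVec Z) : ℝ) : ℂ) = (sqNorm Z : ℝ) := by
    rw [ofReal_sqNorm, ofReal_sqNorm, Matrix.star_mulVec, dotProduct_comm,
      Matrix.dotProduct_mulVec, Matrix.vecMul_vecMul, ← Matrix.star_eq_conjTranspose,
      Matrix.mem_unitaryGroup_iff'.1 A.2, Matrix.vecMul_one, dotProduct_comm]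
  exact_mod_cast h

theorem fibreNorm_unitaryAct (A : Matrix.unitaryGroup (Fin n) ℂ) (x : Manifold n k) :
    fibreNorm (unitaryAct A x) = fibreNorm x := by
  induction x using Quotient.inductionOn with
  | h p =>
  change ‖p.a‖ / ‖p.b‖ * √(sqNorm (A.1.mulVec p.Z)) ^ k = ‖p.a‖ / ‖p.b‖ * √(sqNorm p.Z) ^ k
  rw [sqNorm_unitary]

/-- The action of a unitary matrix, expressed in a pair of charts. -/
def actInCharts (k : ℕ) (A : Matrix.unitaryGroup (Fin n) ℂ) (i : Fin n) (inf : Bool) (j : Fin n)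
    (inf' : Bool) (y : Fin n → ℂ) : Fin n → ℂ :=
  chartFun n k j inf' (unitaryAct A (param n k i inf y))

/-- The domain of `actInCharts`. -/
def actDomain (k : ℕ) (A : Matrix.unitaryGroup (Fin n) ℂ) (i : Fin n) (inf : Bool) (j : Fin n)
    (inf' : Bool) : Set (Fin n → ℂ) :=
  {y | unitaryAct A (param n k i inf y) ∈ chartSource n k j inf'}

variable (A : Matrix.unitaryGroup (Fin n) ℂ) (i : Fin n) (inf : Bool) (j : Fin n) (inf' : Bool)

theorem actDomain_eq : actDomain k A i inf j inf' =
    {y | A.1.mulVec (Function.update y i 1) j ≠ 0 ∧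
      (bif inf' then (bif inf then 1 else y i) else (bif inf then y i else 1)) ≠ 0} := rfl

theorem contDiff_mulVec_update (l : Fin n) :
    ContDiff ℂ ω (fun y : Fin n → ℂ => A.1.mulVec (Function.update y i (1 : ℂ)) l) := by
  simp only [Matrix.mulVec, dotProduct]
  exact ContDiff.sum fun m _ => contDiff_const.mul (contDiff_update_one n i m)

theorem isOpen_actDomain : IsOpen (actDomain k A i inf j inf') := by
  rw [actDomain_eq]
  refine (isOpen_ne_fun (contDiff_mulVec_update A i j).continuous continuous_const).inter
    (isOpen_ne_fun ?_ continuous_const)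
  cases inf <;> cases inf' <;> simp <;> fun_prop

theorem actInCharts_apply (y : Fin n → ℂ) : actInCharts k A i inf j inf' y =
    Function.update (fun l => A.1.mulVec (Function.update y i 1) l /
      A.1.mulVec (Function.update y i 1) j) j
      (fibreCoord k j inf' (unitaryCoord A (paramCoord n i inf y))) := rfl

theorem contDiffOn_actInCharts :
    ContDiffOn ℂ ω (actInCharts k A i inf j inf') (actDomain k A i inf j inf') := by
  rw [actDomain_eq]
  have hu := contDiff_mulVec_update A i
  have hy : ContDiff ℂ ω (fun y : Fin n → ℂ => y i) := contDiff_apply ℂ ℂ i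
  have hk := (hu j).pow k
  refine contDiffOn_pi.2 fun l => ?_
  by_cases h : l = j
  · subst h
    simp only [actInCharts_apply, Function.update_self, fibreCoord, paramCoord, unitaryCoord]
    cases inf <;> cases inf' <;> simp only [cond_true, cond_false]
    · simpa using (hy.mul hk).contDiffOn
    · refine contDiffOn_const.div (hy.mul hk).contDiffOn fun y hy' => ?_
      exact mul_ne_zero hy'.2 (pow_ne_zero _ hy'.1)
    · refine (contDiff_const.mul hk).contDiffOn.div hy.contDiffOn fun y hy' => hy'.2
    · refine hy.contDiffOn.div (contDiff_const.mul hk).contDiffOn fun y hy' => ?_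
      exact mul_ne_zero one_ne_zero (pow_ne_zero _ hy'.1)
  · simp only [actInCharts_apply, ne_eq, h, not_false_eq_true, Function.update_of_ne]
    exact (hu l).contDiffOn.div (hu j).contDiffOn fun y hy' => hy'.1

variable {A i inf j inf'}

theorem actInCharts_coord_ne_zero {y : Fin n → ℂ} (hy : y ∈ actDomain k A i inf j inf')
    (hyi : y i ≠ 0) : actInCharts k A i inf j inf' y j ≠ 0 := by
  rw [actDomain_eq] at hy
  rw [actInCharts_apply, Function.update_self]
  have h1 : (A.1.mulVec (Function.update y i 1)) j ^ k ≠ 0 := pow_ne_zero _ hy.1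
  cases inf <;> cases inf' <;>
    simp only [fibreCoord, paramCoord, unitaryCoord, cond_true, cond_false] <;>
    simp only [ne_eq, div_eq_zero_iff, mul_eq_zero, one_ne_zero, hyi, h1, or_self,
      not_false_eq_true]

theorem logRad_actInCharts {y : Fin n → ℂ} (hy : y ∈ actDomain k A i inf j inf')
    (hyi : y i ≠ 0) :
    sgn inf' * logRad (sgn inf' * k) j (actInCharts k A i inf j inf' y) =
      sgn inf * logRad (sgn inf * k) i y := by
  rw [← log_fibreNorm_param k i inf hyi,
    ← log_fibreNorm_param k j inf' (actInCharts_coord_ne_zero hy hyi), actInCharts,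
    param_chartFun n k j inf' _ hy, fibreNorm_unitaryAct]

/-- Where `y_i ≠ 0`, both sides are Levi forms of the same function of the fibre norm, which `A`
preserves; elsewhere they agree by density and continuity. This gives `U(n)`-invariance, and for `A
= 1` it is the transformation law under a change of charts. -/
theorem localMetric_actInCharts (h : Profile n k c φ W) {y : Fin n → ℂ}
    (hy : y ∈ actDomain k A i inf j inf') (X Y : Fin n → ℂ) :
    localMetric (sgn inf' * k) W j (actInCharts k A i inf j inf' y)
      (fderiv ℝ (actInCharts k A i inf j inf') y X) (fderiv ℝ (actInCharts k A i inf j inf') y Y) =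
      localMetric (sgn inf * k) W i y X Y := by
  set T := actInCharts k A i inf j inf' with hT
  set O := actDomain k A i inf j inf' with hO
  have hOo : IsOpen O := isOpen_actDomain A i inf j inf'
  have hTs : ContDiffOn ℂ ω T O := contDiffOn_actInCharts A i inf j inf'
  have hTr : ContDiffOn ℝ ω T O := hTs.restrict_scalars ℝ
  have hdT : ContinuousOn (fderiv ℝ T) O := hTr.continuousOn_fderiv_of_isOpen hOo (by simp)
  have hG := (contDiff_localMetric h (sgn inf' * k) j).continuous
  have hG' := (contDiff_localMetric h (sgn inf * k) i).continuous
  have hl : ContinuousOn (fun y => localMetric (sgn inf' * k) W j (T y) (fderiv ℝ T y X)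
      (fderiv ℝ T y Y)) O := by
    have h1 : ContinuousOn (fun y => localMetric (sgn inf' * k) W j (T y)) O :=
      hG.comp_continuousOn hTs.continuousOn
    exact (h1.clm_apply (hdT.clm_apply continuousOn_const)).clm_apply
      (hdT.clm_apply continuousOn_const)
  have hr : ContinuousOn (fun y => localMetric (sgn inf * k) W i y X Y) O :=
    Continuous.continuousOn (by fun_prop)
  refine Set.EqOn.of_subset_closure (s := O ∩ {y | y i ≠ 0}) ?_ hl hr Set.inter_subset_left
    ((dense_coord_ne_zero i).open_subset_closure_inter hOo) hy
  rintro y ⟨hyO, hyi⟩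
  obtain ⟨F, hF, hF'⟩ := h.exists_potential
  have le : (2 : ℕ∞ω) ≤ ∞ := ENat.LEInfty.out
  have hj := actInCharts_coord_ne_zero hyO hyi
  have hf : ContDiffAt ℝ 2 (fun y => F (sgn inf' * logRad (sgn inf' * k) j y)) (T y) :=
    (hF.contDiffAt.comp (T y) (contDiffAt_const.mul (contDiffAt_logRad _ hj))).of_le le
  have hTy : ContDiffAt ℂ 2 T y := (hTs.contDiffAt (hOo.mem_nhds hyO)).of_le le_top
  simp only [localMetric_apply]
  rw [localForm_eq_levi h hF hF' (sgn_eq inf') j hj, localForm_eq_levi h hF hF' (sgn_eq inf) i hyi,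
    ← levi_comp_holomorphic hTy hf]
  refine levi_congr ?_ X Y
  filter_upwards [hOo.mem_nhds hyO, (isOpen_coord_ne_zero i).mem_nhds hyi] with y' h1 h2
  rw [hT, logRad_actInCharts h1 h2]

end Compat

/-! ### The metric on the manifold -/

section Global

variable {n k : ℕ} {c : ℝ} {φ W : ℝ → ℝ}

/-- The index of the preferred chart at a point. -/
def idx (x : Manifold n k) : Fin n × Bool := (exists_mem_chartSource n k x).choose

theorem idx_mem (x : Manifold n k) : x ∈ chartSource n k (idx x).1 (idx x).2 :=
  (exists_mem_chartSource n k x).choose_spec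

theorem unitaryAct_one (x : Manifold n k) : unitaryAct 1 x = x := by
  induction x using Quotient.inductionOn with
  | h p =>
  refine congrArg (mk k) ?_
  change Coord.mk _ _ _ _ _ = Coord.mk _ _ _ _ _
  simp

theorem isVonNBounded_of_pos (B : (Fin n → ℂ) →L[ℝ] (Fin n → ℂ) →L[ℝ] ℝ)
    (hB : ∀ X, X ≠ 0 → 0 < B X X) : Bornology.IsVonNBounded ℝ {X | B X X < 1} := by
  have hc : ContinuousOn (fun X => B X X) (Metric.sphere (0 : Fin n → ℂ) 1) := by fun_prop
  obtain ⟨m, hm, hmB⟩ := (isCompact_sphere (0 : Fin n → ℂ) 1).exists_forall_le' hc (a := 0)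
    fun X hX => hB X (by rintro rfl; simp at hX)
  rw [NormedSpace.isVonNBounded_iff']
  refine ⟨1 + 1 / m, fun X hX => ?_⟩
  by_cases h0 : X = 0
  · subst h0; simp; positivity
  have hX0 : 0 < ‖X‖ := norm_pos_iff.2 h0
  have h1 := hmB (‖X‖⁻¹ • X) (by simp [norm_smul, hX0.ne'])
  simp only [map_smul, smul_apply, smul_eq_mul] at h1
  have h2 : B X X < 1 := hX
  have h3 : m * ‖X‖ ^ 2 ≤ 1 := by
    have : m * ‖X‖ ^ 2 ≤ B X X := by
      have := mul_le_mul_of_nonneg_right h1 (sq_nonneg ‖X‖)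
      field_simp at this
      linarith
    linarith
  have h4 : ‖X‖ ^ 2 ≤ 1 / m := by rw [le_div_iff₀ hm]; linarith
  -- From `2 ‖X‖ ≤ 1 + ‖X‖²` one gets the radius `1 + 1/m` without square roots.
  nlinarith [sq_nonneg (‖X‖ - 1)]

/-- The metric in the preferred charts. -/
def metricInner (W : ℝ → ℝ) (x : Manifold n k) : (Fin n → ℂ) →L[ℝ] (Fin n → ℂ) →L[ℝ] ℝ :=
  localMetric (sgn (idx x).2 * k) W (idx x).1 (chartFun n k (idx x).1 (idx x).2 x)

theorem metricInner_unitaryAct (h : Profile n k c φ W) (A : Matrix.unitaryGroup (Fin n) ℂ)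
    {i : Fin n} {inf : Bool} {x : Manifold n k} (hx : x ∈ chartSource n k i inf)
    (X Y : Fin n → ℂ) :
    metricInner W (unitaryAct A x)
      (fderiv ℝ (actInCharts k A i inf (idx (unitaryAct A x)).1 (idx (unitaryAct A x)).2)
        (chartFun n k i inf x) X)
      (fderiv ℝ (actInCharts k A i inf (idx (unitaryAct A x)).1 (idx (unitaryAct A x)).2)
        (chartFun n k i inf x) Y) =
      localMetric (sgn inf * k) W i (chartFun n k i inf x) X Y := by
  have hp := param_chartFun n k i inf x hx
  have hy : chartFun n k i inf x ∈ actDomain k A i inf (idx (unitaryAct A x)).1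
      (idx (unitaryAct A x)).2 := by
    rw [actDomain, Set.mem_ofPred_eq, hp]
    exact idx_mem _
  rw [← localMetric_actInCharts h hy]
  unfold metricInner
  rw [actInCharts, hp]

/-- The case `A = 1` of `metricInner_unitaryAct`: the definition by preferred charts, which jump
from point to point, agrees with the local expression in every chart. -/
theorem metricInner_fderiv (h : Profile n k c φ W) {i : Fin n} {inf : Bool} {x : Manifold n k}
    (hx : x ∈ chartSource n k i inf) (X Y : Fin n → ℂ) :
    metricInner W x
      (fderiv ℝ (fun y => chartFun n k (idx x).1 (idx x).2 (param n k i inf y))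
        (chartFun n k i inf x) X)
      (fderiv ℝ (fun y => chartFun n k (idx x).1 (idx x).2 (param n k i inf y))
        (chartFun n k i inf x) Y) =
      localMetric (sgn inf * k) W i (chartFun n k i inf x) X Y := by
  have := metricInner_unitaryAct h 1 hx X Y
  unfold actInCharts at this
  simpa only [unitaryAct_one] using this

theorem metricInner_pos (h : Profile n k c φ W) (x : Manifold n k) (X : Fin n → ℂ) (hX : X ≠ 0) :
    0 < metricInner W x X X :=
  localMetric_pos h (abs_sgn_mul _ k) _ _ X hX

theorem coordChange_eq (x₀ x : Manifold n k) :
    (tangentBundleCore 𝓘(ℝ, Fin n → ℂ) (Manifold n k)).coordChange (achart (Fin n → ℂ) x₀)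
      (achart (Fin n → ℂ) x) x =
    fderiv ℝ (fun y => chartFun n k (idx x).1 (idx x).2 (param n k (idx x₀).1 (idx x₀).2 y))
      (chartFun n k (idx x₀).1 (idx x₀).2 x) := by
  rw [tangentBundleCore_coordChange_achart, modelWithCornersSelf_coe, Set.range_id,
    fderivWithin_univ]
  rfl

/-- The metric as a bilinear form on the tangent spaces. -/
def tangentInner (W : ℝ → ℝ) (x : Manifold n k) : TangentSpace 𝓘(ℝ, Fin n → ℂ) x →L[ℝ]
    TangentSpace 𝓘(ℝ, Fin n → ℂ) x →L[ℝ] ℝ :=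
  metricInner W x

/-- The preferred chart is not continuous in the point. In the trivialization at `x₀`, however, the
metric is its expression in the fixed chart at `x₀`, which is smooth. -/
theorem contMDiff_tangentInner (h : Profile n k c φ W) :
    ContMDiff 𝓘(ℝ, Fin n → ℂ)
      (𝓘(ℝ, Fin n → ℂ).prod 𝓘(ℝ, (Fin n → ℂ) →L[ℝ] (Fin n → ℂ) →L[ℝ] ℝ)) ∞
      (fun x : Manifold n k => Bundle.TotalSpace.mk' ((Fin n → ℂ) →L[ℝ] (Fin n → ℂ) →L[ℝ] ℝ)
        (E := fun x : Manifold n k => TangentSpace 𝓘(ℝ, Fin n → ℂ) x →L[ℝ]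
          TangentSpace 𝓘(ℝ, Fin n → ℂ) x →L[ℝ] ℝ) x (tangentInner W x)) := by
  intro x₀
  refine (Bundle.contMDiffAt_section x₀).2 ?_
  have hs : ContMDiffAt 𝓘(ℝ, Fin n → ℂ) 𝓘(ℝ, (Fin n → ℂ) →L[ℝ] (Fin n → ℂ) →L[ℝ] ℝ) ∞
      (fun x => localMetric (sgn (idx x₀).2 * k) W (idx x₀).1
        (chartFun n k (idx x₀).1 (idx x₀).2 x)) x₀ := by
    have h1 := contMDiffAt_extChartAt (I := 𝓘(ℝ, Fin n → ℂ)) (n := ∞) (x := x₀)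
    have h2 := (contDiff_localMetric h (sgn (idx x₀).2 * k) (idx x₀).1).contMDiff
    exact h2.contMDiffAt.comp x₀ h1
  refine hs.congr_of_eventuallyEq ?_
  have hopen : (chartAt (Fin n → ℂ) x₀).source ∈ 𝓝 x₀ :=
    (chartAt (Fin n → ℂ) x₀).open_source.mem_nhds (mem_chart_source _ x₀)
  filter_upwards [hopen] with x hx
  ext X Y
  rw [hom_trivializationAt_apply]
  have hb : x ∈ (trivializationAt (Fin n → ℂ)
      (TangentSpace 𝓘(ℝ, Fin n → ℂ) : Manifold n k → Type _) x₀).baseSet := hx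
  rw [inCoordinates_apply_eq₂ hb hb (Set.mem_univ _)]
  have hsym : ∀ V : Fin n → ℂ, (trivializationAt (Fin n → ℂ)
      (TangentSpace 𝓘(ℝ, Fin n → ℂ) : Manifold n k → Type _) x₀).symm x V =
      fderiv ℝ (fun y => chartFun n k (idx x).1 (idx x).2 (param n k (idx x₀).1 (idx x₀).2 y))
        (chartFun n k (idx x₀).1 (idx x₀).2 x) V := by
    intro V
    rw [← coordChange_eq]
    exact (Bundle.Trivialization.symmL_apply (R := ℝ) _ hb V).symm.trans
      (congrArg (fun l : (Fin n → ℂ) →L[ℝ] (Fin n → ℂ) => l V)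
      (TangentBundle.symmL_trivializationAt_eq_core (I := 𝓘(ℝ, Fin n → ℂ)) hx))
  rw [hsym, hsym]
  refine Eq.trans ?_ (metricInner_fderiv h (i := (idx x₀).1) (inf := (idx x₀).2) hx X Y)
  simp
  rfl

/-- The metric on `M_{n,k}` with a given profile. -/
def Profile.metric (h : Profile n k c φ W) : Metric n k where
  inner x := tangentInner W x
  symm _ := localForm_comm _ W _ _
  pos x := metricInner_pos h x
  isVonNBounded x := isVonNBounded_of_pos _ (metricInner_pos h x)
  contMDiff := contMDiff_tangentInner h

theorem Profile.inChart_metric (h : Profile n k c φ W) (i : Fin n) (inf : Bool) :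
    h.metric.inChart i inf = localMetric (sgn inf * k) W i := by
  funext y
  have hd : MDifferentiableAt 𝓘(ℝ, Fin n → ℂ) 𝓘(ℝ, Fin n → ℂ) (chart n k i inf).symm y :=
    mdifferentiableAt_atlas_symm (e := chart n k i inf)
      (show chart n k i inf ∈ Set.range fun c : Fin n × Bool => chart n k c.1 c.2 from
        ⟨(i, inf), rfl⟩) (Set.mem_univ y)
  have hm : mfderiv 𝓘(ℝ, Fin n → ℂ) 𝓘(ℝ, Fin n → ℂ) (chart n k i inf).symm y =
      fderiv ℝ (fun y' => chartFun n k (idx (param n k i inf y)).1 (idx (param n k i inf y)).2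
        (param n k i inf y')) y := by
    rw [hd.mfderiv, modelWithCornersSelf_coe, Set.range_id, fderivWithin_univ]
    rfl
  ext X Y
  have := metricInner_fderiv h (param_mem n k i inf y) X Y
  rw [chartFun_param] at this
  rw [← this, ← hm]
  rfl

theorem Profile.isKahler_metric (h : Profile n k c φ W) : h.metric.IsKahler := fun i inf => by
  rw [h.inChart_metric]
  exact (isKahlerMetric_localMetric h i inf).kahler

theorem continuousAt_unitaryAct (A : Matrix.unitaryGroup (Fin n) ℂ) (x : Manifold n k) :
    ContinuousAt (unitaryAct A) x := by
  set e := chart n k (idx x).1 (idx x).2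
  set e' := chart n k (idx (unitaryAct A x)).1 (idx (unitaryAct A x)).2
  have hx : x ∈ e.source := idx_mem x
  set T := actInCharts k A (idx x).1 (idx x).2 (idx (unitaryAct A x)).1 (idx (unitaryAct A x)).2
  set O := actDomain k A (idx x).1 (idx x).2 (idx (unitaryAct A x)).1 (idx (unitaryAct A x)).2
  have hO : IsOpen O := isOpen_actDomain A _ _ _ _
  have hp : ∀ x' ∈ e.source, param n k (idx x).1 (idx x).2 (e x') = x' :=
    fun x' hx' => param_chartFun n k _ _ x' hx'
  have hxO : e x ∈ O := by
    change unitaryAct A (param n k (idx x).1 (idx x).2 (e x)) ∈ chartSource n k _ _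
    rw [hp x hx]; exact idx_mem _
  have hec : ContinuousAt e x := e.continuousAt hx
  have hT : ContinuousAt T (e x) :=
    (contDiffOn_actInCharts A _ _ _ _).continuousOn.continuousAt (hO.mem_nhds hxO)
  have hs : ContinuousAt e'.symm (T (e x)) := e'.symm.continuousAt (Set.mem_univ _)
  have hcomp : ContinuousAt (fun x' => e'.symm (T (e x'))) x :=
    hs.comp (f := fun x' => T (e x')) (hT.comp hec)
  refine hcomp.congr ?_
  filter_upwards [e.open_source.mem_nhds hx, hec.preimage_mem_nhds (hO.mem_nhds hxO)]
    with x' hx' hx'O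
  have hx2 : unitaryAct A (param n k (idx x).1 (idx x).2 (e x')) ∈
      chartSource n k (idx (unitaryAct A x)).1 (idx (unitaryAct A x)).2 := hx'O
  have h3 := param_chartFun n k _ _ _ hx2
  rw [hp x' hx'] at h3
  change param n k _ _ (chartFun n k _ _ (unitaryAct A (param n k _ _ (e x')))) = _
  rw [hp x' hx', h3]

theorem mfderiv_unitaryAct (A : Matrix.unitaryGroup (Fin n) ℂ) (x : Manifold n k) :
    mfderiv 𝓘(ℝ, Fin n → ℂ) 𝓘(ℝ, Fin n → ℂ) (unitaryAct A) x =
      fderiv ℝ (actInCharts k A (idx x).1 (idx x).2 (idx (unitaryAct A x)).1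
        (idx (unitaryAct A x)).2) (chartFun n k (idx x).1 (idx x).2 x) := by
  have hO : IsOpen (actDomain k A (idx x).1 (idx x).2 (idx (unitaryAct A x)).1
    (idx (unitaryAct A x)).2) := isOpen_actDomain A _ _ _ _
  have hxO : chartFun n k (idx x).1 (idx x).2 x ∈ actDomain k A (idx x).1 (idx x).2
      (idx (unitaryAct A x)).1 (idx (unitaryAct A x)).2 := by
    rw [actDomain, Set.mem_ofPred_eq]
    rw [param_chartFun n k _ _ x (idx_mem x)]; exact idx_mem _
  have hT := ((contDiffOn_actInCharts (k := k) A (idx x).1 (idx x).2 (idx (unitaryAct A x)).1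
    (idx (unitaryAct A x)).2).contDiffAt (hO.mem_nhds hxO)).restrict_scalars ℝ
  have hd : MDifferentiableAt 𝓘(ℝ, Fin n → ℂ) 𝓘(ℝ, Fin n → ℂ) (unitaryAct A) x :=
    (mdifferentiableAt_iff _ _).2 ⟨continuousAt_unitaryAct A x,
      (hT.differentiableAt (by simp)).differentiableWithinAt⟩
  rw [hd.mfderiv, modelWithCornersSelf_coe, Set.range_id, fderivWithin_univ]
  rfl

theorem Profile.isUnitaryInvariant_metric (h : Profile n k c φ W) :
    h.metric.IsUnitaryInvariant := by
  intro A x X Y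
  rw [mfderiv_unitaryAct]
  exact metricInner_unitaryAct h A (idx_mem x) X Y

end Global

/-! ### The generating function -/

section Generated

variable {n k : ℕ} {c : ℝ} {φ W : ℝ → ℝ}

theorem Profile.phi_pos (h : Profile n k c φ W) {r : ℝ} (hr : 0 < r) : 0 < φ (W r) := by
  rw [← h.ode r hr.le]
  have := h.deriv_pos r hr.le
  positivity

theorem Profile.one (h : Profile n k c φ W) : W 1 = 0 := by
  have := h.odd 1 one_pos
  rw [inv_one] at this
  linarith

theorem Profile.exp_sgn_logRad (h : Profile n k c φ W) (inf : Bool) (κ : ℝ) {i : Fin n}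
    {y : Fin n → ℂ} (hy : y i ≠ 0) :
    W (Real.exp (2 * (sgn inf * logRad κ i y))) = sgn inf * W (rad κ i y) := by
  have hr : 0 < rad κ i y := by rw [← exp_logRad κ i hy]; exact Real.exp_pos _
  cases inf
  · simp only [sgn, cond_false, one_mul]
    rw [exp_logRad κ i hy]
  · simp only [sgn, cond_true]
    rw [show 2 * (-1 * logRad κ i y) = -(2 * logRad κ i y) by ring, Real.exp_neg,
        exp_logRad κ i hy, h.odd _ hr]
    ring

/-- Here `U(s) = W(e^{2s})`, and `t` is the primitive of `√φ(U)` vanishing at `s = 0`, where also `U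
= W(1) = 0` by oddness. The form `dt² + (dt ∘ J)²` is `φ(U)` times the squared modulus of the
`(1,0)`-form `theta / y_i`, whose real part is `ds` up to sign. -/
theorem Profile.isGeneratedBy_metric (h : Profile n k c φ W) :
    h.metric.IsGeneratedBy (-c) c φ := by
  set U : ℝ → ℝ := fun s => W (Real.exp (2 * s)) with hU
  have hUd : ∀ s, HasDerivAt U (φ (U s)) s := h.hasDerivAt_exp
  have hpos : ∀ s, 0 < φ (U s) := fun s => h.phi_pos (Real.exp_pos _)
  have hc : Continuous fun s => √(φ (U s)) :=
    (h.phi_smooth.continuous.comp h.contDiff_exp.continuous).sqrt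
  set t : ℝ → ℝ := fun s => ∫ x in (0 : ℝ)..s, √(φ (U x)) with ht
  have htd : ∀ s, HasDerivAt t (√(φ (U s))) s := fun s =>
    intervalIntegral.integral_hasDerivAt_right (hc.intervalIntegrable _ _)
      (hc.stronglyMeasurableAtFilter _ _) hc.continuousAt
  have htm : StrictMono t := strictMono_of_deriv_pos fun s => by
    rw [(htd s).deriv]; exact Real.sqrt_pos.2 (hpos s)
  have hUm : StrictMono U := strictMono_of_deriv_pos fun s => by
    rw [(hUd s).deriv]; exact hpos s
  have ht0 : t 0 = 0 := by simp [ht]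
  have hU0 : U 0 = 0 := by simp [hU, h.one]
  refine ⟨t, U, htd, hUd, ?_, ?_, ?_⟩
  · rw [← h.image]
    ext x
    constructor
    · rintro ⟨s, rfl⟩
      exact ⟨_, Real.exp_pos _, rfl⟩
    · rintro ⟨r, hr, rfl⟩
      refine ⟨Real.log r / 2, ?_⟩
      simp only [hU]
      rw [mul_div_cancel₀ _ two_ne_zero, Real.exp_log hr]
  · intro s
    constructor
    · intro hs
      rw [htm.injective (hs.trans ht0.symm), hU0]
    · intro hs
      rw [hUm.injective (hs.trans hU0.symm), ht0]
  · intro i inf y hy X Y s dt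
    have hs : s =ᶠ[𝓝 y] fun y' => sgn inf * logRad (sgn inf * k) i y' := by
      filter_upwards [(isOpen_coord_ne_zero i).mem_nhds hy] with y' hy'
      exact log_fibreNorm_param k i inf hy'
    have hr : 0 < rad (sgn inf * k) i y := by rw [← exp_logRad _ i hy]; exact Real.exp_pos _
    have hUs : U (s y) = sgn inf * W (rad (sgn inf * k) i y) := by
      rw [hs.eq_of_nhds]; exact h.exp_sgn_logRad inf _ hy
    have hφ : φ (U (s y)) = φ (W (rad (sgn inf * k) i y)) := by
      rw [hUs]
      rcases sgn_eq inf with e | e <;> rw [e]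
      · rw [one_mul]
      · rw [neg_one_mul, h.phi_even]
    have hdt : ∀ X, dt X = √(φ (U (s y))) * (sgn inf * (theta (sgn inf * k) i y X / y i).re) := by
      intro X
      have h1 : HasFDerivAt s (sgn inf • fderiv ℝ (logRad (sgn inf * k) i) y) y :=
        HasFDerivAt.congr_of_eventuallyEq ((((contDiffAt_logRad (sgn inf * k) hy).differentiableAt
          (by simp)).hasFDerivAt).const_mul (sgn inf)) hs
      have h2 : dt = _ := ((htd (s y)).comp_hasFDerivAt y h1).fderiv
      rw [h2]
      simp only [smul_apply, smul_eq_mul, fderiv_logRad hy]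
    have hsq : √(φ (U (s y))) * √(φ (U (s y))) = φ (U (s y)) := Real.mul_self_sqrt (hpos _).le
    have hsgn : sgn inf * sgn inf = 1 := by cases inf <;> simp [sgn]
    rw [h.inChart_metric, localMetric_apply, localForm, hUs, add_assoc]
    congr 1
    · ring
    · have e2 : ∀ X, ∃ a, theta (sgn inf * k) i y X = y i * a :=
        fun X => ⟨theta (sgn inf * k) i y X / y i, by field_simp⟩
      obtain ⟨a, ha⟩ := e2 X
      obtain ⟨b, hb⟩ := e2 Y
      rw [hdt, hdt, hdt, hdt, theta_I, theta_I, ha, hb, mul_left_comm Complex.I,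
        mul_left_comm Complex.I, mul_div_cancel_left₀ _ hy, mul_div_cancel_left₀ _ hy,
        mul_div_cancel_left₀ _ hy, mul_div_cancel_left₀ _ hy]
      have e3 : ∀ p q p' q' : ℝ, √(φ (U (s y))) * (sgn inf * p) * (√(φ (U (s y))) * (sgn inf * q)) +
          √(φ (U (s y))) * (sgn inf * p') * (√(φ (U (s y))) * (sgn inf * q')) = φ (U (s y)) *
          (p * q + p' * q') := by
        intro p q p' q'
        linear_combination (sgn inf) ^ 2 * (p * q + p' * q') * hsq +
          φ (U (s y)) * (p * q + p' * q') * hsgn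
      rw [e3, hφ, ← h.ode _ hr.le, rad, ← Complex.normSq_eq_norm_sq, Complex.normSq_apply]
      simp [Complex.mul_re, Complex.mul_im]
      ring

end Generated

/-! ### Holomorphic discs -/

section Disc

variable {n : ℕ}

/-- The metric along the disc `Z + (q / (1 - q τ)) X'` with fibre coordinate
`h (1 - q τ)^κ`, where `τ = ⟨X', Z⟩ / |Z|²`; here `q'` and `h'` stand for the derivatives. -/
theorem localForm_disc (κ : ℝ) (W : ℝ → ℝ) (i : Fin n) (Z X : Fin n → ℂ) (hZ : Z i = 1)
    (hX : X i = 0) (τ q q' h h' u : ℂ) (hτ : τ = X ⬝ᵥ star Z / sqNorm Z) (hu : u = 1 - q * τ)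
    (hu0 : u ≠ 0) (ν N D : ℝ) (hν : ν = sqNorm (orthPart Z X) / sqNorm Z) (hN : N = sqNorm Z)
    (hD : D = 1 + ν * ‖q‖ ^ 2) (Y V : Fin n → ℂ)
    (hY : Y = Function.update (Z + (q / u) • X) i (h * Complex.exp (κ * Complex.log u)))
    (hV : V = Function.update ((q' / u ^ 2) • X) i
      ((h' - h * κ * τ * q' / u) * Complex.exp (κ * Complex.log u))) :
    localForm κ W i Y V V =
      2 * ν * (n + κ * W (‖h‖ ^ 2 * Real.exp (κ * Real.log (N * D)))) * ‖q'‖ ^ 2 / D ^ 2 +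
      2 * deriv W (‖h‖ ^ 2 * Real.exp (κ * Real.log (N * D))) *
        Real.exp (κ * Real.log (N * D)) *
        ‖h' + κ * h * q' * ν * (starRingEnd ℂ) q / D‖ ^ 2 := by
  have hn : (n : ℝ) ≠ 0 := by exact_mod_cast (Fin.pos i).ne'
  have hZ0 : Z ≠ 0 := fun h0 => by simp [h0] at hZ
  have hNpos : 0 < N := hN ▸ sqNorm_pos hZ0
  have hν0 : 0 ≤ ν := by rw [hν]; exact div_nonneg (sqNorm_nonneg _) (sqNorm_nonneg _)
  have hDpos : 0 < D := by rw [hD]; positivity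
  have hupos : 0 < ‖u‖ := norm_pos_iff.2 hu0
  have hNc : (N : ℂ) ≠ 0 := by exact_mod_cast hNpos.ne'
  have hDc : (D : ℂ) ≠ 0 := by exact_mod_cast hDpos.ne'
  have hub : (starRingEnd ℂ) u ≠ 0 := by simpa using hu0
  have hub' : (starRingEnd ℂ) u = 1 - (starRingEnd ℂ) q * (starRingEnd ℂ) τ := by rw [hu]; simp
  have hD' : (D : ℂ) = 1 + ν * (q * (starRingEnd ℂ) q) := by
    rw [hD, Complex.mul_conj']; push_cast; ring
  rw [← hN] at hτ hν
  have ea : X ⬝ᵥ star Z = τ * N := by rw [hτ]; field_simp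
  have eb : Z ⬝ᵥ star X = (starRingEnd ℂ) τ * N := by
    rw [← conj_dotProduct_star, ea]; simp
  have es : X ⬝ᵥ star X = N * (ν + τ * (starRingEnd ℂ) τ) := by
    have := sqNorm_orthPart hZ0 X
    rw [← hN, ea, eb] at this
    have h2 : (sqNorm (orthPart Z X) : ℂ) = ν * N := by
      rw [hν]; push_cast; field_simp
    rw [h2] at this
    field_simp at this
    linear_combination -this
  have ez : Z ⬝ᵥ star Z = N := by rw [← ofReal_sqNorm, hN]
  have hY1 : Function.update Y i 1 = Z + (q / u) • X := by
    rw [hY, Function.update_idem]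
    funext j
    by_cases hj : j = i
    · subst hj; simp [hZ, hX]
    · simp [hj]
  have hV1 : Function.update V i 0 = (q' / u ^ 2) • X := by
    rw [hV, Function.update_idem]
    funext j
    by_cases hj : j = i
    · subst hj; simp [hX]
    · simp [hj]
  -- Up to the scalar `u = 1 - qτ`, the point `Z + (q/u) X` is `Z` plus `q` times the part of `X`
  -- orthogonal to `Z`. Its squared norm is therefore `N (1 + ν |q|²) / |u|²`, and the factor `u^κ`
  -- in the fibre coordinate absorbs this rescaling.
  have en : (sqNorm (Z + (q / u) • X) : ℂ) = N * D / (u * (starRingEnd ℂ) u) := by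
    rw [ofReal_sqNorm]
    simp only [star_add, star_smul, add_dotProduct, dotProduct_add, smul_dotProduct,
      dotProduct_smul, smul_eq_mul, RCLike.star_def, map_div₀, ea, eb, es, ez]
    rw [hD']
    field_simp
    rw [hub', hu]
    ring
  have enr : sqNorm (Z + (q / u) • X) = N * D / ‖u‖ ^ 2 := by
    rw [Complex.mul_conj'] at en
    exact_mod_cast en
  have ex : X ⬝ᵥ star (Z + (q / u) • X) =
      N * (τ + ν * (starRingEnd ℂ) q) / (starRingEnd ℂ) u := by
    simp only [star_add, star_smul, dotProduct_add, dotProduct_smul, smul_eq_mul, RCLike.star_def,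
      map_div₀, ea, es]
    field_simp
    rw [hub']
    ring
  have ex' : (Z + (q / u) • X) ⬝ᵥ star X =
      N * ((starRingEnd ℂ) τ + ν * q) / u := by
    rw [← conj_dotProduct_star, ex]; simp
  have efs : fubiniStudy (Function.update Y i 1) (Function.update V i 0) (Function.update V i 0) =
      2 * n * (ν * ‖q'‖ ^ 2 / D ^ 2) := by
    have : ((q' / u ^ 2) • X ⬝ᵥ star ((q' / u ^ 2) • X) / sqNorm (Z + (q / u) • X) -
        ((q' / u ^ 2) • X ⬝ᵥ star (Z + (q / u) • X)) *
          ((Z + (q / u) • X) ⬝ᵥ star ((q' / u ^ 2) • X)) / sqNorm (Z + (q / u) • X) ^ 2 : ℂ) =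
        ((ν * ‖q'‖ ^ 2 / D ^ 2 : ℝ) : ℂ) := by
      simp only [star_smul, smul_dotProduct, dotProduct_smul, smul_eq_mul, RCLike.star_def,
        map_div₀, map_pow, ex, ex', es, en]
      push_cast
      rw [← Complex.mul_conj']
      field_simp
      rw [hD', hub', hu]
      ring
    rw [hY1, hV1, fubiniStudy, this, Complex.ofReal_re]
  have eexp : ‖Complex.exp (κ * Complex.log u)‖ = Real.exp (κ * Real.log ‖u‖) := by
    rw [Complex.norm_exp, Complex.re_ofReal_mul, Complex.log_re]
  have eprod : Real.exp (κ * Real.log ‖u‖) ^ 2 * Real.exp (κ * Real.log (N * D / ‖u‖ ^ 2)) =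
      Real.exp (κ * Real.log (N * D)) := by
    rw [← Real.exp_nat_mul, ← Real.exp_add, Real.log_div (by positivity) (by positivity),
      Real.log_pow]
    congr 1
    push_cast; ring
  have eYi : Y i = h * Complex.exp (κ * Complex.log u) := by rw [hY, Function.update_self]
  have eVi : V i = (h' - h * κ * τ * q' / u) * Complex.exp (κ * Complex.log u) := by
    rw [hV, Function.update_self]
  have erad : rad κ i Y = ‖h‖ ^ 2 * Real.exp (κ * Real.log (N * D)) := by
    rw [rad, hY1, enr, eYi, norm_mul, eexp, mul_pow, mul_assoc, eprod]
  have eth : theta κ i Y V = Complex.exp (κ * Complex.log u) *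
      (h' + κ * h * q' * ν * (starRingEnd ℂ) q / D) := by
    rw [theta, hY1, hV1, eYi, eVi, smul_dotProduct, ex, en, smul_eq_mul]
    have hD2 := hD'
    field_simp
    rw [hD', hu]
    ring
  rw [localForm, efs, erad, hY1, enr, eth, Complex.mul_conj', ← Complex.ofReal_pow,
    Complex.ofReal_re, norm_mul, eexp, mul_pow]
  rw [← eprod]
  field_simp

end Disc

/-! ### Positivity of the holomorphic sectional curvature -/

section Positivity

variable {n k : ℕ} {c : ℝ} {φ W : ℝ → ℝ}

/-- The squared speed of the disc of `localForm_disc`. -/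
def discSpeed (n : ℕ) (κ : ℝ) (W : ℝ → ℝ) (ν N : ℝ) (q q' h h' : ℂ) : ℝ :=
  2 * ν * (n + κ * W (‖h‖ ^ 2 * Real.exp (κ * Real.log (N * (1 + ν * ‖q‖ ^ 2))))) * ‖q'‖ ^ 2 /
    (1 + ν * ‖q‖ ^ 2) ^ 2 +
  2 * deriv W (‖h‖ ^ 2 * Real.exp (κ * Real.log (N * (1 + ν * ‖q‖ ^ 2)))) *
    Real.exp (κ * Real.log (N * (1 + ν * ‖q‖ ^ 2))) *
    ‖h' + κ * h * q' * ν * (starRingEnd ℂ) q / (1 + ν * ‖q‖ ^ 2 : ℝ)‖ ^ 2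

/-- Reduces positivity to choosing two scalar holomorphic functions: `q` moves the point along a
projective line and `h` moves it in the fibre. The value of `h' 0` is the one for which the disc has
derivative `X` at the origin. -/
theorem holSec_pos_of_discSpeed (hW : Profile n k c φ W) (i : Fin n) (inf : Bool)
    (y X : Fin n → ℂ) (hX : X ≠ 0) {κ : ℝ} (hκ : κ = sgn inf * k) {Z X' : Fin n → ℂ}
    (hZ : Z = Function.update y i 1) (hX' : X' = Function.update X i 0) {q q' h h' : ℂ → ℂ}
    (hq : ∀ z, HasDerivAt q (q' z) z) (hh : ∀ z, HasDerivAt h (h' z) z)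
    (q0 : q 0 = 0) (q1 : q' 0 = 1) (h0 : h 0 = y i)
    (h1 : h' 0 = X i + κ * y i * (X' ⬝ᵥ star Z / sqNorm Z)) {ν N : ℝ}
    (hν : ν = sqNorm (orthPart Z X') / sqNorm Z) (hN : N = sqNorm Z) {a b d a' b' d' : ℝ}
    (j1 : HasJet (fun x => discSpeed n κ W ν N (q x) (q' x) (h x) (h' x)) a b d)
    (j2 : HasJet (fun x => discSpeed n κ W ν N (q (x * Complex.I)) (q' (x * Complex.I))
      (h (x * Complex.I)) (h' (x * Complex.I))) a' b' d') (hneg : d + d' < 0) :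
    0 < holSec (localMetric (sgn inf * k) W i) y X := by
  set τ := X' ⬝ᵥ star Z / sqNorm Z with hτ
  set u : ℂ → ℂ := fun z => 1 - q z * τ with hu
  set γ : ℂ → Fin n → ℂ := fun z => Function.update (Z + (q z / u z) • X') i
    (h z * Complex.exp (κ * Complex.log (u z))) with hγ
  set V : ℂ → Fin n → ℂ := fun z => Function.update ((q' z / u z ^ 2) • X') i
    ((h' z - h z * κ * τ * q' z / u z) * Complex.exp (κ * Complex.log (u z))) with hV
  have hud : ∀ z, HasDerivAt u (-(q' z * τ)) z := fun z => ((hq z).mul_const τ).const_sub 1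
  have hu0 : u 0 = 1 := by simp [hu, q0]
  have hslit : ∀ᶠ z in 𝓝 (0 : ℂ), u z ∈ Complex.slitPlane :=
    (hud 0).continuousAt.eventually (Complex.isOpen_slitPlane.mem_nhds (by simp [hu0]))
  have hγd : ∀ᶠ z in 𝓝 (0 : ℂ), HasDerivAt γ (V z) z := by
    filter_upwards [hslit] with z hz
    have hz0 : u z ≠ 0 := Complex.slitPlane_ne_zero hz
    refine hasDerivAt_pi.2 fun j => ?_
    by_cases hj : j = i
    · subst hj
      simp only [hγ, hV, Function.update_self]
      have he : HasDerivAt (fun z => Complex.exp (κ * Complex.log (u z)))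
          (Complex.exp (κ * Complex.log (u z)) * (κ * (-(q' z * τ) / u z))) z :=
        (((hud z).clog hz).const_mul (κ : ℂ)).cexp
      refine ((hh z).mul he).congr_deriv ?_
      field_simp
      ring
    · simp only [hγ, hV, ne_eq, hj, not_false_eq_true, Function.update_of_ne, Pi.add_apply,
        Pi.smul_apply, smul_eq_mul]
      refine ((((hq z).div (hud z) hz0).mul_const (X' j)).const_add (Z j)).congr_deriv ?_
      simp only [hu]
      ring
  have hγa : AnalyticAt ℂ γ 0 := by
    rw [Complex.analyticAt_iff_eventually_differentiableAt]
    filter_upwards [hγd] with z hz using hz.differentiableAt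
  have hZi : Z i = 1 := by rw [hZ, Function.update_self]
  have hXi : X' i = 0 := by rw [hX', Function.update_self]
  have g0 : γ 0 = y := by
    funext j
    by_cases hj : j = i
    · subst hj; simp [hγ, hu0, h0]
    · simp [hγ, hj, hu0, q0, hZ]
  have g1 : deriv γ 0 = X := by
    rw [hγd.self_of_nhds.deriv]
    funext j
    by_cases hj : j = i
    · subst hj
      simp only [hV, Function.update_self, hu0, h0, h1, q1, Complex.log_one, mul_zero,
        Complex.exp_zero]
      ring
    · simp [hV, hj, hu0, q1, hX']
  rw [← g1] at hX
  have hG := isKahlerMetric_localMetric hW i inf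
  have key := hG.holSec_pos_of_disc hγa
    (e := fun z => discSpeed n κ W ν N (q z) (q' z) (h z) (h' z)) ?_ hX j1 j2 hneg
  · rwa [g0, g1] at key
  · filter_upwards [hslit, hγd] with z hz hz'
    rw [hz'.deriv, localMetric_apply, ← hκ]
    exact (localForm_disc κ W i Z X' hZi hXi τ (q z) (q' z) (h z) (h' z) (u z) hτ rfl
      (Complex.slitPlane_ne_zero hz) ν N _ hν hN rfl _ _ rfl rfl).symm

theorem HasJet.poly (p₀ p₁ p₂ p₃ p₄ : ℝ) :
    HasJet (fun x => p₀ + p₁ * x + p₂ * x ^ 2 + p₃ * x ^ 3 + p₄ * x ^ 4) p₀ p₁ (2 * p₂) := by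
  refine ⟨fun x => p₁ + 2 * p₂ * x + 3 * p₃ * x ^ 2 + 4 * p₄ * x ^ 3, .of_forall fun x => ?_,
    by simp, by simp, ?_⟩
  · refine (((((hasDerivAt_id x).const_mul p₁).const_add p₀).add
      ((hasDerivAt_pow 2 x).const_mul p₂)).add ((hasDerivAt_pow 3 x).const_mul p₃)).add
      ((hasDerivAt_pow 4 x).const_mul p₄) |>.congr_deriv ?_
    norm_num; ring
  · refine ((((hasDerivAt_id (0 : ℝ)).const_mul (2 * p₂)).const_add p₁).add
      ((hasDerivAt_pow 2 (0 : ℝ)).const_mul (3 * p₃))).add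
      ((hasDerivAt_pow 3 (0 : ℝ)).const_mul (4 * p₄)) |>.congr_deriv ?_
    norm_num

theorem HasJet.cast {f : ℝ → ℝ} {a b d a' b' d' : ℝ} (hf : HasJet f a b d) (ha : a = a')
    (hb : b = b') (hd : d = d') : HasJet f a' b' d' := by
  subst ha hb hd; exact hf

theorem HasJet.log {f : ℝ → ℝ} {d : ℝ} (hf : HasJet f 1 0 d) :
    HasJet (fun x => Real.log (f x)) 0 0 d := by
  refine (hf.comp (h := Real.log) (h' := fun x => x⁻¹) (h'' := -1) ?_ ?_).cast
    Real.log_one (by simp) (by simp)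
  · filter_upwards [isOpen_ne.mem_nhds one_ne_zero] with x hx using Real.hasDerivAt_log hx
  · simpa using hasDerivAt_inv (one_ne_zero (α := ℝ))

/-- The negated right-hand side is, up to a factor, the value of the curvature form on a vector
with vertical part of squared norm `P` and horizontal part of squared norm `ν`. -/
theorem curvature_form_neg {φ₀ φ₁ φ₂ κ σ P ν K k : ℝ} (hκ : |κ| = k) (hφ : 0 ≤ φ₀) (hφ₂ : φ₂ < 0)
    (hσ : K ≤ σ) (hK : 0 < K) (hc : 2 * k ^ 2 * φ₁ ^ 2 < -φ₂ * (2 * K - k ^ 2 * φ₀))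
    (hP : 0 ≤ P) (hν : 0 ≤ ν) (hne : P ≠ 0 ∨ ν ≠ 0) :
    φ₂ * P ^ 2 + 8 * κ * (φ₁ - κ * φ₀ / σ) * P * ν - 8 * (2 * σ - κ ^ 2 * φ₀) * ν ^ 2 < 0 := by
  have hσ0 : 0 < σ := hK.trans_le hσ
  have hk2 : κ ^ 2 = k ^ 2 := by rw [← hκ, sq_abs]
  have e1 : 0 ≤ κ ^ 2 * φ₀ / σ * P * ν := by positivity
  have e2 : φ₂ * P ^ 2 + 8 * κ * φ₁ * P * ν - 8 * (2 * K - k ^ 2 * φ₀) * ν ^ 2 < 0 := by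
    have hα : 0 < -φ₂ := by linarith
    -- Completing the square in `P`: after multiplication by `-φ₂`, the form is minus a square minus
    -- a multiple of `ν²`, whose coefficient is positive by `hc`. The mixed term `κ² φ₀ / σ` only
    -- helps and is dropped, and `σ` is replaced by its lower bound `K`.
    have h1 : 0 < (-φ₂ * P - 4 * κ * φ₁ * ν) ^ 2 +
        8 * (-φ₂ * (2 * K - k ^ 2 * φ₀) - 2 * k ^ 2 * φ₁ ^ 2) * ν ^ 2 := by
      by_cases h0 : ν = 0
      · have hP0 : P ≠ 0 := by simpa [h0] using hne
        have : 0 < (-φ₂ * P) ^ 2 := by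
          have := hα.ne'
          positivity
        simpa [h0] using this
      · have h2 : 0 < -φ₂ * (2 * K - k ^ 2 * φ₀) - 2 * k ^ 2 * φ₁ ^ 2 := by linarith
        positivity
    have h3 : -φ₂ * (φ₂ * P ^ 2 + 8 * κ * φ₁ * P * ν - 8 * (2 * K - k ^ 2 * φ₀) * ν ^ 2) =
        -((-φ₂ * P - 4 * κ * φ₁ * ν) ^ 2 +
          8 * (-φ₂ * (2 * K - k ^ 2 * φ₀) - 2 * k ^ 2 * φ₁ ^ 2) * ν ^ 2) := by
      rw [← hk2]; ring
    by_contra hcon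
    have := mul_nonneg hα.le (not_lt.1 hcon)
    linarith
  have e3 : 0 ≤ 16 * (σ - K) * ν ^ 2 := by
    have := sub_nonneg.2 hσ
    positivity
  have e4 : φ₂ * P ^ 2 + 8 * κ * (φ₁ - κ * φ₀ / σ) * P * ν - 8 * (2 * σ - κ ^ 2 * φ₀) * ν ^ 2 =
      (φ₂ * P ^ 2 + 8 * κ * φ₁ * P * ν - 8 * (2 * K - k ^ 2 * φ₀) * ν ^ 2) -
        8 * (κ ^ 2 * φ₀ / σ * P * ν) - 16 * (σ - K) * ν ^ 2 := by
    rw [← hk2]; ring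
  linarith

/-- The speed of the disc along a real line, away from the two sections. -/
def lineSpeed (n : ℕ) (κ : ℝ) (U φ : ℝ → ℝ) (ν s₀ b β x y : ℝ) (t : ℝ) : ℝ :=
  let D : ℝ := 1 + 0 * t + ν * t ^ 2 + (-2 * ν * β * x) * t ^ 3
    + (ν * β ^ 2 * (x ^ 2 + y ^ 2)) * t ^ 4
  let w : ℝ := U ((s₀ + x * t + (-(b * (x ^ 2 - y ^ 2) / 2)) * t ^ 2 + 0 * t ^ 3 + 0 * t ^ 4)
    + κ / 2 * Real.log D)
  2 * ν * (n + κ * w) * (1 + (-4 * β * x) * t + (4 * β ^ 2 * (x ^ 2 + y ^ 2)) * t ^ 2 + 0 * t ^ 3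
    + 0 * t ^ 4) * (D⁻¹ * D⁻¹) +
  φ w * (((x + (-(b * (x ^ 2 - y ^ 2))) * t + 0 * t ^ 2 + 0 * t ^ 3 + 0 * t ^ 4) +
      (0 + κ * ν * t + (-3 * κ * ν * β * x) * t ^ 2 + (2 * κ * ν * β ^ 2 * (x ^ 2 + y ^ 2)) * t ^ 3
        + 0 * t ^ 4) * D⁻¹) *
    ((x + (-(b * (x ^ 2 - y ^ 2))) * t + 0 * t ^ 2 + 0 * t ^ 3 + 0 * t ^ 4) +
      (0 + κ * ν * t + (-3 * κ * ν * β * x) * t ^ 2 + (2 * κ * ν * β ^ 2 * (x ^ 2 + y ^ 2)) * t ^ 3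
        + 0 * t ^ 4) * D⁻¹) +
    ((y + (-2 * b * x * y) * t + 0 * t ^ 2 + 0 * t ^ 3 + 0 * t ^ 4) +
      (0 + 0 * t + (-κ * ν * β * y) * t ^ 2 + 0 * t ^ 3 + 0 * t ^ 4) * D⁻¹) *
    ((y + (-2 * b * x * y) * t + 0 * t ^ 2 + 0 * t ^ 3 + 0 * t ^ 4) +
      (0 + 0 * t + (-κ * ν * β * y) * t ^ 2 + 0 * t ^ 3 + 0 * t ^ 4) * D⁻¹))

theorem hasJet_lineSpeed (n : ℕ) (κ : ℝ) {U φ φ' : ℝ → ℝ} {φ'' : ℝ} (ν s₀ b β x y : ℝ)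
    (hU : ∀ s, HasDerivAt U (φ (U s)) s) (hφ : ∀ x, HasDerivAt φ (φ' x) x)
    (hφ' : HasDerivAt φ' φ'' (U s₀)) : ∃ a₀ a₁, HasJet (lineSpeed n κ U φ ν s₀ b β x y) a₀ a₁
      (2 * ν * (κ * (φ (U s₀) * φ' (U s₀) * x ^ 2 +
          φ (U s₀) * (-b * (x ^ 2 - y ^ 2) + κ * ν)) +
        2 * κ * (φ (U s₀) * x) * (-4 * β * x) +
        (n + κ * U s₀) * (8 * β ^ 2 * (x ^ 2 + y ^ 2) - 4 * ν)) +
      (φ'' * (φ (U s₀) * x) ^ 2 + φ' (U s₀) * (φ (U s₀) * φ' (U s₀) * x ^ 2 +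
        φ (U s₀) * (-b * (x ^ 2 - y ^ 2) + κ * ν))) * (x ^ 2 + y ^ 2) +
      2 * φ' (U s₀) * (φ (U s₀) * x) *
        (2 * x * (-b * (x ^ 2 - y ^ 2) + κ * ν) + 2 * y * (-2 * b * x * y)) +
      φ (U s₀) * (2 * (-b * (x ^ 2 - y ^ 2) + κ * ν) ^ 2 + 2 * x * (-6 * κ * ν * β * x) +
        2 * (2 * b * x * y) ^ 2 + 2 * y * (-2 * κ * ν * β * y))) := by
  -- The vanishing terms written out in `lineSpeed` make each factor syntactically an instance of
  -- `HasJet.poly`.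
  have jD := HasJet.poly 1 0 ν (-2 * ν * β * x) (ν * β ^ 2 * (x ^ 2 + y ^ 2))
  have jDi := jD.inv one_ne_zero
  have jS := (HasJet.poly s₀ x (-(b * (x ^ 2 - y ^ 2) / 2)) 0 0).add (jD.log.const_mul (κ / 2))
  have jS' := jS.cast (a' := s₀) (b' := x) (d' := -b * (x ^ 2 - y ^ 2) + κ * ν)
    (by ring) (by ring) (by ring)
  have jw := jS'.comp (h := U) (h' := fun s => φ (U s)) (h'' := φ' (U s₀) * φ (U s₀))
    (.of_forall hU) ((hφ (U s₀)).comp s₀ (hU s₀))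
  have jφ := jw.comp (h := φ) (.of_forall hφ) hφ'
  have jQ := HasJet.poly 1 (-4 * β * x) (4 * β ^ 2 * (x ^ 2 + y ^ 2)) 0 0
  have jP := (HasJet.poly x (-(b * (x ^ 2 - y ^ 2))) 0 0 0).add
    ((HasJet.poly 0 (κ * ν) (-3 * κ * ν * β * x)
      (2 * κ * ν * β ^ 2 * (x ^ 2 + y ^ 2)) 0).mul jDi)
  have jR := (HasJet.poly y (-2 * b * x * y) 0 0 0).add
    ((HasJet.poly 0 0 (-κ * ν * β * y) 0 0).mul jDi)
  have j := (((((HasJet.const (n : ℝ)).add (jw.const_mul κ)).const_mul (2 * ν)).mul jQ).mul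
    (jDi.mul jDi)).add (jφ.mul ((jP.mul jP).add (jR.mul jR)))
  refine ⟨_, _, HasJet.cast j rfl rfl ?_⟩
  simp only [inv_one, one_pow]
  ring

/-- The disc is `q(z) = z - βa z²` and `h(z) = y₀ exp(az - b a² z² / 2)`, evaluated on the line `z =
tη`. The exponential form makes `log |h|` a polynomial in `t`, and the equation `2 r W' = φ(W)`
eliminates `W'`. -/
theorem discSpeed_eq_lineSpeed (hW : Profile n k c φ W) (κ : ℝ) {ν N : ℝ} (hν : 0 ≤ ν)
    (hN : 0 < N) {y₀ : ℂ} (hy : y₀ ≠ 0) (a : ℂ) (b β : ℝ) {η : ℂ} (hη : ‖η‖ = 1) (t : ℝ) :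
    discSpeed n κ W ν N (t * η + (-(β * a)) * (t * η) ^ 2) (1 + 2 * (-(β * a)) * (t * η))
      (y₀ * Complex.exp (a * (t * η) - b * a ^ 2 / 2 * (t * η) ^ 2))
      (y₀ * Complex.exp (a * (t * η) - b * a ^ 2 / 2 * (t * η) ^ 2) *
        (a - b * a ^ 2 * (t * η))) =
    lineSpeed n κ (fun s => W (Real.exp (2 * s))) φ ν (Real.log ‖y₀‖ + κ / 2 * Real.log N) b β
      (a * η).re (a * η).im t := by
  obtain ⟨x, hx⟩ : ∃ x, x = (a * η).re := ⟨_, rfl⟩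
  obtain ⟨y, hy'⟩ : ∃ y, y = (a * η).im := ⟨_, rfl⟩
  have hξ : a * η = x + y * Complex.I := by rw [hx, hy', Complex.re_add_im]
  rw [← hx, ← hy']
  have hηη : η * (starRingEnd ℂ) η = 1 := by rw [Complex.mul_conj', hη]; norm_num
  set D : ℝ := 1 + 0 * t + ν * t ^ 2 + (-2 * ν * β * x) * t ^ 3
    + (ν * β ^ 2 * (x ^ 2 + y ^ 2)) * t ^ 4 with hD
  set q : ℂ := t * η + (-(β * a)) * (t * η) ^ 2 with hq
  set q' : ℂ := 1 + 2 * (-(β * a)) * (t * η) with hq'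
  set h : ℂ := y₀ * Complex.exp (a * (t * η) - b * a ^ 2 / 2 * (t * η) ^ 2) with hh
  have eq0 : q = t * η * (1 - β * t * (x + y * Complex.I)) := by rw [hq, ← hξ]; ring
  have eq1 : q' = 1 - 2 * β * t * (x + y * Complex.I) := by rw [hq', ← hξ]; ring
  have nq : 1 + ν * ‖q‖ ^ 2 = D := by
    rw [eq0, norm_mul, norm_mul, hη, mul_one, mul_pow, ← Complex.normSq_eq_norm_sq (1 - _),
      Complex.normSq_apply, Complex.norm_real, Real.norm_eq_abs, sq_abs, hD]
    simp
    ring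
  have nq' : ‖q'‖ ^ 2 = 1 + (-4 * β * x) * t + (4 * β ^ 2 * (x ^ 2 + y ^ 2)) * t ^ 2 + 0 * t ^ 3
    + 0 * t ^ 4 := by
    rw [eq1, ← Complex.normSq_eq_norm_sq, Complex.normSq_apply]
    simp
    ring
  have hDpos : 0 < D := by rw [← nq]; positivity
  have hDc : (D : ℂ) ≠ 0 := by exact_mod_cast hDpos.ne'
  set S : ℝ := (Real.log ‖y₀‖ + κ / 2 * Real.log N + x * t + (-(b * (x ^ 2 - y ^ 2) / 2)) * t ^ 2
    + 0 * t ^ 3 + 0 * t ^ 4) + κ / 2 * Real.log D with hS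
  have hy0 : 0 < ‖y₀‖ := norm_pos_iff.2 hy
  have hr : ‖h‖ ^ 2 * Real.exp (κ * Real.log (N * D)) = Real.exp (2 * S) := by
    have e1 : (a * (t * η) - b * a ^ 2 / 2 * (t * η) ^ 2).re =
        x * t - b * (x ^ 2 - y ^ 2) / 2 * t ^ 2 := by
      rw [show a * (t * η) - b * a ^ 2 / 2 * (t * η) ^ 2 =
        t * (a * η) - ((b / 2 * t ^ 2 : ℝ) : ℂ) * (a * η) ^ 2 by push_cast; ring, hξ,
        Complex.sub_re, Complex.re_ofReal_mul, Complex.re_ofReal_mul]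
      simp [pow_two]
      ring
    rw [hh, norm_mul, Complex.norm_exp, e1, mul_pow, ← Real.exp_nat_mul,
      Real.log_mul hN.ne' hDpos.ne']
    nth_rewrite 1 [← Real.exp_log hy0]
    rw [← Real.exp_nat_mul, ← Real.exp_add, ← Real.exp_add, hS]
    congr 1
    push_cast; ring
  have hlam : ‖h * (a - b * a ^ 2 * (t * η)) + κ * h * q' * ν * (starRingEnd ℂ) q / (D : ℝ)‖ ^ 2 =
      ‖h‖ ^ 2 * (((x + (-(b * (x ^ 2 - y ^ 2))) * t + 0 * t ^ 2 + 0 * t ^ 3 + 0 * t ^ 4) +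
      (0 + κ * ν * t + (-3 * κ * ν * β * x) * t ^ 2 + (2 * κ * ν * β ^ 2 * (x ^ 2 + y ^ 2)) * t ^ 3
        + 0 * t ^ 4) * D⁻¹) *
    ((x + (-(b * (x ^ 2 - y ^ 2))) * t + 0 * t ^ 2 + 0 * t ^ 3 + 0 * t ^ 4) +
      (0 + κ * ν * t + (-3 * κ * ν * β * x) * t ^ 2 + (2 * κ * ν * β ^ 2 * (x ^ 2 + y ^ 2)) * t ^ 3
        + 0 * t ^ 4) * D⁻¹) +
    ((y + (-2 * b * x * y) * t + 0 * t ^ 2 + 0 * t ^ 3 + 0 * t ^ 4) +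
      (0 + 0 * t + (-κ * ν * β * y) * t ^ 2 + 0 * t ^ 3 + 0 * t ^ 4) * D⁻¹) *
    ((y + (-2 * b * x * y) * t + 0 * t ^ 2 + 0 * t ^ 3 + 0 * t ^ 4) +
      (0 + 0 * t + (-κ * ν * β * y) * t ^ 2 + 0 * t ^ 3 + 0 * t ^ 4) * D⁻¹)) := by
    -- Multiplication by the unit number `η` does not change the modulus, and turns the complex
    -- derivative into the derivative along the line, which involves only `aη = x + iy`.
    have e1 : η * (h * (a - b * a ^ 2 * (t * η)) + κ * h * q' * ν * (starRingEnd ℂ) q / (D : ℝ)) =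
        h * ((x + y * Complex.I) - b * t * (x + y * Complex.I) ^ 2 +
          κ * ν * t * (1 - 2 * β * t * (x + y * Complex.I)) *
          (1 - β * t * (x - y * Complex.I)) * ((D⁻¹ : ℝ) : ℂ)) := by
      have e2 : (starRingEnd ℂ) q = t * (starRingEnd ℂ) η * (1 - β * t * (x - y * Complex.I)) := by
        rw [eq0]
        simp only [map_mul, map_sub, map_add, map_one, Complex.conj_ofReal, Complex.conj_I]
        ring
      rw [e2, eq1, ← hξ]
      rw [Complex.ofReal_inv, div_eq_mul_inv]
      linear_combination (κ * h * ν * t * (1 - 2 * β * t * (a * η)) *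
        (1 - β * t * (x - y * Complex.I)) * (D : ℂ)⁻¹) * hηη
    have e3 : ∀ v : ℂ, ‖v‖ = ‖η * v‖ := fun v => by rw [norm_mul, hη, one_mul]
    rw [e3, e1, norm_mul, mul_pow, ← Complex.normSq_eq_norm_sq ((_ : ℂ) + _), Complex.normSq_apply]
    congr 1
    simp [pow_two]
    ring
  have hode := hW.ode _ (Real.exp_pos (2 * S)).le
  simp only [discSpeed, lineSpeed]
  rw [nq, hr, nq', hlam, ← hD, ← hS, ← hode, ← hr]
  field_simp

end Positivity

/-! ### From the curvature condition on `φ` to positive holomorphic sectional curvature. -/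

section Positivity

variable {n k : ℕ} {c : ℝ} {φ W : ℝ → ℝ}

theorem update_zero_of_sqNorm_orthPart {i : Fin n} {y X : Fin n → ℂ}
    (h : sqNorm (orthPart (Function.update y i 1) (Function.update X i 0)) = 0) :
    Function.update X i 0 = 0 := by
  have e1 := sqNorm_eq_zero.1 h
  have e2 := congrFun e1 i
  simp only [orthPart, Pi.sub_apply, Pi.smul_apply, Function.update_self, smul_eq_mul,
    mul_one, zero_sub, Pi.zero_apply, neg_eq_zero] at e2
  rwa [orthPart, e2, zero_smul, sub_zero] at e1

theorem apply_ne_zero_of_update_zero {i : Fin n} {X : Fin n → ℂ} (hX : X ≠ 0)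
    (h : Function.update X i 0 = 0) : X i ≠ 0 := fun h0 => hX <| by
  rw [← h, ← h0, Function.update_eq_self]

theorem Profile.le_sigma (hW : Profile n k c φ W) {κ : ℝ} (hκ : |κ| = k) {r : ℝ} (hr : 0 ≤ r) :
    n - k * c ≤ n + κ * W r := by
  have h1 : |W r| ≤ c := abs_le.2 (hW.mem_Icc hr)
  have h2 : |κ * W r| ≤ k * c := by
    rw [abs_mul, hκ]; gcongr
  linarith [(abs_le.1 h2).1]

/-- The condition on `φ` under which the holomorphic sectional curvature is positive. -/
def CurvatureCondition (n k : ℕ) (c : ℝ) (φ : ℝ → ℝ) : Prop :=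
  ∀ x ∈ Set.Icc (-c) c, deriv (deriv φ) x < 0 ∧
    2 * (k : ℝ) ^ 2 * deriv φ x ^ 2 < -deriv (deriv φ) x * (2 * (n - k * c) - (k : ℝ) ^ 2 * φ x)

theorem Profile.hasDerivAt_phi (hW : Profile n k c φ W) (x : ℝ) : HasDerivAt φ (deriv φ x) x :=
  (hW.phi_smooth.differentiable (by simp) x).hasDerivAt

theorem Profile.hasDerivAt_deriv_phi (hW : Profile n k c φ W) (x : ℝ) :
    HasDerivAt (deriv φ) (deriv (deriv φ) x) x := by
  have : ContDiff ℝ ∞ (deriv φ) := (contDiff_infty_iff_deriv.1 hW.phi_smooth).2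
  exact (this.differentiable (by simp) x).hasDerivAt

theorem Profile.holSec_pos_of_ne_zero (hW : Profile n k c φ W) (hc : CurvatureCondition n k c φ)
    (i : Fin n) (inf : Bool) {y X : Fin n → ℂ} (hX : X ≠ 0) (hy : y i ≠ 0) :
    0 < holSec (localMetric (sgn inf * k) W i) y X := by
  obtain ⟨κ, hκ⟩ : ∃ κ : ℝ, κ = sgn inf * k := ⟨_, rfl⟩
  have hκ' : |κ| = k := by rw [hκ]; exact abs_sgn_mul inf k
  obtain ⟨Z, hZ⟩ : ∃ Z, Z = Function.update y i (1 : ℂ) := ⟨_, rfl⟩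
  obtain ⟨X', hX'⟩ : ∃ X', X' = Function.update X i (0 : ℂ) := ⟨_, rfl⟩
  obtain ⟨N, hN⟩ : ∃ N, N = sqNorm Z := ⟨_, rfl⟩
  obtain ⟨ν, hν⟩ : ∃ ν, ν = sqNorm (orthPart Z X') / sqNorm Z := ⟨_, rfl⟩
  have hN0 : 0 < N := by rw [hN, hZ]; exact sqNorm_update_pos i y
  have hν0 : 0 ≤ ν := by rw [hν]; exact div_nonneg (sqNorm_nonneg _) (sqNorm_nonneg _)
  obtain ⟨a, ha⟩ : ∃ a : ℂ, a = X i / y i + κ * (X' ⬝ᵥ star Z / sqNorm Z) := ⟨_, rfl⟩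
  obtain ⟨s₀, hs₀⟩ : ∃ s₀ : ℝ, s₀ = Real.log ‖y i‖ + κ / 2 * Real.log N := ⟨_, rfl⟩
  obtain ⟨U₀, hU₀⟩ : ∃ U₀ : ℝ, U₀ = W (Real.exp (2 * s₀)) := ⟨_, rfl⟩
  have hU : U₀ ∈ Set.Icc (-c) c := by rw [hU₀]; exact hW.mem_Icc (Real.exp_pos _).le
  obtain ⟨σ, hσ⟩ : ∃ σ : ℝ, σ = n + κ * U₀ := ⟨_, rfl⟩
  have hσK : n - k * c ≤ σ := by rw [hσ, hU₀]; exact hW.le_sigma hκ' (Real.exp_pos _).le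
  have hK : 0 < n - k * c := sub_pos.2 hW.mul_lt
  have hσ0 : 0 < σ := hK.trans_le hσK
  -- The Laplacian of the squared speed is quadratic in `b` and in `β`, with no mixed term; these
  -- are the values minimising it.
  obtain ⟨b, hb⟩ : ∃ b : ℝ, b = deriv φ U₀ / 2 := ⟨_, rfl⟩
  obtain ⟨β, hβ⟩ : ∃ β : ℝ, β = κ * φ U₀ / (2 * σ) := ⟨_, rfl⟩
  have hjet := fun x y => hasJet_lineSpeed n κ (U := fun s => W (Real.exp (2 * s))) (φ := φ)
    (φ' := deriv φ) ν s₀ b β x y hW.hasDerivAt_exp hW.hasDerivAt_phi (hW.hasDerivAt_deriv_phi _)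
  obtain ⟨_, _, j1⟩ := hjet a.re a.im
  -- The imaginary direction: `a i` has real part `-a.im` and imaginary part `a.re`.
  obtain ⟨_, _, j2⟩ := hjet (-a.im) a.re
  have hφ0 : 0 < φ U₀ := by
    rw [hU₀]; exact hW.phi_pos (Real.exp_pos _)
  have hq : ∀ z : ℂ, HasDerivAt (fun z : ℂ => z + (-(β * a)) * z ^ 2)
      (1 + 2 * (-(β * a)) * z) z := fun z =>
    ((hasDerivAt_id z).fun_add ((hasDerivAt_pow 2 z).const_mul (-(β * a)))).congr_deriv (by
      norm_num; ring)
  have hh : ∀ z : ℂ, HasDerivAt (fun z : ℂ => y i * Complex.exp (a * z - b * a ^ 2 / 2 * z ^ 2))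
      (y i * Complex.exp (a * z - b * a ^ 2 / 2 * z ^ 2) * (a - b * a ^ 2 * z)) z := fun z =>
    ((((hasDerivAt_id z).const_mul a).fun_sub
      ((hasDerivAt_pow 2 z).const_mul ((b : ℂ) * a ^ 2 / 2))).cexp.const_mul (y i)).congr_deriv (by
      simp only [id]; norm_num; ring)
  refine holSec_pos_of_discSpeed hW i inf y X hX hκ hZ hX' hq hh (by simp) (by simp) (by simp) ?_
    hν hN (j1.congr (.of_forall fun t => ?_)) (j2.congr (.of_forall fun t => ?_)) ?_
  · simp only [mul_zero, ne_eq, OfNat.ofNat_ne_zero, not_false_eq_true, zero_pow, sub_zero,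
      Complex.exp_zero, mul_one, ha]
    field_simp
  · have := discSpeed_eq_lineSpeed hW κ hν0 hN0 hy a b β (η := 1) (by simp) t
    rw [hs₀]
    simpa only [mul_one] using this.symm
  · have := discSpeed_eq_lineSpeed hW κ hν0 hN0 hy a b β (η := Complex.I) (by simp) t
    rw [hs₀]
    simpa only [Complex.mul_I_re, Complex.mul_I_im] using this.symm
  · have hcv := hc U₀ hU
    have hne : φ U₀ * (a.re ^ 2 + a.im ^ 2) ≠ 0 ∨ ν ≠ 0 := by
      by_cases h0 : ν = 0
      · left
        have h1 : sqNorm (orthPart Z X') = 0 := by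
          rw [hν] at h0
          exact (div_eq_zero_iff.1 h0).resolve_right (hN ▸ hN0.ne')
        rw [hZ, hX'] at h1
        have h2 := update_zero_of_sqNorm_orthPart h1
        have h3 := apply_ne_zero_of_update_zero hX h2
        have h4 : a ≠ 0 := by
          rw [ha, hX', h2, zero_dotProduct, zero_div, mul_zero, add_zero]
          exact div_ne_zero h3 hy
        have h5 := Complex.normSq_pos.2 h4
        rw [Complex.normSq_apply] at h5
        exact mul_ne_zero hφ0.ne' (by nlinarith)
      · exact .inr h0
    have key := curvature_form_neg hκ' hφ0.le hcv.1 hσK hK hcv.2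
      -- `P` is `φ(U)` times the squared modulus of the vertical component `a` of `X`; summed over
      -- the two directions, the jets are exactly the form of `curvature_form_neg`.
      (P := φ U₀ * (a.re ^ 2 + a.im ^ 2)) (by positivity) hν0 hne
    simp only [← hU₀, ← hσ]
    refine lt_of_eq_of_lt ?_ key
    rw [hβ, hb]
    field_simp
    ring

theorem eventually_hasDerivAt_deriv {f : ℝ → ℝ} {x : ℝ} (hf : ContDiffAt ℝ ∞ f x) :
    ∀ᶠ r in 𝓝 x, HasDerivAt f (deriv f r) r := by
  filter_upwards [(hf.of_le (m := 1) (by simp)).eventually (by simp)] with r hr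
  exact (hr.differentiableAt (by simp)).hasDerivAt

/-- Compares the two-jets at `r = 0` of both sides of `2 r W' = φ(W)`: first order gives `2 W' = φ'
W'`, second order gives `4 W'' = φ'' W'² + φ' W''`. A two-sided neighbourhood is needed, hence
`ode_near_zero`. -/
theorem Profile.deriv_phi_and_deriv_deriv (hW : Profile n k c φ W) :
    deriv φ (-c) = 2 ∧ deriv (deriv W) 0 = deriv (deriv φ) (-c) * deriv W 0 ^ 2 / 2 := by
  have hd1 := eventually_hasDerivAt_deriv (hW.smooth 0 le_rfl)
  have hs := hW.deriv_smooth le_rfl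
  have hd2 := eventually_hasDerivAt_deriv hs
  have hs2 : ContDiffAt ℝ ∞ (deriv (deriv W)) 0 :=
    (hs.fderiv_right (m := ∞) (by simp)).clm_apply (contDiffAt_const (c := (1 : ℝ)))
  have jW : HasJet W (-c) (deriv W 0) (deriv (deriv W) 0) :=
    ⟨deriv W, hd1, hW.zero, rfl, hd2.self_of_nhds⟩
  have jf : HasJet (deriv W) (deriv W 0) (deriv (deriv W) 0) (deriv (deriv (deriv W)) 0) :=
    ⟨_, hd2, rfl, rfl, (hs2.differentiableAt (by simp)).hasDerivAt⟩
  have jl := (HasJet.id.const_mul 2).mul jf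
  have jr := jW.comp (h := φ) (.of_forall hW.hasDerivAt_phi) (hW.hasDerivAt_deriv_phi (-c))
  have jr' := jr.congr (hW.ode_near_zero.mono fun r hr => hr.symm)
  have h0 := hW.deriv_pos 0 le_rfl
  have e1 : deriv φ (-c) = 2 := by
    obtain ⟨f₁, k1, -, k3, -⟩ := jl
    obtain ⟨f₂, l1, -, l3, -⟩ := jr'
    have := k1.self_of_nhds.unique l1.self_of_nhds
    rw [k3, l3] at this
    have e : (deriv φ (-c) - 2) * deriv W 0 = 0 := by linarith
    linarith [(mul_eq_zero.1 e).resolve_right h0.ne']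
  refine ⟨e1, ?_⟩
  have := jl.snd_unique jr'
  rw [e1] at this
  linarith

/-- On the zero section the exponential disc is unavailable, and the linear one `q = z`, `h = wz`
suffices. Its squared speed depends only on `|z|`, so the jet is independent of `η`. -/
theorem Profile.hasJet_discSpeed_zero (hW : Profile n k c φ W) (κ : ℝ) {ν N : ℝ} (hν : 0 ≤ ν)
    (hN : 0 < N) (w : ℂ) {η : ℂ} (hη : ‖η‖ = 1) : ∃ a₀ a₁,
    HasJet (fun t : ℝ => discSpeed n κ W ν N (t * η) 1 (w * (t * η)) w) a₀ a₁
      (4 * deriv (deriv W) 0 * (‖w‖ ^ 2 * Real.exp (κ * Real.log N)) ^ 2 +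
        16 * κ * ν * deriv W 0 * (‖w‖ ^ 2 * Real.exp (κ * Real.log N)) -
        8 * (n + κ * W 0) * ν ^ 2) := by
  have hd1 := eventually_hasDerivAt_deriv (hW.smooth 0 le_rfl)
  have hs := hW.deriv_smooth le_rfl
  have hd2 := eventually_hasDerivAt_deriv hs
  have hs2 : ContDiffAt ℝ ∞ (deriv (deriv W)) 0 :=
    (hs.fderiv_right (m := ∞) (by simp)).clm_apply (contDiffAt_const (c := (1 : ℝ)))
  have hd3 : HasDerivAt (deriv (deriv W)) (deriv (deriv (deriv W)) 0) 0 :=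
    (hs2.differentiableAt (by simp)).hasDerivAt
  have jD := HasJet.poly 1 0 ν 0 0
  have jDi := jD.inv one_ne_zero
  have jE := (((jD.log.const_mul κ).cast (mul_zero κ) (mul_zero κ) rfl).comp (h := Real.exp)
    (.of_forall Real.hasDerivAt_exp) (Real.hasDerivAt_exp 0)).const_mul
    (Real.exp (κ * Real.log N))
  have jr := ((HasJet.poly 0 0 (‖w‖ ^ 2) 0 0).mul jE).cast (a' := 0) (by ring) rfl rfl
  have jW := jr.comp hd1 hd2.self_of_nhds
  have jW' := jr.comp hd2 hd3
  have jv := (HasJet.const 1).add ((HasJet.poly 0 0 (κ * ν) 0 0).mul jDi)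
  have j := ((((HasJet.const (n : ℝ)).add (jW.const_mul κ)).const_mul (2 * ν)).mul
    (jDi.mul jDi)).add (((jW'.const_mul 2).mul jE).mul ((jv.mul jv).const_mul (‖w‖ ^ 2)))
  refine ⟨_, _, (HasJet.cast j rfl rfl ?_).congr (.of_forall fun t => ?_)⟩
  · simp only [Real.exp_zero]
    ring
  · have hDpos : 0 < 1 + ν * t ^ 2 := by positivity
    have hn : ‖(t : ℂ) * η‖ ^ 2 = t ^ 2 := by
      rw [norm_mul, hη, mul_one, Complex.norm_real, Real.norm_eq_abs, sq_abs]
    have hηη : η * (starRingEnd ℂ) η = 1 := by rw [Complex.mul_conj', hη]; norm_num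
    have hv : ‖w + κ * (w * (t * η)) * 1 * ν * (starRingEnd ℂ) (t * η) / (1 + ν * t ^ 2 : ℝ)‖ ^ 2 =
        ‖w‖ ^ 2 * (1 + κ * ν * t ^ 2 * (1 + ν * t ^ 2)⁻¹) ^ 2 := by
      have : w + κ * (w * (t * η)) * 1 * ν * (starRingEnd ℂ) (t * η) / (1 + ν * t ^ 2 : ℝ) =
          w * ((1 + κ * ν * t ^ 2 * (1 + ν * t ^ 2)⁻¹ : ℝ) : ℂ) := by
        rw [map_mul, Complex.conj_ofReal, div_eq_mul_inv]
        push_cast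
        linear_combination (κ * w * t ^ 2 * ν * (1 + (ν : ℂ) * t ^ 2)⁻¹) * hηη
      rw [this, norm_mul, mul_pow, Complex.norm_real, Real.norm_eq_abs, sq_abs]
    have hE : Real.exp (κ * Real.log (N * (1 + ν * t ^ 2))) =
        Real.exp (κ * Real.log N) * Real.exp (κ * Real.log (1 + ν * t ^ 2)) := by
      rw [Real.log_mul hN.ne' hDpos.ne', mul_add, Real.exp_add]
    simp only [discSpeed, hn]
    rw [hv, hE, norm_mul w, mul_pow, hn, norm_one]
    have hr : ‖w‖ ^ 2 * t ^ 2 * (Real.exp (κ * Real.log N) *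
        Real.exp (κ * Real.log (1 + ν * t ^ 2))) =
        (0 + 0 * t + ‖w‖ ^ 2 * t ^ 2 + 0 * t ^ 3 + 0 * t ^ 4) * (Real.exp (κ * Real.log N) *
        Real.exp (κ * Real.log (1 + 0 * t + ν * t ^ 2 + 0 * t ^ 3 + 0 * t ^ 4))) := by
      simp
    have hD' : 1 + 0 * t + ν * t ^ 2 + 0 * t ^ 3 + 0 * t ^ 4 = 1 + ν * t ^ 2 := by ring
    rw [← hr, hD']
    field_simp
    ring

theorem Profile.holSec_pos_of_eq_zero (hW : Profile n k c φ W) (hc : CurvatureCondition n k c φ)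
    (i : Fin n) (inf : Bool) {y X : Fin n → ℂ} (hX : X ≠ 0) (hy : y i = 0) :
    0 < holSec (localMetric (sgn inf * k) W i) y X := by
  obtain ⟨κ, hκ⟩ : ∃ κ : ℝ, κ = sgn inf * k := ⟨_, rfl⟩
  have hκ' : |κ| = k := by rw [hκ]; exact abs_sgn_mul inf k
  obtain ⟨Z, hZ⟩ : ∃ Z, Z = Function.update y i (1 : ℂ) := ⟨_, rfl⟩
  obtain ⟨X', hX'⟩ : ∃ X', X' = Function.update X i (0 : ℂ) := ⟨_, rfl⟩
  obtain ⟨N, hN⟩ : ∃ N, N = sqNorm Z := ⟨_, rfl⟩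
  obtain ⟨ν, hν⟩ : ∃ ν, ν = sqNorm (orthPart Z X') / sqNorm Z := ⟨_, rfl⟩
  have hN0 : 0 < N := by rw [hN, hZ]; exact sqNorm_update_pos i y
  have hν0 : 0 ≤ ν := by rw [hν]; exact div_nonneg (sqNorm_nonneg _) (sqNorm_nonneg _)
  obtain ⟨_, _, j1⟩ := hW.hasJet_discSpeed_zero κ hν0 hN0 (X i) (η := 1) (by simp)
  obtain ⟨_, _, j2⟩ := hW.hasJet_discSpeed_zero κ hν0 hN0 (X i) (η := Complex.I) (by simp)
  have hq : ∀ z : ℂ, HasDerivAt (fun z : ℂ => z) ((fun _ => 1) z) z := fun z => hasDerivAt_id z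
  have hh : ∀ z : ℂ, HasDerivAt (fun z : ℂ => X i * z) ((fun _ => X i) z) z := fun z => by
    simpa using (hasDerivAt_id z).const_mul (X i)
  refine holSec_pos_of_discSpeed hW i inf y X hX hκ hZ hX' hq hh rfl rfl (by simp [hy])
    (by simp [hy]) hν hN (by simpa only [mul_one] using j1) j2 ?_
  obtain ⟨e1, e2⟩ := hW.deriv_phi_and_deriv_deriv
  have hc0 := hW.c_pos
  have hcv := hc (-c) ⟨le_rfl, by linarith⟩
  have hφ : φ (-c) = 0 := by
    have := hW.ode 0 le_rfl
    rw [hW.zero] at this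
    simpa using this.symm
  have hd := hW.deriv_pos 0 le_rfl
  have hσK := hW.le_sigma hκ' (le_refl (0 : ℝ))
  have hK : 0 < n - k * c := sub_pos.2 hW.mul_lt
  obtain ⟨ρ, hρ⟩ : ∃ ρ : ℝ, ρ = ‖X i‖ ^ 2 * Real.exp (κ * Real.log N) := ⟨_, rfl⟩
  have hne : 2 * (deriv W 0 * ρ) ≠ 0 ∨ ν ≠ 0 := by
    by_cases h0 : ν = 0
    · left
      have h1 : sqNorm (orthPart Z X') = 0 := by
        rw [hν] at h0
        exact (div_eq_zero_iff.1 h0).resolve_right (hN ▸ hN0.ne')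
      rw [hZ, hX'] at h1
      have h3 := apply_ne_zero_of_update_zero hX (update_zero_of_sqNorm_orthPart h1)
      rw [hρ]
      positivity
    · exact .inr h0
  -- At the section `φ = 0` and `φ' = 2`; substituting `W'' = φ'' W'² / 2`, the sum of the jets is
  -- the same quadratic form with `P = 2 W'(0) ρ`.
  have key := curvature_form_neg hκ' hφ.ge hcv.1 hσK hK hcv.2
    (P := 2 * (deriv W 0 * ρ)) (by rw [hρ]; positivity) hν0 hne
  rw [hφ, e1] at key
  rw [← hρ, e2]
  refine lt_of_eq_of_lt ?_ key
  ring

theorem Profile.holSecPos_metric (hW : Profile n k c φ W) (hc : CurvatureCondition n k c φ) :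
    hW.metric.HolSecPos := by
  intro i inf y X hX
  rw [hW.inChart_metric]
  by_cases hy : y i = 0
  · exact hW.holSec_pos_of_eq_zero hc i inf hX hy
  · exact hW.holSec_pos_of_ne_zero hc i inf hX hy

end Positivity

/-! ### Solving the equation for the momentum coordinate -/

section Solution

variable {c : ℝ} {φ χ θ : ℝ → ℝ}

/-- A primitive of `2 θ / χ`. -/
def expo (χ θ : ℝ → ℝ) (x : ℝ) : ℝ := ∫ t in (0 : ℝ)..x, 2 * θ t / χ t

/-- The squared fibre norm as a function of the momentum coordinate. -/
def radOf (c : ℝ) (χ θ : ℝ → ℝ) (x : ℝ) : ℝ := (c + x) / (c - x) * Real.exp (expo χ θ x)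

theorem contDiff_expo_deriv (hχ : ContDiff ℝ ∞ χ) (hθ : ContDiff ℝ ∞ θ) (hpos : ∀ x, 0 < χ x) :
    ContDiff ℝ ∞ (fun x => 2 * θ x / χ x) :=
  (contDiff_const.mul hθ).div hχ fun x => (hpos x).ne'

theorem hasDerivAt_expo (hχ : ContDiff ℝ ∞ χ) (hθ : ContDiff ℝ ∞ θ) (hpos : ∀ x, 0 < χ x)
    (x : ℝ) : HasDerivAt (expo χ θ) (2 * θ x / χ x) x :=
  have hc := (contDiff_expo_deriv hχ hθ hpos).continuous
  intervalIntegral.integral_hasDerivAt_right (hc.intervalIntegrable _ _)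
    (hc.stronglyMeasurableAtFilter _ _) hc.continuousAt

theorem contDiff_expo (hχ : ContDiff ℝ ∞ χ) (hθ : ContDiff ℝ ∞ θ) (hpos : ∀ x, 0 < χ x) :
    ContDiff ℝ ∞ (expo χ θ) := by
  refine contDiff_infty_iff_deriv.2
    ⟨fun x => (hasDerivAt_expo hχ hθ hpos x).differentiableAt, ?_⟩
  rw [show deriv (expo χ θ) = _ from funext fun x => (hasDerivAt_expo hχ hθ hpos x).deriv]
  exact contDiff_expo_deriv hχ hθ hpos

theorem expo_neg (heχ : ∀ x, χ (-x) = χ x) (heθ : ∀ x, θ (-x) = θ x) (x : ℝ) :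
    expo χ θ (-x) = -expo χ θ x := by
  have := intervalIntegral.integral_comp_neg (a := 0) (b := x) fun t => 2 * θ t / χ t
  simp only [heχ, heθ, neg_zero] at this
  rw [expo, expo, this, intervalIntegral.integral_symm]

/-- The evenness of `χ` and `θ` becomes the symmetry exchanging the two sections, `W(1/r) = -W(r)`.
-/
theorem radOf_neg (heχ : ∀ x, χ (-x) = χ x) (heθ : ∀ x, θ (-x) = θ x) (x : ℝ) :
    radOf c χ θ (-x) = (radOf c χ θ x)⁻¹ := by
  rw [radOf, radOf, expo_neg heχ heθ, Real.exp_neg, mul_inv, inv_div, sub_neg_eq_add,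
    ← sub_eq_add_neg]

theorem contDiffAt_radOf (hχ : ContDiff ℝ ∞ χ) (hθ : ContDiff ℝ ∞ θ) (hpos : ∀ x, 0 < χ x)
    {x : ℝ} (hx : x < c) : ContDiffAt ℝ ∞ (radOf c χ θ) x :=
  ((contDiff_const.add contDiff_id).contDiffAt.div (contDiff_const.sub contDiff_id).contDiffAt
    (sub_pos.2 hx).ne').mul (contDiff_expo hχ hθ hpos).exp.contDiffAt

/-- The hypothesis `heq` is the splitting `2/φ = 2c/(c² - x²) + 2θ/χ` for `φ = (c² - x²) χ`. It
forces `c χ(±c) = 1`, that is, slope `2` of `φ` at `-c`. The derivative has no zero at `x = -c`, so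
the inverse is smooth at `r = 0`. -/
theorem hasDerivAt_radOf (hχ : ContDiff ℝ ∞ χ) (hθ : ContDiff ℝ ∞ θ) (hpos : ∀ x, 0 < χ x)
    (heq : ∀ x, 1 - c * χ x = (c ^ 2 - x ^ 2) * θ x) {x : ℝ} (hx : x < c) :
    HasDerivAt (radOf c χ θ) (2 * Real.exp (expo χ θ x) / ((c - x) ^ 2 * χ x)) x := by
  have h0 : c - x ≠ 0 := (sub_pos.2 hx).ne'
  have h1 := (hpos x).ne'
  refine ((((hasDerivAt_id x).const_add c).fun_div ((hasDerivAt_id x).const_sub c) h0).fun_mul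
    (hasDerivAt_expo hχ hθ hpos x).exp).congr_deriv ?_
  simp only [id]
  field_simp
  linear_combination -2 * heq x

theorem strictMonoOn_radOf (hχ : ContDiff ℝ ∞ χ) (hθ : ContDiff ℝ ∞ θ) (hpos : ∀ x, 0 < χ x)
    (heq : ∀ x, 1 - c * χ x = (c ^ 2 - x ^ 2) * θ x) :
    StrictMonoOn (radOf c χ θ) (Set.Iio c) := by
  refine strictMonoOn_of_deriv_pos (convex_Iio c)
    (fun x hx => (contDiffAt_radOf hχ hθ hpos hx).continuousAt.continuousWithinAt) fun x hx => ?_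
  rw [interior_Iio] at hx
  rw [(hasDerivAt_radOf hχ hθ hpos heq hx).deriv]
  have h0 : 0 < c - x := sub_pos.2 hx
  have h1 := hpos x
  positivity

theorem tendsto_radOf (hc : 0 < c) (hχ : ContDiff ℝ ∞ χ) (hθ : ContDiff ℝ ∞ θ)
    (hpos : ∀ x, 0 < χ x) : Filter.Tendsto (radOf c χ θ) (𝓝[<] c) Filter.atTop := by
  have h1 : Filter.Tendsto (fun x => (c - x)⁻¹) (𝓝[<] c) Filter.atTop := by
    refine tendsto_inv_nhdsGT_zero.comp (tendsto_nhdsWithin_iff.2 ⟨?_, ?_⟩)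
    · have : Filter.Tendsto (fun x => c - x) (𝓝 c) (𝓝 (c - c)) :=
        (continuous_const.sub continuous_id).tendsto c
      rw [sub_self] at this
      exact this.mono_left nhdsWithin_le_nhds
    · filter_upwards [self_mem_nhdsWithin] with x hx using sub_pos.2 (Set.mem_Iio.1 hx)
  have h2 : Filter.Tendsto (fun x => (c + x) * Real.exp (expo χ θ x)) (𝓝[<] c)
      (𝓝 ((c + c) * Real.exp (expo χ θ c))) :=
    (((continuous_const.add continuous_id).mul
      (contDiff_expo hχ hθ hpos).continuous.rexp).tendsto c).mono_left nhdsWithin_le_nhds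
  refine (h1.atTop_mul_pos (by positivity) h2).congr fun x => ?_
  rw [radOf]; ring

theorem exists_radOf_eq (hc : 0 < c) (hχ : ContDiff ℝ ∞ χ) (hθ : ContDiff ℝ ∞ θ)
    (hpos : ∀ x, 0 < χ x) {r : ℝ} (hr : 0 ≤ r) :
    ∃ x, -c ≤ x ∧ x < c ∧ radOf c χ θ x = r := by
  obtain ⟨x, hx1, hx2⟩ := (((tendsto_radOf hc hχ hθ hpos).eventually_ge_atTop r).and
    (Ioo_mem_nhdsLT (show -c < c by linarith))).exists
  have h0 : radOf c χ θ (-c) = 0 := by simp [radOf]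
  obtain ⟨z, hz, hz'⟩ := intermediate_value_Icc hx2.1.le
    (fun w hw => (contDiffAt_radOf hχ hθ hpos (hw.2.trans_lt hx2.2)).continuousAt.continuousWithinAt)
    (show r ∈ Set.Icc (radOf c χ θ (-c)) (radOf c χ θ x) from ⟨h0.symm ▸ hr, hx1⟩)
  exact ⟨z, hz.1, hz.2.trans_lt hx2.2, hz'⟩

/-- The momentum coordinate as a function of the squared fibre norm. -/
def momentum (c : ℝ) (χ θ : ℝ → ℝ) : ℝ → ℝ := Function.invFunOn (radOf c χ θ) (Set.Iio c)

theorem momentum_radOf (hχ : ContDiff ℝ ∞ χ) (hθ : ContDiff ℝ ∞ θ) (hpos : ∀ x, 0 < χ x)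
    (heq : ∀ x, 1 - c * χ x = (c ^ 2 - x ^ 2) * θ x) {x : ℝ} (hx : x < c) :
    momentum c χ θ (radOf c χ θ x) = x :=
  (strictMonoOn_radOf hχ hθ hpos heq).injOn.leftInvOn_invFunOn hx

/-- Injectivity on `x < c` identifies the global inverse with the local one of the inverse function
theorem. Working on `x < c` rather than on `-c < x < c` makes `x = -c` an interior point, so `r = 0`
is included. -/
theorem momentum_local (hχ : ContDiff ℝ ∞ χ) (hθ : ContDiff ℝ ∞ θ) (hpos : ∀ x, 0 < χ x)
    (heq : ∀ x, 1 - c * χ x = (c ^ 2 - x ^ 2) * θ x) {x : ℝ} (hx : x < c) :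
    ContDiffAt ℝ ∞ (momentum c χ θ) (radOf c χ θ x) ∧
      ∀ᶠ r in 𝓝 (radOf c χ θ x), ∃ z < c, radOf c χ θ z = r := by
  have hR := contDiffAt_radOf hχ hθ hpos hx
  have hd := hasDerivAt_radOf hχ hθ hpos heq hx
  have h0 : 2 * Real.exp (expo χ θ x) / ((c - x) ^ 2 * χ x) ≠ 0 := by
    have h0 : 0 < c - x := sub_pos.2 hx
    have h1 := hpos x
    positivity
  have hd' : HasFDerivAt (radOf c χ θ)
      ((ContinuousLinearEquiv.unitsEquivAut ℝ (Units.mk0 _ h0) : ℝ ≃L[ℝ] ℝ) : ℝ →L[ℝ] ℝ) x := by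
    refine hd.hasFDerivAt.congr_fderiv ?_
    ext
    simp
  have hinf : (∞ : WithTop ℕ∞) ≠ 0 := by simp
  have hloc := hR.to_localInverse hd' hinf
  have hstrict := hR.hasStrictFDerivAt' hd' hinf
  have hright := hstrict.eventually_right_inverse
  have hc := hstrict.localInverse_continuousAt
  have hself : hstrict.localInverse _ _ _ (radOf c χ θ x) = x := hstrict.localInverse_apply_image
  have hlt : ∀ᶠ r in 𝓝 (radOf c χ θ x), hstrict.localInverse _ _ _ r < c :=
    hc.eventually (by rw [hself]; exact Iio_mem_nhds hx)
  refine ⟨hloc.congr_of_eventuallyEq ?_, ?_⟩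
  · filter_upwards [hright, hlt] with r h1 h2
    change _ = hstrict.localInverse _ _ _ r
    conv_lhs => rw [← h1]
    exact momentum_radOf hχ hθ hpos heq h2
  · filter_upwards [hright, hlt] with r h1 h2 using ⟨_, h2, h1⟩

theorem deriv_momentum (hχ : ContDiff ℝ ∞ χ) (hθ : ContDiff ℝ ∞ θ) (hpos : ∀ x, 0 < χ x)
    (heq : ∀ x, 1 - c * χ x = (c ^ 2 - x ^ 2) * θ x) {x : ℝ} (hx : x < c) :
    deriv (momentum c χ θ) (radOf c χ θ x) =
      ((c - x) ^ 2 * χ x) / (2 * Real.exp (expo χ θ x)) := by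
  have h0 : 0 < c - x := sub_pos.2 hx
  have h1 := hpos x
  have hW := ((momentum_local hχ hθ hpos heq hx).1.differentiableAt (by simp)).hasDerivAt
  have h2 := hW.comp x (hasDerivAt_radOf hχ hθ hpos heq hx)
  have h3 : HasDerivAt (momentum c χ θ ∘ radOf c χ θ) 1 x := by
    refine (hasDerivAt_id x).congr_of_eventuallyEq ?_
    filter_upwards [Iio_mem_nhds hx] with z hz using momentum_radOf hχ hθ hpos heq hz
  have h4 := h2.unique h3
  field_simp at h4 ⊢
  linarith

/-- A function `φ = (c² - x²) χ` with the boundary behaviour encoded by `θ` has a profile. -/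
theorem profile_momentum {n k : ℕ} (hk : 0 < k) (hc : 0 < c) (hkc : k * c < n)
    (hχ : ContDiff ℝ ∞ χ) (hθ : ContDiff ℝ ∞ θ) (hpos : ∀ x, 0 < χ x)
    (heχ : ∀ x, χ (-x) = χ x) (heθ : ∀ x, θ (-x) = θ x)
    (hφ : ∀ x, φ x = (c ^ 2 - x ^ 2) * χ x)
    (heq : ∀ x, 1 - c * χ x = (c ^ 2 - x ^ 2) * θ x) :
    Profile n k c φ (momentum c χ θ) := by
  have hode : ∀ x < c, 2 * radOf c χ θ x * deriv (momentum c χ θ) (radOf c χ θ x) =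
      φ (momentum c χ θ (radOf c χ θ x)) := fun x hx => by
    have h0 : c - x ≠ 0 := (sub_pos.2 hx).ne'
    rw [deriv_momentum hχ hθ hpos heq hx, momentum_radOf hχ hθ hpos heq hx, hφ, radOf]
    field_simp
    ring
  have hrange := fun r hr => exists_radOf_eq hc hχ hθ hpos (r := r) hr
  have hzero : radOf c χ θ (-c) = 0 := by simp [radOf]
  have hcc : -c < c := by linarith
  have hne : ∀ x, -c ≤ x → 0 < radOf c χ θ x → -c < x := fun x hx h =>
    lt_of_le_of_ne hx fun h' => h.ne' (h' ▸ hzero)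
  exact
    { phi_smooth := by
        rw [show φ = _ from funext hφ]
        exact (contDiff_const.sub (contDiff_id.pow 2)).mul hχ
      phi_even := fun x => by rw [hφ, hφ, heχ, neg_sq]
      smooth := fun r hr => by
        obtain ⟨x, -, hx, rfl⟩ := hrange r hr
        exact (momentum_local hχ hθ hpos heq hx).1
      zero := by
        rw [← hzero, momentum_radOf hχ hθ hpos heq hcc]
      ode := fun r hr => by
        obtain ⟨x, -, hx, rfl⟩ := hrange r hr
        exact hode x hx
      ode_near_zero := by
        have := (momentum_local hχ hθ hpos heq hcc).2
        rw [hzero] at this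
        filter_upwards [this] with r ⟨x, hx, hr⟩
        rw [← hr]
        exact hode x hx
      deriv_pos := fun r hr => by
        obtain ⟨x, -, hx, rfl⟩ := hrange r hr
        rw [deriv_momentum hχ hθ hpos heq hx]
        have h0 : 0 < c - x := sub_pos.2 hx
        have h1 := hpos x
        positivity
      image := by
        ext x
        constructor
        · rintro ⟨r, hr, rfl⟩
          obtain ⟨x, hx', hx, rfl⟩ := hrange r (le_of_lt hr)
          rw [momentum_radOf hχ hθ hpos heq hx]
          exact ⟨hne x hx' hr, hx⟩
        · intro hx
          refine ⟨radOf c χ θ x, ?_, momentum_radOf hχ hθ hpos heq hx.2⟩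
          have h1 : 0 < c + x := by linarith [hx.1]
          have h2 : 0 < c - x := sub_pos.2 hx.2
          simp only [radOf, Set.mem_Ioi]
          positivity
      odd := fun r hr => by
        obtain ⟨x, hx', hx, rfl⟩ := hrange r (le_of_lt hr)
        rw [← radOf_neg heχ heθ, momentum_radOf hχ hθ hpos heq hx,
          momentum_radOf hχ hθ hpos heq (by linarith [hne x hx' hr])]
      c_pos := hc
      mul_lt := hkc
      k_pos := hk }

end Solution

/-! ### The polynomials generating the metrics -/

section Polynomials

/-- The polynomial `A (1 - y²) + B (1 - y^{2m+2}) + D (1 - y^{2m+4})` in `y = x / c`. -/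
def trinomial (m : ℕ) (c A B D x : ℝ) : ℝ :=
  A * (1 - (x / c) ^ 2) + B * (1 - (x / c) ^ (2 * m + 2)) + D * (1 - (x / c) ^ (2 * m + 4))

variable {m : ℕ} {c A B D : ℝ}

/-- With `p = m + 2`, the three coefficients are `c² α₂`, `c^{2p-2} α_{2p-2}` and `c^{2p} α_{2p}`;
in this form the vanishing at `±c` is visible. -/
theorem phi_eq_trinomial (hc : 0 < c) (δ α₂ : ℝ) :
    phi (m + 2) c (c / (m + 2 : ℕ) + δ) α₂ = trinomial m c (α₂ * c ^ 2)
      ((m + 2) * δ - (m + 1) * (α₂ * c ^ 2))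
      (c / (m + 2) - (m + 1) * δ + m * (α₂ * c ^ 2)) := by
  funext x
  have h1 : 2 * (m + 2) - 2 = 2 * m + 2 := by omega
  have h2 : 2 * (m + 2) = 2 * m + 4 := by omega
  have h3 : (m : ℝ) + 2 ≠ 0 := by positivity
  rw [phi, trinomial, h1, h2, div_pow, div_pow, div_pow]
  push_cast
  field_simp
  ring

theorem hasDerivAt_trinomial (m : ℕ) (c A B D x : ℝ) : HasDerivAt (trinomial m c A B D)
    (-(2 * A * (x / c) + (2 * m + 2) * B * (x / c) ^ (2 * m + 1) +
      (2 * m + 4) * D * (x / c) ^ (2 * m + 3)) / c) x := by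
  have h : ∀ N : ℕ, HasDerivAt (fun x : ℝ => 1 - (x / c) ^ N) (-(N * (x / c) ^ (N - 1) * (1 / c))) x :=
    fun N => (((hasDerivAt_id x).div_const c).pow N).const_sub 1
  refine ((((h 2).const_mul A).fun_add ((h (2 * m + 2)).const_mul B)).fun_add
    ((h (2 * m + 4)).const_mul D)).congr_deriv ?_
  push_cast
  ring

theorem hasDerivAt_deriv_trinomial (m : ℕ) (c A B D x : ℝ) :
    HasDerivAt (deriv (trinomial m c A B D))
    (-(2 * A + (2 * m + 2) * (2 * m + 1) * B * (x / c) ^ (2 * m) +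
      (2 * m + 4) * (2 * m + 3) * D * (x / c) ^ (2 * m + 2)) / c ^ 2) x := by
  rw [show deriv (trinomial m c A B D) = _ from
    funext fun x => (hasDerivAt_trinomial m c A B D x).deriv]
  have h : ∀ N : ℕ, HasDerivAt (fun x : ℝ => (x / c) ^ N) (N * (x / c) ^ (N - 1) * (1 / c)) x :=
    fun N => ((hasDerivAt_id x).div_const c).pow N
  have h1 : HasDerivAt (fun x : ℝ => x / c) (1 / c) x := (hasDerivAt_id x).div_const c
  refine (((((h1.const_mul (2 * A)).fun_add ((h (2 * m + 1)).const_mul ((2 * m + 2) * B))).fun_add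
    ((h (2 * m + 3)).const_mul ((2 * m + 4) * D))).fun_neg).div_const c).congr_deriv ?_
  push_cast
  ring

/-- The geometric sum `1 + z + ⋯ + z^{N-1}`. -/
def geomSum (N : ℕ) (z : ℝ) : ℝ := ∑ j ∈ Finset.range N, z ^ j

/-- The quotient of `N - geomSum N` by `1 - z`. -/
def geomSumSum (N : ℕ) (z : ℝ) : ℝ := ∑ j ∈ Finset.range N, geomSum j z

theorem one_sub_mul_geomSum (N : ℕ) (z : ℝ) : (1 - z) * geomSum N z = 1 - z ^ N := by
  rw [mul_comm]; exact geom_sum_mul_neg z N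

theorem one_sub_mul_geomSumSum (N : ℕ) (z : ℝ) :
    (1 - z) * geomSumSum N z = N - geomSum N z := by
  rw [geomSumSum, Finset.mul_sum, Finset.sum_congr rfl fun j _ => one_sub_mul_geomSum j z,
    Finset.sum_sub_distrib, geomSum]
  simp

theorem contDiff_geomSum (N : ℕ) : ContDiff ℝ ∞ (geomSum N) :=
  ContDiff.sum fun j _ => contDiff_id.pow j

theorem contDiff_geomSumSum (N : ℕ) : ContDiff ℝ ∞ (geomSumSum N) :=
  ContDiff.sum fun j _ => contDiff_geomSum j

theorem geomSum_pos {N : ℕ} (hN : 0 < N) {z : ℝ} (hz : 0 ≤ z) : 0 < geomSum N z := by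
  obtain ⟨N, rfl⟩ : ∃ l, N = l + 1 := ⟨N - 1, by omega⟩
  rw [geomSum, Finset.sum_range_succ']
  positivity

/-- Dividing each `1 - z^N` by `1 - z`, with `z = (x/c)²`, gives `χ` as geometric sums. By `hsum`,
`1 - cχ` is a combination of the differences `N - geomSum N z`, which are divisible by `1 - z` once
more; this gives `θ`. -/
theorem exists_profile_trinomial {n k : ℕ} (hk : 0 < k) (hc : 0 < c) (hkc : k * c < n)
    (hA : 0 < A) (hB : 0 < B) (hD : 0 < D) (hsum : A + (m + 1) * B + (m + 2) * D = c) :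
    ∃ W, Profile n k c (trinomial m c A B D) W := by
  have hz : ContDiff ℝ ∞ (fun x : ℝ => (x / c) ^ 2) := (contDiff_id.div_const c).pow 2
  have key : ∀ x, c ^ 2 - x ^ 2 = c ^ 2 * (1 - (x / c) ^ 2) := fun x => by field_simp
  refine ⟨_, profile_momentum hk hc hkc
    (χ := fun x => (A * geomSum 1 ((x / c) ^ 2) + B * geomSum (m + 1) ((x / c) ^ 2) +
      D * geomSum (m + 2) ((x / c) ^ 2)) / c ^ 2)
    (θ := fun x => (A * geomSumSum 1 ((x / c) ^ 2) + B * geomSumSum (m + 1) ((x / c) ^ 2) +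
      D * geomSumSum (m + 2) ((x / c) ^ 2)) / c ^ 3) ?_ ?_ ?_ ?_ ?_ ?_ ?_⟩
  · exact (((contDiff_const.mul ((contDiff_geomSum _).comp hz)).add
      (contDiff_const.mul ((contDiff_geomSum _).comp hz))).add
      (contDiff_const.mul ((contDiff_geomSum _).comp hz))).div_const _
  · exact (((contDiff_const.mul ((contDiff_geomSumSum _).comp hz)).add
      (contDiff_const.mul ((contDiff_geomSumSum _).comp hz))).add
      (contDiff_const.mul ((contDiff_geomSumSum _).comp hz))).div_const _
  · intro x
    have h1 := geomSum_pos (N := 1) one_pos (sq_nonneg (x / c))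
    have h2 := geomSum_pos (N := m + 1) (by omega) (sq_nonneg (x / c))
    have h3 := geomSum_pos (N := m + 2) (by omega) (sq_nonneg (x / c))
    positivity
  · intro x; simp only [neg_div, neg_sq]
  · intro x; simp only [neg_div, neg_sq]
  · intro x
    have h1 := one_sub_mul_geomSum 1 ((x / c) ^ 2)
    have h2 := one_sub_mul_geomSum (m + 1) ((x / c) ^ 2)
    have h3 := one_sub_mul_geomSum (m + 2) ((x / c) ^ 2)
    rw [key x, mul_assoc, mul_div_assoc']
    rw [mul_div_cancel₀ _ (pow_ne_zero 2 hc.ne'), trinomial]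
    rw [← pow_mul] at h2 h3
    rw [show 2 * m + 2 = 2 * (m + 1) by ring, show 2 * m + 4 = 2 * (m + 2) by ring]
    linear_combination -A * h1 - B * h2 - D * h3
  · intro x
    have h1 := one_sub_mul_geomSumSum 1 ((x / c) ^ 2)
    have h2 := one_sub_mul_geomSumSum (m + 1) ((x / c) ^ 2)
    have h3 := one_sub_mul_geomSumSum (m + 2) ((x / c) ^ 2)
    push_cast at h1 h2 h3
    rw [key x]
    generalize (x / c) ^ 2 = z at *
    field_simp
    linear_combination -hsum - A * h1 - B * h2 - D * h3

/-- The Cauchy-Schwarz inequality for three terms with weights `1`, `l` and `r`. -/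
theorem sq_add_le {u v w l r : ℝ} (hu : 0 ≤ u) (hv : 0 ≤ v) (hw : 0 ≤ w) (hl : 0 < l)
    (hr : 0 < r) : (u + v + w) ^ 2 ≤ (u + l * v + r * w) * (u + v / l + w / r) := by
  have h : (u + l * v + r * w) * (u + v / l + w / r) - (u + v + w) ^ 2 =
      u * v * (l - 1) ^ 2 / l + u * w * (r - 1) ^ 2 / r + v * w * (l - r) ^ 2 / (l * r) := by
    field_simp
    ring
  have : 0 ≤ u * v * (l - 1) ^ 2 / l + u * w * (r - 1) ^ 2 / r +
      v * w * (l - r) ^ 2 / (l * r) := by positivity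
  linarith

/-- In `φ''` the summands `u₁`, `u₂`, `u₃` of `φ'` reappear with weights `1`, `2m + 1`, `2m + 3`.
Cauchy-Schwarz with these weights lets `-φ''` be cancelled, and what remains is `k² (2z Σ + φ) < 2
(n - kc)`, where `Σ` is the sum with inverse weights. -/
theorem curvatureCondition_trinomial {n k : ℕ} (hk : 0 < k) (hc : 0 < c)
    (hA : 0 < A) (hB : 0 < B) (hD : 0 < D)
    (hbound : (k : ℝ) ^ 2 * (4 * A + 4 * B + (4 * m + 8) / (2 * m + 3) * D) < 2 * (n - k * c)) :
    CurvatureCondition n k c (trinomial m c A B D) := by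
  intro x hx
  obtain ⟨y, hy⟩ : ∃ y, y = x / c := ⟨_, rfl⟩
  have hy1 : y ^ 2 ≤ 1 := by
    rw [sq_le_one_iff_abs_le_one, hy, abs_div, abs_of_pos hc]
    exact div_le_one_of_le₀ (abs_le.2 hx) hc.le
  obtain ⟨v, hv⟩ : ∃ v, v = (y ^ 2) ^ m := ⟨_, rfl⟩
  have hv0 : 0 ≤ v := by rw [hv]; positivity
  have hv1 : v ≤ 1 := by rw [hv]; exact pow_le_one₀ (sq_nonneg y) hy1
  obtain ⟨z, hz⟩ : ∃ z, z = y ^ 2 := ⟨_, rfl⟩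
  have hz0 : 0 ≤ z := by rw [hz]; positivity
  have hz1 : z ≤ 1 := hz ▸ hy1
  have hvz : v * z ≤ 1 := mul_le_one₀ hv1 hz0 hz1
  have hvzz : v * z * z ≤ 1 := mul_le_one₀ hvz hz0 hz1
  obtain ⟨u₁, hu₁⟩ : ∃ u, u = 2 * A := ⟨_, rfl⟩
  obtain ⟨u₂, hu₂⟩ : ∃ u, u = (2 * m + 2) * B * v := ⟨_, rfl⟩
  obtain ⟨u₃, hu₃⟩ : ∃ u, u = (2 * m + 4) * D * (v * z) := ⟨_, rfl⟩
  have e0 : trinomial m c A B D x =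
      A * (1 - z) + B * (1 - v * z) + D * (1 - v * z * z) := by
    rw [trinomial, ← hy, hv, hz]; ring
  have e1 : deriv (trinomial m c A B D) x = -(y * (u₁ + u₂ + u₃)) / c := by
    rw [(hasDerivAt_trinomial m c A B D x).deriv, ← hy, hu₁, hu₂, hu₃, hv, hz]; ring
  have e2 : deriv (deriv (trinomial m c A B D)) x =
      -(u₁ + (2 * m + 1) * u₂ + (2 * m + 3) * u₃) / c ^ 2 := by
    rw [(hasDerivAt_deriv_trinomial m c A B D x).deriv, ← hy, hu₁, hu₂, hu₃, hv, hz]; ring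
  have p1 : 0 < u₁ := by rw [hu₁]; positivity
  have p2 : 0 ≤ u₂ := by rw [hu₂]; positivity
  have p3 : 0 ≤ u₃ := by rw [hu₃]; positivity
  have cs := sq_add_le p1.le p2 p3 (l := 2 * m + 1) (r := 2 * m + 3) (by positivity) (by positivity)
  obtain ⟨L, hL⟩ : ∃ L, L = u₁ + (2 * m + 1) * u₂ + (2 * m + 3) * u₃ := ⟨_, rfl⟩
  -- Strict concavity at `x = 0`, where the higher powers may contribute nothing, comes from `A >
  -- 0`.
  have hL0 : 0 < L := by rw [hL]; positivity
  rw [← hL] at cs e2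
  have hB1 : (2 * (m : ℝ) + 2) / (2 * m + 1) ≤ 2 := by
    rw [div_le_iff₀ (by positivity)]
    linarith [Nat.cast_nonneg (α := ℝ) m]
  have hB0 : 1 ≤ (2 * (m : ℝ) + 2) / (2 * m + 1) := by
    rw [le_div_iff₀ (by positivity)]; linarith
  have hD0 : 1 ≤ (2 * (m : ℝ) + 4) / (2 * m + 3) := by
    rw [le_div_iff₀ (by positivity)]; linarith
  -- Each of the three monomials is bounded separately on `0 ≤ z ≤ 1`. For `B` the factor `2
  -- (2m+2)/(2m+1)` is rounded up to `4`, which costs nothing since `B` will be small; for `D` it is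
  -- kept exact.
  have hS : 2 * z * (u₁ + u₂ / (2 * m + 1) + u₃ / (2 * m + 3)) + trinomial m c A B D x ≤
      4 * A + 4 * B + (4 * m + 8) / (2 * m + 3) * D := by
    rw [e0, hu₁, hu₂, hu₃, show (4 * (m : ℝ) + 8) / (2 * m + 3) =
      2 * ((2 * m + 4) / (2 * m + 3)) by ring,
      show (2 * (m : ℝ) + 2) * B * v / (2 * m + 1) = (2 * m + 2) / (2 * m + 1) * (B * v) by ring,
      show (2 * (m : ℝ) + 4) * D * (v * z) / (2 * m + 3) =
        (2 * m + 4) / (2 * m + 3) * (D * (v * z)) by ring]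
    generalize (2 * (m : ℝ) + 2) / (2 * m + 1) = β at *
    generalize (2 * (m : ℝ) + 4) / (2 * m + 3) = ρ at *
    have t1 : 0 ≤ A * (1 - z) := mul_nonneg hA.le (by linarith)
    have t2 : 0 ≤ B * (2 * (2 - β) * (v * z) + 3 * (1 - v * z)) := by
      have : 0 ≤ 2 - β := by linarith
      have : 0 ≤ 1 - v * z := by linarith
      positivity
    have t3 : 0 ≤ D * ((2 * ρ - 1) * (1 - v * z * z)) := by
      have : 0 ≤ 2 * ρ - 1 := by linarith
      have : 0 ≤ 1 - v * z * z := by linarith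
      positivity
    linarith
  rw [e1, e2]
  refine ⟨by rw [neg_div]; exact neg_lt_zero.2 (by positivity), ?_⟩
  have hk2 : (0 : ℝ) < (k : ℝ) ^ 2 := by positivity
  have hS' := mul_le_mul_of_nonneg_left hS hk2.le
  have hcs' := mul_le_mul_of_nonneg_left cs (show 0 ≤ 2 * (k : ℝ) ^ 2 * z by positivity)
  have e3 : 2 * (k : ℝ) ^ 2 * (-(y * (u₁ + u₂ + u₃)) / c) ^ 2 =
      2 * (k : ℝ) ^ 2 * z * (u₁ + u₂ + u₃) ^ 2 / c ^ 2 := by rw [hz]; ring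
  have e4 : -(-L / c ^ 2) * (2 * (n - k * c) - (k : ℝ) ^ 2 * trinomial m c A B D x) =
      L * (2 * (n - k * c) - (k : ℝ) ^ 2 * trinomial m c A B D x) / c ^ 2 := by ring
  rw [e3, e4]
  refine (div_lt_div_iff_of_pos_right (by positivity)).2 (hcs'.trans_lt ?_)
  have h5 : 2 * (k : ℝ) ^ 2 * z * (u₁ + u₂ / (2 * m + 1) + u₃ / (2 * m + 3)) <
      2 * (n - k * c) - (k : ℝ) ^ 2 * trinomial m c A B D x := by linarith
  calc _ = L * (2 * (k : ℝ) ^ 2 * z * (u₁ + u₂ / (2 * m + 1) + u₃ / (2 * m + 3))) := by ring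
    _ < _ := mul_lt_mul_of_pos_left h5 hL0

/-- The metric generated by `phi`, for admissible parameters. -/
theorem exists_metric_phi {n k : ℕ} (hk : 0 < k) (hc : 0 < c) (hkc : k * c < n) {δ α : ℝ}
    (hm : 2 * (k : ℝ) ^ 2 * c / (2 * m + 3) + 4 * (k : ℝ) ^ 2 * (m + 2) * δ < n - k * c)
    (hδ : (m + 1) * δ < c / (m + 2)) (hα : 0 < α) (hαδ : α * c ^ 2 < δ) :
    ∃ g : Metric n k, g.IsKahler ∧ g.IsUnitaryInvariant ∧
      g.IsGeneratedBy (-c) c (phi (m + 2) c (c / (m + 2 : ℕ) + δ) α) ∧ g.HolSecPos := by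
  rw [phi_eq_trinomial hc]
  obtain ⟨A, hA'⟩ : ∃ A, A = α * c ^ 2 := ⟨_, rfl⟩
  rw [← hA'] at hαδ ⊢
  have hA : 0 < A := by rw [hA']; positivity
  have hm0 : (0 : ℝ) ≤ m := Nat.cast_nonneg m
  have hmA : (m + 1) * A ≤ (m + 1) * δ := by gcongr
  obtain ⟨B, hB'⟩ : ∃ B, B = (m + 2) * δ - (m + 1) * A := ⟨_, rfl⟩
  obtain ⟨D, hD'⟩ : ∃ D, D = c / (m + 2) - (m + 1) * δ + m * A := ⟨_, rfl⟩
  rw [← hB', ← hD']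
  -- Since `A < δ`, `B` exceeds `δ`.
  have hB : 0 < B := by rw [hB']; linarith
  have hD : 0 < D := by
    have : 0 ≤ m * A := by positivity
    rw [hD']; linarith
  have hsum : A + (m + 1) * B + (m + 2) * D = c := by
    rw [hB', hD']; field_simp; ring
  obtain ⟨W, hW⟩ := exists_profile_trinomial hk hc hkc hA hB hD hsum
  refine ⟨hW.metric, hW.isKahler_metric, hW.isUnitaryInvariant_metric, hW.isGeneratedBy_metric,
    hW.holSecPos_metric (curvatureCondition_trinomial hk hc hA hB hD ?_)⟩
  have hk2 : (0 : ℝ) < (k : ℝ) ^ 2 := by positivity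
  -- The main term `(4m+8)/(2m+3) · c/(m+2) = 4c/(2m+3)` is kept exact. The excess `4mA` is absorbed
  -- by the negative multiple of `A` in `4B`, so that `A` disappears from the bound.
  have hD1 : (4 * m + 8) / (2 * m + 3) * D ≤ 4 * c / (2 * m + 3) + 4 * (m * A) := by
    have h1 : D ≤ c / (m + 2) + m * A := by
      have : 0 ≤ (m + 1) * δ := le_trans (by positivity) hmA
      rw [hD']; linarith
    have h2 : (4 * m + 8) / (2 * m + 3) ≤ (4 : ℝ) := by
      rw [div_le_iff₀ (by positivity)]; linarith
    calc (4 * m + 8) / (2 * m + 3) * D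
        ≤ (4 * m + 8) / (2 * m + 3) * (c / (m + 2) + m * A) := by gcongr
      _ = 4 * c / (2 * m + 3) + (4 * m + 8) / (2 * m + 3) * (m * A) := by field_simp; ring
      _ ≤ _ := by gcongr
  have h3 : 4 * A + 4 * B + (4 * m + 8) / (2 * m + 3) * D ≤
      4 * c / (2 * m + 3) + 8 * ((m + 2) * δ) := by
    rw [hB']; nlinarith
  calc _ ≤ (k : ℝ) ^ 2 * (4 * c / (2 * m + 3) + 8 * ((m + 2) * δ)) := by gcongr
    _ = 2 * (2 * (k : ℝ) ^ 2 * c / (2 * m + 3) + 4 * (k : ℝ) ^ 2 * (m + 2) * δ) := by ring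
    _ < _ := by linarith

/-! ### The sequence `ε_p`. -/

theorem eps_pos {n k p : ℕ} (hn : 0 < n) (hp : 1 ≤ p) : 0 < eps n k p := by
  have h1 : (1 : ℝ) ≤ p := by exact_mod_cast hp
  have h2 : (0 : ℝ) ≤ k := Nat.cast_nonneg k
  have h3 : (0 : ℝ) < n := by exact_mod_cast hn
  exact div_pos (by positivity) (by linarith)

theorem tendsto_eps (n k : ℕ) : Filter.Tendsto (eps n k) Filter.atTop (𝓝 0) := by
  refine Filter.Tendsto.const_div_atTop ?_ _
  have h : Filter.Tendsto (fun p : ℕ => 2 * (p : ℝ) + (2 * k - 1)) Filter.atTop Filter.atTop :=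
    Filter.tendsto_atTop_add_const_right _ _
      (tendsto_natCast_atTop_atTop.const_mul_atTop two_pos)
  exact h.congr fun p => by ring

end Polynomials

end Hirzebruch

end

/-! ### Choice of the constants. -/

theorem mainTheorem2 (n k : ℕ) (hn : 2 ≤ n) (hk : 1 ≤ k) :
    ∃ p₀ : ℕ,
      (∀ p : ℕ, p₀ ≤ p → 0 < Hirzebruch.eps n k p) ∧
      Filter.Tendsto (Hirzebruch.eps n k) Filter.atTop (nhds 0) ∧
      ∃ p₁ : ℝ → ℕ, ∀ q : ℕ, p₀ ≤ q →
        ∀ c : ℝ, 0 < c → c ≤ (n : ℝ) / k - 2 * Hirzebruch.eps n k q →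
          p₀ < p₁ c ∧
          ∀ p : ℕ, p₁ c ≤ p →
            ∃ δ₁ > (0 : ℝ), ∃ δ₂ > (0 : ℝ), ∀ α₂ ∈ Set.Ioo (0 : ℝ) δ₁,
              ∃ g : Hirzebruch.Metric n k,
                g.IsKahler ∧ g.IsUnitaryInvariant ∧
                g.IsGeneratedBy (-c) c (Hirzebruch.phi p c (c / p + δ₂) α₂) ∧
                g.HolSecPos := by
  -- The summand `4` makes `p₁ > p₀ = 3`; with `p = m + 2`, the ceiling makes `m` at least `k² c /
  -- (n - kc)`.
  refine ⟨3, fun p hp => Hirzebruch.eps_pos (by omega) (by omega), Hirzebruch.tendsto_eps n k,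
    fun c => ⌈(k : ℝ) ^ 2 * c / (n - k * c)⌉₊ + 4, fun q hq c hc hcq =>
      ⟨by simp, fun p hp => ?_⟩⟩
  simp only at hp
  obtain ⟨m, rfl⟩ : ∃ m, p = m + 2 := ⟨p - 2, by omega⟩
  have hk0 : (0 : ℝ) < k := by exact_mod_cast hk
  have hq0 := Hirzebruch.eps_pos (n := n) (k := k) (p := q) (by omega) (by omega)
  -- The margin `2 ε_q` enters only through its positivity, as `c < n/k`; this is why `p₁` depends
  -- on `c` and not on `q`.
  have hkc : k * c < n := by
    have : c < n / k := by linarith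
    rwa [lt_div_iff₀' hk0] at this
  have hK : 0 < n - k * c := sub_pos.2 hkc
  have hceil : (k : ℝ) ^ 2 * c / (n - k * c) ≤ m :=
    (Nat.le_ceil _).trans (Nat.cast_le.2 (by omega))
  rw [div_le_iff₀ hK] at hceil
  -- As `2m + 3 = 2p - 1`, this is equivalent to `c < n/k - ε_p`.
  have hgap : 2 * (k : ℝ) ^ 2 * c / (2 * m + 3) < n - k * c := by
    rw [div_lt_iff₀ (by positivity)]
    nlinarith
  obtain ⟨ε, hε⟩ : ∃ ε, ε = n - k * c - 2 * (k : ℝ) ^ 2 * c / (2 * m + 3) := ⟨_, rfl⟩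
  have hε0 : 0 < ε := by rw [hε]; linarith
  obtain ⟨δ, hδ, hδ1, hδ2⟩ : ∃ δ : ℝ, 0 < δ ∧ 4 * (k : ℝ) ^ 2 * (m + 2) * δ < ε ∧
      (m + 1) * δ < c / (m + 2) := by
    refine ⟨min (ε / (8 * (k : ℝ) ^ 2 * (m + 2))) (c / (2 * (m + 1) * (m + 2))), by positivity,
      ?_, ?_⟩
    · calc _ ≤ 4 * (k : ℝ) ^ 2 * (m + 2) * (ε / (8 * (k : ℝ) ^ 2 * (m + 2))) := by
            gcongr; exact min_le_left _ _
        _ = ε / 2 := by field_simp; norm_num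
        _ < ε := half_lt_self hε0
    · calc _ ≤ (m + 1) * (c / (2 * (m + 1) * (m + 2))) := by gcongr; exact min_le_right _ _
        _ = c / (m + 2) / 2 := by field_simp
        _ < c / (m + 2) := half_lt_self (by positivity)
  -- The value of `δ₁` is chosen so that `A = α c²` stays below `δ`.
  refine ⟨δ / c ^ 2, by positivity, δ, hδ, fun α hα => ?_⟩
  exact Hirzebruch.exists_metric_phi hk hc hkc (by linarith) hδ2 hα.1
    ((lt_div_iff₀ (by positivity)).1 hα.2)
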